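/- Let $(M,g)$ be a smooth Riemannian $n$-manifold (Hausdorff, second countable, without boundary), let $\mathcal E\to M$ be a smooth real vector bundle of finite rank with a smooth fibre metric $\langle\,,\rangle$ and a smooth connection $\nabla$ compatible with $\langle\,,\rangle$, and let $p,q\in\mathbb R$. For a smooth section $\sigma$ of $\mathcal E$ put $$F=\tfrac12|\sigma|^2,\qquad w(\sigma)=\frac1{1+|\sigma|^2},\qquad \nabla^*\nabla\sigma=-\operatorname{Trace}\nabla^2\sigma,\qquad \Delta F=-\operatorname{Trace}\nabla dF,$$ let $\nabla F$ be the gradient of $F$ and, for a relatively compact open set $U\subseteq M$, let $$E^v_{p,q}(\sigma;U)=\frac12\int_U w^p(\sigma)\bigl(|\nabla\sigma|^2+q|\nabla F|^2\bigr)\operatorname{vol}(g)$$ be the vertical $(p,q)$-energy of $\sigma$ over $U$. A smooth variation of $\sigma$ supported in $U$ is a family of sections $\sigma_t$ $(t\in\mathbb R)$ of $\mathcal E$ such that $(x,t)\mapsto\sigma_t(x)$ is smooth, $\sigma_0=\sigma$, and all $\sigma_t$ agree with $\sigma$ outside of one compact subset of $U$; its variation field is $\rho(x)=\frac{d}{dt}\big|_{t=0}\sigma_t(x)$.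 (If $M$ is compact one may take $U=M$, and then every smooth variation is allowed.) The section $\sigma$ is called $(p,q)$-harmonic if $\frac{d}{dt}\big|_{t=0}E^v_{p,q}(\sigma_t;U)=0$ for every relatively compact open $U$ and every smooth variation $\sigma_t$ of $\sigma$ supported in $U$. Theorem 3.6. Let $\sigma$ be a smooth section of $\mathcal E$. (1) For every relatively compact open $U\subseteq M$ and every smooth variation $\sigma_t$ of $\sigma$ supported in $U$, with variation field $\rho$, the integrals below converge absolutely, $t\mapsto E^v_{p,q}(\sigma_t;U)$ is differentiable at $0$, and $$\frac{d}{dt}\Big|_{t=0}E^v_{p,q}(\sigma_t;U)=\int_M\Bigl(w^p(\sigma)\bigl\langle\nabla^*\nabla\sigma+q\,\Delta F\,\sigma,\rho\bigr\rangle+p\,w^{p+1}(\sigma)\bigl\langle2\nabla_{\nabla F}\sigma+q|\nabla F|^2\sigma-|\nabla\sigma|^2\sigma,\rho\bigr\rangle\Bigr)\operatorname{vol}(g).$$ (2) $\sigma$ is $(p,q)$-harmonic if and only if $T_p(\sigma)=\phi_{p,q}(\sigma)\,\sigma$, where $$T_p(\sigma)=(1+2F)\nabla^*\nabla\sigma+2p\,\nabla_{\nabla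 F}\sigma,\qquad \phi_{p,q}(\sigma)=p|\nabla\sigma|^2-pq|\nabla F|^2-q(1+2F)\Delta F.$$ -/

import Mathlib

open Bundle MeasureTheory
open scoped Manifold ContDiff ENNReal

noncomputable section

namespace PQHarmonic

section Base

variable {n : ℕ} {M : Type*} [TopologicalSpace M] [ChartedSpace (EuclideanSpace ℝ (Fin n)) M]

instance instFiniteDimensionalTangent (x : M) : FiniteDimensional ℝ (TangentSpace (𝓡 n) x) :=
  inferInstanceAs (FiniteDimensional ℝ (EuclideanSpace ℝ (Fin n)))

variable [IsManifold (𝓡 n) ∞ M]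
  [RiemannianBundle (fun x : M ↦ TangentSpace (𝓡 n) x)]

/-- An orthonormal basis of the tangent space at `x`. Everything below that is written with it
is independent of the choice. -/
def tangentBasis (x : M) :
    OrthonormalBasis (Fin (Module.finrank ℝ (TangentSpace (𝓡 n) x))) ℝ (TangentSpace (𝓡 n) x) :=
  stdOrthonormalBasis ℝ (TangentSpace (𝓡 n) x)

/-! ### Gradient, Levi-Civita connection, Laplace-Beltrami operator -/

/-- The gradient vector of `f` at `x`: `∑ i, df(Eᵢ) Eᵢ` for an orthonormal basis `Eᵢ`. -/
def gradient (f : M → ℝ) (x : M) : TangentSpace (𝓡 n) x :=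
  ∑ i, mvfderiv (𝓡 n) f x (tangentBasis x i) • tangentBasis x i

/-- The right-hand side of the Koszul formula: for vector fields `X`, `Y`, `Z`,
`½ (X⟨Y,Z⟩ + Y⟨Z,X⟩ - Z⟨X,Y⟩ + ⟨[X,Y],Z⟩ - ⟨[Y,Z],X⟩ + ⟨[Z,X],Y⟩)` at `x`. -/
def koszul (X Y Z : Π x : M, TangentSpace (𝓡 n) x) (x : M) : ℝ :=
  (1 / 2) *
    (mvfderiv (𝓡 n) (fun y ↦ inner ℝ (Y y) (Z y)) x (X x)
      + mvfderiv (𝓡 n) (fun y ↦ inner ℝ (Z y) (X y)) x (Y x)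
      - mvfderiv (𝓡 n) (fun y ↦ inner ℝ (X y) (Y y)) x (Z x)
      + inner ℝ (VectorField.mlieBracket (𝓡 n) X Y x) (Z x)
      - inner ℝ (VectorField.mlieBracket (𝓡 n) Y Z x) (X x)
      + inner ℝ (VectorField.mlieBracket (𝓡 n) Z X x) (Y x))

/-- A vector field, smooth near `x`, whose value at `x` is the tangent vector `v`. -/
def extendVector {x : M} (v : TangentSpace (𝓡 n) x) : Π y : M, TangentSpace (𝓡 n) y :=
  FiberBundle.extend (EuclideanSpace ℝ (Fin n)) v

/-- The Levi-Civita derivative `∇_v Y` at `x` of a vector field `Y` in the direction of the tangent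
vector `v` at `x`, given by the Koszul formula. (The Koszul expression only depends on the values of
`X` and `Z` at `x`, so it does not matter which extensions of `v` and of the basis vectors are
used.) -/
def leviCivita (Y : Π x : M, TangentSpace (𝓡 n) x) (x : M) (v : TangentSpace (𝓡 n) x) :
    TangentSpace (𝓡 n) x :=
  ∑ k, koszul (extendVector v) Y (extendVector (tangentBasis x k)) x • tangentBasis x k

/-- The Laplace-Beltrami operator with the sign convention `Δf = - Trace ∇df`, that is
`Δf = - ∑ i, (Eᵢ(Eᵢ f) - (∇_{Eᵢ} Eᵢ) f)`. -/
def laplacian (f : M → ℝ) (x : M) : ℝ :=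
  -∑ i,
    (mvfderiv (𝓡 n)
        (fun y ↦ mvfderiv (𝓡 n) f y (extendVector (tangentBasis x i) y)) x (tangentBasis x i)
      - mvfderiv (𝓡 n) f x
        (leviCivita (extendVector (tangentBasis x i)) x (tangentBasis x i)))

/-! ### The Riemannian volume measure -/

/-- The Gram matrix `g_{ij} = g(∂ᵢ, ∂ⱼ)` of the metric in the chart around `x₀`, at the point of
the manifold with coordinates `y`. -/
def gramMatrix (x₀ : M) (y : EuclideanSpace ℝ (Fin n)) : Matrix (Fin n) (Fin n) ℝ :=
  let d : Fin n → TangentSpace (𝓡 n) ((extChartAt (𝓡 n) x₀).symm y) := fun i ↦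
    mfderiv 𝓘(ℝ, EuclideanSpace ℝ (Fin n)) (𝓡 n) (extChartAt (𝓡 n) x₀).symm y
      (EuclideanSpace.basisFun (Fin n) ℝ i)
  Matrix.of fun i j ↦ inner ℝ (d i) (d j)

/-- The measure on `M` which is `√(det g_{ij}) dy¹ ⋯ dyⁿ` on the domain of the preferred chart around
`x₀` and zero outside this domain. -/
def chartVolume [MeasurableSpace M] (x₀ : M) : Measure M :=
  Measure.map (extChartAt (𝓡 n) x₀).symm
    ((volume.restrict (extChartAt (𝓡 n) x₀).target).withDensity
      fun y ↦ ENNReal.ofReal (Real.sqrt (gramMatrix x₀ y).det))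

variable (n M) in
/-- The Riemannian volume measure `vol(g)`. The measures `chartVolume x₀` agree on the overlaps of
the chart domains, and their supremum in the lattice of measures is the measure that restricts
to each of them. -/
def volumeMeasure [MeasurableSpace M] : Measure M :=
  ⨆ x₀ : M, chartVolume (n := n) x₀

end Base

/-! ### Sections of a Riemannian vector bundle with a metric connection -/

section Section

variable {n : ℕ} {M : Type*} [TopologicalSpace M] [ChartedSpace (EuclideanSpace ℝ (Fin n)) M]
  [IsManifold (𝓡 n) ∞ M] [RiemannianBundle (fun x : M ↦ TangentSpace (𝓡 n) x)]
  {F : Type*} [NormedAddCommGroup F] [NormedSpace ℝ F]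
  {V : M → Type*} [TopologicalSpace (TotalSpace F V)]
  [∀ x, NormedAddCommGroup (V x)] [∀ x, InnerProductSpace ℝ (V x)] [FiberBundle F V]

/-- The function `½ |σ|²`. -/
def halfSq (σ : Π x : M, V x) (x : M) : ℝ := (1 / 2) * ‖σ x‖ ^ 2

/-- The function `w(σ) = 1 / (1 + |σ|²)`. -/
def weight (σ : Π x : M, V x) (x : M) : ℝ := 1 / (1 + ‖σ x‖ ^ 2)

/-- The function `|∇σ|² = ∑ i, |∇_{Eᵢ} σ|²`. -/
def normSqCov (nabla : CovariantDerivative (𝓡 n) F V) (σ : Π x : M, V x) (x : M) : ℝ :=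
  ∑ i, ‖nabla σ x (tangentBasis x i)‖ ^ 2

/-- The rough Laplacian `∇*∇σ = - Trace ∇²σ = - ∑ i, (∇_{Eᵢ} ∇_{Eᵢ} σ - ∇_{∇_{Eᵢ} Eᵢ} σ)`. -/
def roughLaplacian (nabla : CovariantDerivative (𝓡 n) F V) (σ : Π x : M, V x) (x : M) : V x :=
  -∑ i,
    (nabla (fun y ↦ nabla σ y (extendVector (tangentBasis x i) y)) x (tangentBasis x i)
      - nabla σ x (leviCivita (extendVector (tangentBasis x i)) x (tangentBasis x i)))

/-- The density `w^p(σ) (|∇σ|² + q |∇F|²)`, where `F = ½ |σ|²`. -/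
def energyDensity (nabla : CovariantDerivative (𝓡 n) F V) (p q : ℝ) (σ : Π x : M, V x) (x : M) :
    ℝ :=
  weight σ x ^ p *
    (normSqCov nabla σ x + q * ‖gradient (n := n) (halfSq σ) x‖ ^ 2)

/-- The vertical `(p,q)`-energy of `σ` over `U`. -/
def verticalEnergy [MeasurableSpace M] (nabla : CovariantDerivative (𝓡 n) F V) (p q : ℝ)
    (U : Set M) (σ : Π x : M, V x) : ℝ :=
  (1 / 2) * ∫ x in U, energyDensity nabla p q σ x ∂(volumeMeasure n M)

variable (n F) in
/-- `S` is a smooth variation of `σ` through sections, with compact support in `U`: the map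
`(x, t) ↦ S t x` is smooth, `S 0 = σ`, and all the `S t` agree with `σ` outside of some compact
subset of `U`. If `M` is compact and `U = M`, the support condition is empty. -/
structure IsVariation (σ : Π x : M, V x) (U : Set M) (S : ℝ → Π x : M, V x) : Prop where
  smooth : ContMDiff ((𝓡 n).prod 𝓘(ℝ, ℝ)) ((𝓡 n).prod 𝓘(ℝ, F)) ∞
    (fun z : M × ℝ ↦ (⟨z.1, S z.2 z.1⟩ : TotalSpace F V))
  zero : S 0 = σ
  support : ∃ K : Set M, IsCompact K ∧ K ⊆ U ∧ ∀ t, ∀ x ∉ K, S t x = σ x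

/-- The variation field `ρ = d/dt|₀ σ_t`. -/
def variationField (S : ℝ → Π x : M, V x) (x : M) : V x := deriv (fun t ↦ S t x) 0

/-- `σ` is a `(p,q)`-harmonic section: it is stationary for the vertical `(p,q)`-energy, over every
relatively compact open set `U` and with respect to smooth variations supported in `U`. If `M` is
compact this is stationarity for the energy over `M` under all smooth variations. -/
def IsHarmonicSection [MeasurableSpace M] (nabla : CovariantDerivative (𝓡 n) F V) (p q : ℝ)
    (σ : Π x : M, V x) : Prop :=
  ∀ U : Set M, IsOpen U → IsCompact (closure U) →
    ∀ S : ℝ → Π x : M, V x, IsVariation n F σ U S →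
      HasDerivAt (fun t ↦ verticalEnergy nabla p q U (S t)) 0 0

/-- `T_p(σ) = (1 + 2F) ∇*∇σ + 2p ∇_{∇F} σ`, where `F = ½ |σ|²`. -/
def opT (nabla : CovariantDerivative (𝓡 n) F V) (p : ℝ) (σ : Π x : M, V x) (x : M) : V x :=
  (1 + 2 * halfSq σ x) • roughLaplacian nabla σ x
    + (2 * p) • nabla σ x (gradient (halfSq σ) x)

/-- `φ_{p,q}(σ) = p |∇σ|² - p q |∇F|² - q (1 + 2F) ΔF`, where `F = ½ |σ|²`. -/
def opPhi (nabla : CovariantDerivative (𝓡 n) F V) (p q : ℝ) (σ : Π x : M, V x) (x : M) : ℝ :=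
  p * normSqCov nabla σ x - p * q * ‖gradient (n := n) (halfSq σ) x‖ ^ 2
    - q * (1 + 2 * halfSq σ x) * laplacian (n := n) (halfSq σ) x

/-- The integrand of the first variation formula, with `F = ½ |σ|²`:
`w^p(σ) ⟨∇*∇σ + q ΔF σ, ρ⟩ + p w^{p+1}(σ) ⟨2 ∇_{∇F} σ + q |∇F|² σ - |∇σ|² σ, ρ⟩`. -/
def firstVariationIntegrand (nabla : CovariantDerivative (𝓡 n) F V) (p q : ℝ)
    (σ ρ : Π x : M, V x) (x : M) : ℝ :=
  weight σ x ^ p *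
      inner ℝ (roughLaplacian nabla σ x + (q * laplacian (n := n) (halfSq σ) x) • σ x) (ρ x)
    + p * weight σ x ^ (p + 1) *
      inner ℝ ((2 : ℝ) • nabla σ x (gradient (halfSq σ) x)
        + (q * ‖gradient (n := n) (halfSq σ) x‖ ^ 2) • σ x - normSqCov nabla σ x • σ x) (ρ x)

end Section

end PQHarmonic

end

/-! Let `σ_t` be a variation with field `ρ`. Since `dF/dt = ⟨σ,ρ⟩` and the `t`-derivative commutes
with `∇`, half of the derivative of the energy density at `t = 0` is `w^p (∑ ⟨∇_i σ, ∇_i ρ⟩ + q ⟨∇F,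
∇⟨σ,ρ⟩⟩) - p w^(p+1) ⟨σ,ρ⟩ (|∇σ|² + q |∇F|²)`. The derivatives of `ρ` are removed by the one-form `ω
= w^p (⟨∇σ,ρ⟩ + q ⟨σ,ρ⟩ dF)` (`energyForm`). Metric compatibility and `d(w^p) = -2p w^(p+1) dF` show
that the expression above equals the integrand of the first variation formula plus `div ω`
(`divForm_energyForm`). As `ω` has compact support, the integral of `div ω` vanishes, and (1)
follows by differentiation under the integral sign.

For (2), `w^p = w^(p+1) (1 + 2F)` turns the integrand into `w^(p+1) ⟨T_p(σ) - φ_{p,q}(σ) σ, ρ⟩`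
(`firstVariationIntegrand_eq`). One direction is then immediate. The other is the fundamental lemma
of the calculus of variations: if the left entry is nonzero at a point, extend its value there to a
smooth section, cut this off by a bump function, and use the result as `ρ`; the first variation is
then positive.

The divergence theorem (`integral_divForm_eq_zero`) is proved from the definitions. The divergence
is a trace over an arbitrarily chosen orthonormal basis with arbitrarily extended basis vectors.
Tensoriality of the Koszul expression and of `∇η` allows computing it in the coordinate frame, and
Jacobi's formula for the derivative of a determinant gives `√det g · div η = ∑ ∂_i (√det g g^{ij}
η_j)`. In a chart, `vol(g)` has density `√det g`, so for forms supported in one chart the Euclidean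
statement applies; a partition of unity does the rest.

Families of sections are handled in a fixed local frame, where they become finitely many smooth
functions of `(x,t)`. The commutation of `d/dt` with `∇` is then the symmetry of second derivatives
(`hasDerivAt_cov`). -/

noncomputable section

namespace PQHarmonic

set_option linter.unusedSectionVars false

/-! ### Traces in arbitrary bases. -/

section LinearAlgebra

variable {E : Type*} [NormedAddCommGroup E] [InnerProductSpace ℝ E] {ι κ : Type*} [Fintype ι]
  [Fintype κ] [DecidableEq κ]

/-- The trace of a bilinear form with respect to an orthonormal basis, computed in an arbitrary
basis by means of the inverse of the Gram matrix. -/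
theorem sum_orthonormalBasis_eq_sum_gram_inv (e : OrthonormalBasis ι ℝ E) (b : Module.Basis κ ℝ E)
    (B : E →ₗ[ℝ] E →ₗ[ℝ] ℝ) :
    ∑ i, B (e i) (e i) =
      ∑ j, ∑ k, (Matrix.of fun j k ↦ inner ℝ (b j) (b k))⁻¹ j k * B (b j) (b k) := by
  classical
  set A : Matrix ι κ ℝ := Matrix.of fun i j ↦ b.repr (e i) j with hA
  set P : Matrix κ ι ℝ := Matrix.of fun j i ↦ inner ℝ (b j) (e i) with hP
  have he (i : ι) : e i = ∑ j, A i j • b j := (b.sum_repr (e i)).symm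
  have hb (j : κ) : b j = ∑ i, P j i • e i := by
    conv_lhs => rw [← e.sum_repr' (b j)]
    simp [hP, real_inner_comm]
  -- `A` expresses `e` through `b` and `P` expresses `b` through `e`. The index types may differ, so
  -- both one-sided identities are established. Orthonormality makes the Gram matrix `P Pᵀ`, with
  -- inverse `Aᵀ A`.
  have hPA : P * A = 1 := by
    ext j k
    have h : b j = ∑ k, (P * A) j k • b k := by
      conv_lhs => rw [hb j]
      simp_rw [Matrix.mul_apply, Finset.sum_smul]
      rw [Finset.sum_comm]
      refine Finset.sum_congr rfl fun i _ ↦ ?_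
      rw [he i, Finset.smul_sum]
      simp [mul_smul]
    have h2 := congrArg (fun v ↦ b.repr v k) h
    simp only [map_sum, map_smul, Module.Basis.repr_self, Finsupp.coe_finsetSum,
      Finset.sum_apply, Finsupp.coe_smul, Pi.smul_apply, smul_eq_mul] at h2
    rw [Finset.sum_eq_single k (fun l _ hl ↦ by simp [hl]) (by simp)] at h2
    simp only [Finsupp.single_eq_same, mul_one] at h2
    rw [← h2, Matrix.one_apply, Finsupp.single_apply]
  have hAP : A * P = 1 := by
    ext i k
    have h : e i = ∑ k, (A * P) i k • e k := by
      conv_lhs => rw [he i]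
      simp_rw [Matrix.mul_apply, Finset.sum_smul]
      rw [Finset.sum_comm]
      refine Finset.sum_congr rfl fun i _ ↦ ?_
      rw [hb i, Finset.smul_sum]
      simp [mul_smul]
    have h2 := congrArg (fun v ↦ inner ℝ v (e k)) h
    simp only [sum_inner, real_inner_smul_left, e.inner_eq_ite] at h2
    simp only [mul_ite, mul_one, mul_zero, Finset.sum_ite_eq', Finset.mem_univ, if_true] at h2
    rw [← h2, Matrix.one_apply]
  have hG : (Matrix.of fun j k ↦ inner ℝ (b j) (b k)) = P * P.transpose := by
    ext j k
    simp only [Matrix.mul_apply, Matrix.transpose_apply, Matrix.of_apply, hP]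
    rw [← e.sum_inner_mul_inner (b j) (b k)]
    simp [real_inner_comm]
  have hinv : (Matrix.of fun j k ↦ inner ℝ (b j) (b k))⁻¹ = A.transpose * A := by
    rw [hG]
    apply Matrix.inv_eq_left_inv
    calc A.transpose * A * (P * P.transpose) = A.transpose * (A * P) * P.transpose := by
          simp only [Matrix.mul_assoc]
      _ = (P * A).transpose := by rw [hAP, Matrix.mul_one, Matrix.transpose_mul]
      _ = 1 := by rw [hPA, Matrix.transpose_one]
  rw [hinv]
  have h1 (i : ι) : B (e i) (e i) = ∑ j, ∑ k, A i j * A i k * B (b j) (b k) := by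
    conv_lhs => rw [he i]
    simp only [map_sum, map_smul, LinearMap.sum_apply, LinearMap.smul_apply, smul_eq_mul,
      Finset.mul_sum]
    rw [Finset.sum_comm]
    refine Finset.sum_congr rfl fun j _ ↦ Finset.sum_congr rfl fun k _ ↦ ?_
    ring
  simp_rw [h1, Matrix.mul_apply, Matrix.transpose_apply, Finset.sum_mul]
  rw [Finset.sum_comm]
  exact Finset.sum_congr rfl fun j _ ↦ Finset.sum_comm

end LinearAlgebra

/-! ### Pointwise regularity of functions, sections and vector fields. -/

section Abbreviations

variable {M : Type*} [TopologicalSpace M] (n : ℕ) [ChartedSpace (EuclideanSpace ℝ (Fin n)) M]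
  (F : Type*) [NormedAddCommGroup F] [NormedSpace ℝ F]
  {V : M → Type*} [TopologicalSpace (TotalSpace F V)] [∀ x, TopologicalSpace (V x)]
  [FiberBundle F V]

/-- The section `s` is differentiable at `x`. -/
abbrev DiffSectionAt (s : Π x : M, V x) (x : M) : Prop :=
  MDifferentiableAt (𝓡 n) ((𝓡 n).prod 𝓘(ℝ, F)) (fun y ↦ (⟨y, s y⟩ : TotalSpace F V)) x

/-- The section `s` is smooth at `x`. -/
abbrev SmoothSectionAt (s : Π x : M, V x) (x : M) : Prop :=
  ContMDiffAt (𝓡 n) ((𝓡 n).prod 𝓘(ℝ, F)) ∞ (fun y ↦ (⟨y, s y⟩ : TotalSpace F V)) x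

/-- The function `f` is differentiable at `x`. -/
abbrev DiffFunAt (f : M → ℝ) (x : M) : Prop := MDifferentiableAt (𝓡 n) 𝓘(ℝ, ℝ) f x

/-- The function `f` is smooth at `x`. -/
abbrev SmoothFunAt (f : M → ℝ) (x : M) : Prop := ContMDiffAt (𝓡 n) 𝓘(ℝ, ℝ) ∞ f x

variable [IsManifold (𝓡 n) ∞ M]

/-- The vector field `X` is differentiable at `x`. -/
abbrev DiffFieldAt (X : Π x : M, TangentSpace (𝓡 n) x) (x : M) : Prop :=
  DiffSectionAt n (EuclideanSpace ℝ (Fin n)) X x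

/-- The vector field `X` is smooth at `x`. -/
abbrev SmoothFieldAt (X : Π x : M, TangentSpace (𝓡 n) x) (x : M) : Prop :=
  SmoothSectionAt n (EuclideanSpace ℝ (Fin n)) X x

end Abbreviations

/-! ### Algebraic properties of the Koszul expression. -/

section Koszul

variable {n : ℕ} {M : Type*} [TopologicalSpace M] [ChartedSpace (EuclideanSpace ℝ (Fin n)) M]
  [IsManifold (𝓡 n) ∞ M] [RiemannianBundle (fun x : M ↦ TangentSpace (𝓡 n) x)]
  [IsContMDiffRiemannianBundle (𝓡 n) ∞ (EuclideanSpace ℝ (Fin n))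
      (fun x : M ↦ TangentSpace (𝓡 n) x)]
  {X Y Z : Π x : M, TangentSpace (𝓡 n) x} {x : M}

instance isContMDiffRiemannianBundle_one_tangent :
    IsContMDiffRiemannianBundle (𝓡 n) 1 (EuclideanSpace ℝ (Fin n))
      (fun x : M ↦ TangentSpace (𝓡 n) x) :=
  IsContMDiffRiemannianBundle.of_le (n := ∞) (by simp)

theorem mdifferentiableAt_inner_tangent (hX : DiffFieldAt n X x) (hY : DiffFieldAt n Y x) :
    DiffFunAt n (fun y ↦ inner ℝ (X y) (Y y)) x :=
  hX.inner_bundle hY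

theorem mvfderiv_inner_smul_left {f : M → ℝ} (hf : DiffFunAt n f x) (hX : DiffFieldAt n X x)
    (hY : DiffFieldAt n Y x) (v : TangentSpace (𝓡 n) x) :
    mvfderiv (𝓡 n) (fun y ↦ inner ℝ ((f • X) y) (Y y)) x v =
      f x * mvfderiv (𝓡 n) (fun y ↦ inner ℝ (X y) (Y y)) x v
        + inner ℝ (X x) (Y x) * mvfderiv (𝓡 n) f x v := by
  have h : (fun y ↦ inner ℝ ((f • X) y) (Y y)) = f * fun y ↦ inner ℝ (X y) (Y y) := by
    ext y
    simp [real_inner_smul_left]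
  rw [h, mvfderiv_mul hf (mdifferentiableAt_inner_tangent hX hY)]
  simp

theorem mvfderiv_inner_comm (v : TangentSpace (𝓡 n) x) :
    mvfderiv (𝓡 n) (fun y ↦ inner ℝ (X y) (Y y)) x v =
      mvfderiv (𝓡 n) (fun y ↦ inner ℝ (Y y) (X y)) x v := by
  simp_rw [real_inner_comm]

theorem mvfderiv_inner_add_left {X' : Π x : M, TangentSpace (𝓡 n) x} (hX : DiffFieldAt n X x)
    (hX' : DiffFieldAt n X' x) (hY : DiffFieldAt n Y x) (v : TangentSpace (𝓡 n) x) :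
    mvfderiv (𝓡 n) (fun y ↦ inner ℝ ((X + X') y) (Y y)) x v =
      mvfderiv (𝓡 n) (fun y ↦ inner ℝ (X y) (Y y)) x v
        + mvfderiv (𝓡 n) (fun y ↦ inner ℝ (X' y) (Y y)) x v := by
  have h : (fun y ↦ inner ℝ ((X + X') y) (Y y)) =
      (fun y ↦ inner ℝ (X y) (Y y)) + fun y ↦ inner ℝ (X' y) (Y y) := by
    ext y
    simp [inner_add_left]
  rw [h, mvfderiv_add (mdifferentiableAt_inner_tangent hX hY)
    (mdifferentiableAt_inner_tangent hX' hY)]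
  simp

/-- The Koszul expression is tensorial in its third argument. -/
theorem tensorialAt_koszul_right (hX : DiffFieldAt n X x) (hY : DiffFieldAt n Y x) :
    TensorialAt (𝓡 n) (EuclideanSpace ℝ (Fin n)) (fun Z ↦ koszul X Y Z x) x where
  smul {f Z} hf hZ := by
    simp only [koszul]
    rw [mvfderiv_inner_comm (X := Y), mvfderiv_inner_smul_left hf hZ hY,
      mvfderiv_inner_smul_left hf hZ hX, VectorField.mlieBracket_smul_right hf hZ,
      VectorField.mlieBracket_smul_left hf hZ, mvfderiv_inner_comm (X := Z) (Y := Y)]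
    simp only [Pi.smul_apply', map_smul, inner_add_left, real_inner_smul_left,
      real_inner_smul_right, smul_eq_mul]
    rw [real_inner_comm (X x), real_inner_comm (Y x)]
    ring
  add {Z Z'} hZ hZ' := by
    simp only [koszul]
    rw [mvfderiv_inner_comm (X := Y), mvfderiv_inner_add_left hZ hZ' hY,
      mvfderiv_inner_add_left hZ hZ' hX, VectorField.mlieBracket_add_right hZ hZ',
      VectorField.mlieBracket_add_left hZ hZ', mvfderiv_inner_comm (X := Z) (Y := Y),
      mvfderiv_inner_comm (X := Z') (Y := Y)]
    simp only [Pi.add_apply, map_add, inner_add_left, inner_add_right]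
    ring

/-- The Koszul expression is tensorial in its first argument. -/
theorem tensorialAt_koszul_left (hY : DiffFieldAt n Y x) (hZ : DiffFieldAt n Z x) :
    TensorialAt (𝓡 n) (EuclideanSpace ℝ (Fin n)) (fun X ↦ koszul X Y Z x) x where
  smul {f X} hf hX := by
    simp only [koszul]
    rw [mvfderiv_inner_comm (X := Z), mvfderiv_inner_smul_left hf hX hZ,
      mvfderiv_inner_smul_left hf hX hY, VectorField.mlieBracket_smul_right hf hX,
      VectorField.mlieBracket_smul_left hf hX, mvfderiv_inner_comm (X := X) (Y := Z)]
    simp only [Pi.smul_apply', map_smul, inner_add_left, real_inner_smul_left,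
      real_inner_smul_right, smul_eq_mul]
    rw [real_inner_comm (Z x), real_inner_comm (Y x)]
    ring
  add {X X'} hX hX' := by
    simp only [koszul]
    rw [mvfderiv_inner_comm (X := Z), mvfderiv_inner_add_left hX hX' hY,
      mvfderiv_inner_add_left hX hX' hZ, VectorField.mlieBracket_add_right hX hX',
      VectorField.mlieBracket_add_left hX hX', mvfderiv_inner_comm (X := X) (Y := Z),
      mvfderiv_inner_comm (X := X') (Y := Z)]
    simp only [Pi.add_apply, map_add, inner_add_left, inner_add_right]
    ring

/-- The middle slot is the differentiated one. Of the derivatives of `f` coming from the metric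
terms and the brackets, only the Leibniz term of a connection survives. -/
theorem koszul_smul_middle {f : M → ℝ} (hf : DiffFunAt n f x) (hX : DiffFieldAt n X x)
    (hY : DiffFieldAt n Y x) (hZ : DiffFieldAt n Z x) :
    koszul X (f • Y) Z x =
      f x * koszul X Y Z x + mvfderiv (𝓡 n) f x (X x) * inner ℝ (Y x) (Z x) := by
  simp only [koszul]
  rw [mvfderiv_inner_comm (X := X), mvfderiv_inner_smul_left hf hY hZ,
    mvfderiv_inner_smul_left hf hY hX, VectorField.mlieBracket_smul_right hf hY,
    VectorField.mlieBracket_smul_left hf hY, mvfderiv_inner_comm (X := Y) (Y := X)]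
  simp only [Pi.smul_apply', map_smul, inner_add_left, real_inner_smul_left,
    real_inner_smul_right, smul_eq_mul]
  rw [real_inner_comm (X x), real_inner_comm (Z x)]
  ring

theorem koszul_add_middle {Y' : Π x : M, TangentSpace (𝓡 n) x} (hX : DiffFieldAt n X x)
    (hY : DiffFieldAt n Y x) (hY' : DiffFieldAt n Y' x) (hZ : DiffFieldAt n Z x) :
    koszul X (Y + Y') Z x = koszul X Y Z x + koszul X Y' Z x := by
  simp only [koszul]
  rw [mvfderiv_inner_comm (X := X), mvfderiv_inner_add_left hY hY' hX,
    mvfderiv_inner_add_left hY hY' hZ, VectorField.mlieBracket_add_right hY hY',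
    VectorField.mlieBracket_add_left hY hY', mvfderiv_inner_comm (X := Y) (Y := X),
    mvfderiv_inner_comm (X := Y') (Y := X)]
  simp only [Pi.add_apply, map_add, inner_add_left, inner_add_right]
  ring

end Koszul

/-! ### The divergence of a one-form and its independence of the frame. -/

section Divergence

variable {n : ℕ} {M : Type*} [TopologicalSpace M] [ChartedSpace (EuclideanSpace ℝ (Fin n)) M]
  [IsManifold (𝓡 n) ∞ M] [RiemannianBundle (fun x : M ↦ TangentSpace (𝓡 n) x)]

/-- The divergence `Trace ∇η` of a one-form `η`. -/
def divForm (η : Π x : M, TangentSpace (𝓡 n) x →L[ℝ] ℝ) (x : M) : ℝ :=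
  ∑ i,
    (mvfderiv (𝓡 n) (fun y ↦ η y (extendVector (tangentBasis x i) y)) x (tangentBasis x i)
      - η x (leviCivita (extendVector (tangentBasis x i)) x (tangentBasis x i)))

theorem laplacian_eq_neg_divForm (f : M → ℝ) (x : M) :
    laplacian (n := n) f x = -divForm (mvfderiv (𝓡 n) f) x := rfl

/-- The covariant derivative `(∇_Y η)(Z)` of a one-form. -/
def covForm (η : Π x : M, TangentSpace (𝓡 n) x →L[ℝ] ℝ) (Y Z : Π x : M, TangentSpace (𝓡 n) x)
    (x : M) : ℝ :=
  mvfderiv (𝓡 n) (fun y ↦ η y (Z y)) x (Y x)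
    - ∑ k, koszul Y Z (extendVector (tangentBasis x k)) x * η x (tangentBasis x k)

omit [RiemannianBundle (fun x : M ↦ TangentSpace (𝓡 n) x)] in
theorem extendVector_self {x : M} (v : TangentSpace (𝓡 n) x) : extendVector v x = v :=
  FiberBundle.extend_apply_self (F := EuclideanSpace ℝ (Fin n)) v

omit [RiemannianBundle (fun x : M ↦ TangentSpace (𝓡 n) x)] in
theorem smoothFieldAt_extendVector {x : M} (v : TangentSpace (𝓡 n) x) :
    SmoothFieldAt n (extendVector v) x :=
  FiberBundle.contMDiffAt_extend (𝓡 n) (EuclideanSpace ℝ (Fin n)) v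

omit [RiemannianBundle (fun x : M ↦ TangentSpace (𝓡 n) x)] in
theorem diffFieldAt_extendVector {x : M} (v : TangentSpace (𝓡 n) x) :
    DiffFieldAt n (extendVector v) x :=
  FiberBundle.mdifferentiableAt_extend (𝓡 n) (EuclideanSpace ℝ (Fin n)) v

theorem divForm_eq_sum_covForm (η : Π x : M, TangentSpace (𝓡 n) x →L[ℝ] ℝ) (x : M) :
    divForm η x = ∑ i, covForm η (extendVector (tangentBasis x i))
      (extendVector (tangentBasis x i)) x := by
  refine Finset.sum_congr rfl fun i _ ↦ ?_
  simp only [covForm, leviCivita, map_sum, map_smul, smul_eq_mul, extendVector_self]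

omit [RiemannianBundle (fun x : M ↦ TangentSpace (𝓡 n) x)] in
variable (n) in
/-- The one-form `η` maps vector fields that are differentiable at `x` to functions that are
differentiable at `x`. -/
def DiffFormAt (η : Π x : M, TangentSpace (𝓡 n) x →L[ℝ] ℝ) (x : M) : Prop :=
  ∀ Y : Π x : M, TangentSpace (𝓡 n) x, DiffFieldAt n Y x → DiffFunAt n (fun y ↦ η y (Y y)) x

variable [IsContMDiffRiemannianBundle (𝓡 n) ∞ (EuclideanSpace ℝ (Fin n))
      (fun x : M ↦ TangentSpace (𝓡 n) x)]
  {η : Π x : M, TangentSpace (𝓡 n) x →L[ℝ] ℝ} {X Y Z : Π x : M, TangentSpace (𝓡 n) x} {x : M}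

theorem tensorialAt_covForm_left (hZ : DiffFieldAt n Z x) :
    TensorialAt (𝓡 n) (EuclideanSpace ℝ (Fin n)) (fun Y ↦ covForm η Y Z x) x where
  smul {f Y} hf hY := by
    have h (k) := (tensorialAt_koszul_left hZ
      (diffFieldAt_extendVector (tangentBasis x k))).smul hf hY
    simp only [covForm, h, Pi.smul_apply', map_smul, smul_eq_mul, mul_sub, Finset.mul_sum, mul_assoc]
  add {Y Y'} hY hY' := by
    have h (k) := (tensorialAt_koszul_left hZ
      (diffFieldAt_extendVector (tangentBasis x k))).add hY hY'
    simp only [covForm, h, Pi.add_apply, map_add, add_mul, Finset.sum_add_distrib]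
    ring

/-- Replacing `Z` by `f Z` produces `df(Y) η(Z)` from the product rule and `∑ df(Y) ⟨Z, E_k⟩ η(E_k)`
from `koszul_smul_middle`. The two cancel once `η(Z)` is expanded in the orthonormal basis. -/
theorem tensorialAt_covForm_right (hη : DiffFormAt n η x) (hY : DiffFieldAt n Y x) :
    TensorialAt (𝓡 n) (EuclideanSpace ℝ (Fin n)) (fun Z ↦ covForm η Y Z x) x where
  smul {f Z} hf hZ := by
    have h (k) := koszul_smul_middle hf hY hZ (diffFieldAt_extendVector (tangentBasis x k))
    have h2 : (fun y ↦ η y ((f • Z) y)) = f * fun y ↦ η y (Z y) := by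
      ext y
      simp
    have h3 : η x (Z x) = ∑ k, inner ℝ (Z x) (tangentBasis x k) * η x (tangentBasis x k) := by
      conv_lhs => rw [← (tangentBasis x).sum_repr' (Z x)]
      simp [real_inner_comm]
    simp only [covForm, h, h2, extendVector_self, smul_eq_mul]
    rw [mvfderiv_mul hf (hη Z hZ)]
    simp only [add_apply, smul_apply, smul_eq_mul, h3,
      add_mul, Finset.sum_add_distrib, mul_sub, Finset.mul_sum, Finset.sum_mul]
    have h4 : ∀ k, mvfderiv (𝓡 n) f x (Y x) * inner ℝ (Z x) (tangentBasis x k) *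
        η x (tangentBasis x k) = inner ℝ (Z x) (tangentBasis x k) * η x (tangentBasis x k) *
          mvfderiv (𝓡 n) f x (Y x) := fun k ↦ by ring
    simp only [h4, mul_assoc]
    ring
  add {Z Z'} hZ hZ' := by
    have h (k) := koszul_add_middle hY hZ hZ' (diffFieldAt_extendVector (tangentBasis x k))
    have h2 : (fun y ↦ η y ((Z + Z') y)) = (fun y ↦ η y (Z y)) + fun y ↦ η y (Z' y) := by
      ext y
      simp
    simp only [covForm, h, h2]
    rw [mvfderiv_add (hη Z hZ) (hη Z' hZ')]
    simp only [add_apply, add_mul, Finset.sum_add_distrib]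
    ring

variable {κ : Type*} [Fintype κ] [DecidableEq κ]

/-- The divergence of a one-form in an arbitrary frame. -/
theorem divForm_eq_frame (hη : DiffFormAt n η x) (X : κ → Π x : M, TangentSpace (𝓡 n) x)
    (hX : ∀ i, DiffFieldAt n (X i) x) (b : Module.Basis κ ℝ (TangentSpace (𝓡 n) x))
    (hb : ∀ i, b i = X i x) :
    divForm η x = ∑ j, ∑ k, (Matrix.of fun j k ↦ inner ℝ (X j x) (X k x))⁻¹ j k *
      (mvfderiv (𝓡 n) (fun y ↦ η y (X k y)) x (X j x)
        - ∑ l, ∑ m, (Matrix.of fun j k ↦ inner ℝ (X j x) (X k x))⁻¹ l m *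
            (koszul (X j) (X k) (X l) x * η x (X m x))) := by
  -- Tensoriality turns `∇η` into a bilinear form on the tangent space at `x`. It may be evaluated
  -- with any differentiable extensions, here `X`, and its trace computed in any basis, here `b`.
  set B := TensorialAt.mkHom₂ (I := 𝓡 n) (F := EuclideanSpace ℝ (Fin n))
    (F' := EuclideanSpace ℝ (Fin n)) (fun Y Z ↦ covForm η Y Z x) x
    (fun τ hτ ↦ tensorialAt_covForm_left hτ) (fun σ hσ ↦ tensorialAt_covForm_right hη hσ) with hB
  have hB1 (v w : TangentSpace (𝓡 n) x) : B v w = covForm η (extendVector v) (extendVector w) x :=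
    TensorialAt.mkHom₂_apply_eq_extend (I := 𝓡 n) (F := EuclideanSpace ℝ (Fin n))
      (F' := EuclideanSpace ℝ (Fin n)) _ _ v w
  have hB2 (j k : κ) : B (b j) (b k) = covForm η (X j) (X k) x := by
    rw [hb, hb]
    exact TensorialAt.mkHom₂_apply (I := 𝓡 n) (F := EuclideanSpace ℝ (Fin n))
      (F' := EuclideanSpace ℝ (Fin n)) _ _ (hX j) (hX k)
  have h1 := sum_orthonormalBasis_eq_sum_gram_inv (tangentBasis x) b
    (LinearMap.mk₂ ℝ (fun v w ↦ B v w) (by simp) (by simp) (by simp) (by simp))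
  simp only [LinearMap.mk₂_apply] at h1
  rw [divForm_eq_sum_covForm]
  simp only [← hB1]
  rw [h1]
  simp only [hB2]
  simp only [hb]
  refine Finset.sum_congr rfl fun j _ ↦ Finset.sum_congr rfl fun k _ ↦ ?_
  congr 1
  rw [covForm]
  congr 1
  -- The same argument for the inner sum: it is the trace of `(v, w) ↦ K v * η w`, where `K` is the
  -- Koszul expression as a linear form in its third argument.
  have hK := tensorialAt_koszul_right (hX j) (hX k)
  set K := TensorialAt.mkHom (I := 𝓡 n) (F := EuclideanSpace ℝ (Fin n)) _ x hK with hKdef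
  have hK1 (v : TangentSpace (𝓡 n) x) : K v = koszul (X j) (X k) (extendVector v) x :=
    TensorialAt.mkHom_apply_eq_extend hK v
  have hK2 (l : κ) : K (b l) = koszul (X j) (X k) (X l) x := by
    rw [hb]
    exact TensorialAt.mkHom_apply hK (hX l)
  have h2 := sum_orthonormalBasis_eq_sum_gram_inv (tangentBasis x) b
    (LinearMap.mk₂ ℝ (fun v w ↦ K v * η x w) (by simp [add_mul]) (by simp [mul_assoc])
      (by simp [mul_add]) (fun _ _ _ ↦ by simp only [map_smul, smul_eq_mul]; ring))
  simp only [LinearMap.mk₂_apply] at h2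
  simp only [← hK1]
  rw [h2]
  simp only [hK2]
  simp only [hb]

end Divergence

/-! ### Derivatives of determinants and the coordinate formula for the divergence. -/

section MatrixCalculus

variable {κ : Type*} [Fintype κ] [DecidableEq κ]

/-- Jacobi's formula for the derivative of a determinant. -/
theorem hasDerivAt_det {A : ℝ → Matrix κ κ ℝ} {A' : Matrix κ κ ℝ} {t : ℝ}
    (hA : ∀ i j, HasDerivAt (fun s ↦ A s i j) (A' i j) t) :
    HasDerivAt (fun s ↦ (A s).det) ((A t).adjugate * A').trace t := by
  have h : ((A t).adjugate * A').trace = ∑ σ : Equiv.Perm κ, ((Equiv.Perm.sign σ : ℤ) : ℝ) *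
      ∑ i, (∏ j ∈ Finset.univ.erase i, A t (σ j) j) • A' (σ i) i := by
    -- By Cramer's rule, the `i`-th diagonal entry is the determinant with column `i` replaced by
    -- its derivative, which is also what the product rule gives in the Leibniz expansion.
    have h1 : ((A t).adjugate * A').trace = ∑ i, ((A t).updateCol i (fun k ↦ A' k i)).det := by
      rw [Matrix.trace]
      refine Finset.sum_congr rfl fun i _ ↦ ?_
      rw [← Matrix.cramer_apply, Matrix.cramer_eq_adjugate_mulVec]
      rfl
    rw [h1]
    simp_rw [Finset.mul_sum]
    rw [Finset.sum_comm]
    refine Finset.sum_congr rfl fun i _ ↦ ?_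
    rw [Matrix.det_apply']
    refine Finset.sum_congr rfl fun σ _ ↦ ?_
    rw [← Finset.prod_erase_mul _ _ (Finset.mem_univ i)]
    congr 1
    simp only [Matrix.updateCol_self, smul_eq_mul]
    congr 1
    refine Finset.prod_congr rfl fun j hj ↦ ?_
    rw [Matrix.updateCol_ne (Finset.ne_of_mem_erase hj)]
  rw [h]
  simp_rw [Matrix.det_apply']
  refine HasDerivAt.fun_sum fun σ _ ↦ HasDerivAt.const_mul _ ?_
  exact HasDerivAt.fun_finsetProd fun i _ ↦ hA (σ i) i

variable {E : Type*} [NormedAddCommGroup E] [NormedSpace ℝ E]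

theorem contDiffAt_det {G : E → Matrix κ κ ℝ} {y : E} {m : ℕ∞ω}
    (hG : ∀ i j, ContDiffAt ℝ m (fun z ↦ G z i j) y) :
    ContDiffAt ℝ m (fun z ↦ (G z).det) y := by
  simp_rw [Matrix.det_apply']
  exact ContDiffAt.sum fun σ _ ↦ contDiffAt_const.mul (contDiffAt_prod fun i _ ↦ hG (σ i) i)

/-- The entries of the inverse are cofactors divided by the determinant, and cofactors are
determinants of matrices with entries from `G` and constants. -/
theorem contDiffAt_inv_apply {G : E → Matrix κ κ ℝ} {y : E} {m : ℕ∞ω}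
    (hG : ∀ i j, ContDiffAt ℝ m (fun z ↦ G z i j) y) (hdet : (G y).det ≠ 0) (i j : κ) :
    ContDiffAt ℝ m (fun z ↦ (G z)⁻¹ i j) y := by
  simp only [Matrix.inv_def, Ring.inverse_eq_inv, Matrix.smul_apply, smul_eq_mul]
  refine ((contDiffAt_det hG).inv hdet).mul ?_
  simp only [Matrix.adjugate_apply]
  refine contDiffAt_det fun k l ↦ ?_
  simp only [Matrix.updateRow_apply]
  split_ifs
  · exact contDiffAt_const
  · exact hG k l

theorem fderiv_apply_eq_of_hasDerivAt {f : E → ℝ} {y e : E} {f' : ℝ} (hf : DifferentiableAt ℝ f y)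
    (h : HasDerivAt (fun t : ℝ ↦ f (y + t • e)) f' 0) : fderiv ℝ f y e = f' :=
  (hf.hasFDerivAt.hasLineDerivAt e).unique h

theorem fderiv_det_apply {G : E → Matrix κ κ ℝ} {y : E}
    (hG : ∀ i j, ContDiffAt ℝ 1 (fun z ↦ G z i j) y) (e : E) :
    fderiv ℝ (fun z ↦ (G z).det) y e =
      ∑ i, ∑ j, (G y).adjugate i j * fderiv ℝ (fun z ↦ G z j i) y e := by
  refine fderiv_apply_eq_of_hasDerivAt ((contDiffAt_det hG).differentiableAt one_ne_zero) ?_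
  have h := hasDerivAt_det (A := fun t : ℝ ↦ G (y + t • e)) (t := 0)
    (A' := Matrix.of fun i j ↦ fderiv ℝ (fun z ↦ G z i j) y e)
    fun i j ↦ ((hG i j).differentiableAt one_ne_zero).hasFDerivAt.hasLineDerivAt e
  simpa [Matrix.trace, Matrix.mul_apply] using h

theorem fderiv_sqrt_det_apply {G : E → Matrix κ κ ℝ} {y : E}
    (hG : ∀ i j, ContDiffAt ℝ 1 (fun z ↦ G z i j) y) (hdet : 0 < (G y).det) (e : E) :
    fderiv ℝ (fun z ↦ Real.sqrt (G z).det) y e =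
      Real.sqrt (G y).det * (1 / 2 * ∑ i, ∑ j, (G y)⁻¹ i j * fderiv ℝ (fun z ↦ G z j i) y e) := by
  rw [fderiv_sqrt ((contDiffAt_det hG).differentiableAt one_ne_zero) hdet.ne']
  simp only [smul_apply, fderiv_det_apply hG, smul_eq_mul, Matrix.inv_def,
    Ring.inverse_eq_inv, Matrix.smul_apply]
  have h : Real.sqrt (G y).det ≠ 0 := (Real.sqrt_pos.2 hdet).ne'
  have h2 : (G y).det = Real.sqrt (G y).det * Real.sqrt (G y).det :=
    (Real.mul_self_sqrt hdet.le).symm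
  simp only [mul_assoc, ← Finset.mul_sum]
  set S := ∑ i, ∑ j, (G y).adjugate i j * fderiv ℝ (fun z ↦ G z j i) y e
  rw [← mul_assoc (Real.sqrt _)]
  generalize Real.sqrt (G y).det = r at *
  rw [h2]
  field_simp

/-- The classical coordinate formula for the divergence: the trace of the covariant derivative of a
one-form `h`, with Christoffel symbols computed from the metric `G`, times the volume density is the
Euclidean divergence of the densitized vector field that is dual to `h`. -/
theorem sqrt_det_mul_trace_christoffel {G : E → Matrix κ κ ℝ} {y : E} {h : κ → E → ℝ} (e : κ → E)
    (hG : ∀ i j, ContDiffAt ℝ 1 (fun z ↦ G z i j) y) (hdet : 0 < (G y).det)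
    (hsymm : ∀ z i j, G z i j = G z j i) (hh : ∀ k, ContDiffAt ℝ 1 (h k) y) :
    Real.sqrt (G y).det * ∑ j, ∑ k, (G y)⁻¹ j k * (fderiv ℝ (h k) y (e j)
      - ∑ l, ∑ m, (G y)⁻¹ l m * (1 / 2 * (fderiv ℝ (fun z ↦ G z k l) y (e j)
          + fderiv ℝ (fun z ↦ G z l j) y (e k) - fderiv ℝ (fun z ↦ G z j k) y (e l)) * h m y)) =
    ∑ i, fderiv ℝ (fun z ↦ Real.sqrt (G z).det * ∑ j, (G z)⁻¹ i j * h j z) y (e i) := by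
  -- `u` is the vector field dual to `h`. Writing `h = G u` near `y` and differentiating this
  -- product avoids any derivative of the inverse matrix.
  set u : κ → E → ℝ := fun i z ↦ ∑ j, (G z)⁻¹ i j * h j z with hu
  have hu1 (i : κ) : ContDiffAt ℝ 1 (u i) y :=
    ContDiffAt.sum fun j _ ↦ (contDiffAt_inv_apply hG hdet.ne' i j).mul (hh j)
  have hsq : ContDiffAt ℝ 1 (fun z ↦ Real.sqrt (G z).det) y := (contDiffAt_det hG).sqrt hdet.ne'
  have hdet' : ∀ᶠ z in nhds y, (G z).det ≠ 0 :=
    (contDiffAt_det hG).continuousAt.eventually_ne hdet.ne'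
  have hunit : IsUnit (G y).det := isUnit_iff_ne_zero.2 hdet.ne'
  have hhu (k : κ) : h k =ᶠ[nhds y] fun z ↦ ∑ i, G z k i * u i z := by
    filter_upwards [hdet'] with z hz
    have h1 : (G z).mulVec ((G z)⁻¹.mulVec (fun j ↦ h j z)) = fun j ↦ h j z := by
      rw [Matrix.mulVec_mulVec, Matrix.mul_nonsing_inv _ (isUnit_iff_ne_zero.2 hz),
        Matrix.one_mulVec]
    exact (congrFun h1 k).symm
  have hd (j k : κ) : fderiv ℝ (h k) y (e j) = ∑ i, (G y k i * fderiv ℝ (u i) y (e j)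
      + u i y * fderiv ℝ (fun z ↦ G z k i) y (e j)) := by
    rw [(hhu k).fderiv_eq, fderiv_fun_sum fun i _ ↦
      ((hG k i).mul (hu1 i)).differentiableAt one_ne_zero, sum_apply]
    refine Finset.sum_congr rfl fun i _ ↦ ?_
    rw [fderiv_fun_mul ((hG k i).differentiableAt one_ne_zero)
      ((hu1 i).differentiableAt one_ne_zero)]
    simp
  have hr (i : κ) : fderiv ℝ (fun z ↦ Real.sqrt (G z).det * ∑ j, (G z)⁻¹ i j * h j z) y (e i) =
      Real.sqrt (G y).det * (fderiv ℝ (u i) y (e i) + u i y *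
        (1 / 2 * ∑ k, ∑ j, (G y)⁻¹ k j * fderiv ℝ (fun z ↦ G z j k) y (e i))) := by
    rw [fderiv_fun_mul (hsq.differentiableAt one_ne_zero) ((hu1 i).differentiableAt one_ne_zero)]
    simp only [add_apply, smul_apply, smul_eq_mul, fderiv_sqrt_det_apply hG hdet]
    ring
  simp_rw [hr, ← Finset.mul_sum]
  congr 1
  have hinvsymm (j k : κ) : (G y)⁻¹ j k = (G y)⁻¹ k j := by
    have : (G y).transpose = G y := by
      ext i j
      exact hsymm y j i
    conv_lhs => rw [← this, ← Matrix.transpose_nonsing_inv, Matrix.transpose_apply]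
  have hul (l : κ) (c : ℝ) : ∑ m, (G y)⁻¹ l m * (c * h m y) = u l y * c := by
    simp only [hu, Finset.sum_mul]
    exact Finset.sum_congr rfl fun m _ ↦ by ring
  set D : κ → κ → κ → ℝ := fun j k l ↦ fderiv ℝ (fun z ↦ G z k l) y (e j) with hD
  have hDs (j k l : κ) : D j k l = D j l k := by
    simp only [hD]
    congr 2
    ext z
    exact hsymm z k l
  have hDdef (j k l : κ) : fderiv ℝ (fun z ↦ G z k l) y (e j) = D j k l := rfl
  simp only [hul, hd, hDdef]
  have e1 : ∑ j, ∑ k, (G y)⁻¹ j k * ∑ i, G y k i * fderiv ℝ (u i) y (e j) =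
      ∑ i, fderiv ℝ (u i) y (e i) := by
    refine Finset.sum_congr rfl fun j _ ↦ ?_
    simp_rw [Finset.mul_sum]
    rw [Finset.sum_comm]
    have h1 (i : κ) : ∑ k, (G y)⁻¹ j k * (G y k i * fderiv ℝ (u i) y (e j)) =
        (1 : Matrix κ κ ℝ) j i * fderiv ℝ (u i) y (e j) := by
      rw [← Matrix.nonsing_inv_mul _ hunit, Matrix.mul_apply, Finset.sum_mul]
      exact Finset.sum_congr rfl fun k _ ↦ by ring
    simp_rw [h1, Matrix.one_apply]
    simp
  -- Contracted with the symmetric inverse matrix, the first two Christoffel terms coincide.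
  -- Together they cancel the derivatives of `G` from `h = G u`. What remains is the divergence of
  -- `u` (`e1`) and half the third term, which is the logarithmic derivative of `√det G` along `u`
  -- (`e3`).
  have e2 : ∑ j, ∑ k, (G y)⁻¹ j k * ∑ i, u i y * D k i j =
      ∑ j, ∑ k, (G y)⁻¹ j k * ∑ i, u i y * D j k i := by
    rw [Finset.sum_comm]
    refine Finset.sum_congr rfl fun j _ ↦ Finset.sum_congr rfl fun k _ ↦ ?_
    rw [hinvsymm]
    congr 1
    exact Finset.sum_congr rfl fun i _ ↦ by rw [hDs]
  have e3 : ∑ j, ∑ k, (G y)⁻¹ j k * ∑ i, u i y * D i j k =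
      ∑ i, u i y * ∑ k, ∑ j, (G y)⁻¹ k j * D i j k := by
    simp_rw [Finset.mul_sum]
    rw [Finset.sum_comm]
    have : ∀ k, ∑ j, ∑ i, (G y)⁻¹ j k * (u i y * D i j k) =
        ∑ i, ∑ j, u i y * ((G y)⁻¹ k j * D i j k) := fun k ↦ by
      rw [Finset.sum_comm]
      refine Finset.sum_congr rfl fun i _ ↦ Finset.sum_congr rfl fun j _ ↦ ?_
      rw [hinvsymm]
      ring
    simp_rw [this]
    rw [Finset.sum_comm]
  have e4 : ∀ j k, (G y)⁻¹ j k * (∑ i, (G y k i * fderiv ℝ (u i) y (e j) + u i y * D j k i)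
      - ∑ l, u l y * (1 / 2 * (D j k l + D k l j - D l j k))) =
      (G y)⁻¹ j k * ∑ i, G y k i * fderiv ℝ (u i) y (e j)
      + 1 / 2 * ((G y)⁻¹ j k * ∑ i, u i y * D j k i) - 1 / 2 * ((G y)⁻¹ j k * ∑ i, u i y * D k i j)
      + 1 / 2 * ((G y)⁻¹ j k * ∑ i, u i y * D i j k) := fun j k ↦ by
    have : ∑ l, u l y * (1 / 2 * (D j k l + D k l j - D l j k)) =
        1 / 2 * ∑ i, u i y * D j k i + 1 / 2 * ∑ i, u i y * D k i j
          - 1 / 2 * ∑ i, u i y * D i j k := by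
      simp_rw [Finset.mul_sum]
      rw [← Finset.sum_add_distrib, ← Finset.sum_sub_distrib]
      exact Finset.sum_congr rfl fun l _ ↦ by ring
    rw [this, Finset.sum_add_distrib]
    ring
  simp_rw [e4, Finset.sum_add_distrib, Finset.sum_sub_distrib, Finset.sum_add_distrib,
    ← Finset.mul_sum]
  rw [e1, e2, e3]
  have e5 : ∑ i, u i y * (1 / 2 * ∑ k, ∑ j, (G y)⁻¹ k j * D i j k) =
      1 / 2 * ∑ i, u i y * ∑ k, ∑ j, (G y)⁻¹ k j * D i j k := by
    rw [Finset.mul_sum]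
    exact Finset.sum_congr rfl fun i _ ↦ by ring
  rw [e5]
  ring

end MatrixCalculus

/-! ### Coordinate vector fields, the Gram matrix and the divergence in a chart. -/

section CoordinateFrame

variable {n : ℕ} {M : Type*} [TopologicalSpace M] [ChartedSpace (EuclideanSpace ℝ (Fin n)) M]

variable [IsManifold (𝓡 n) ∞ M]

local notation "E" => EuclideanSpace ℝ (Fin n)

/-- The coordinate vector field `∂ᵢ` of the preferred chart at `x₀`. -/
def coordFrame (x₀ : M) (i : Fin n) (x : M) : TangentSpace (𝓡 n) x :=
  (trivializationAt E (TangentSpace (𝓡 n)) x₀).symmL ℝ x (EuclideanSpace.basisFun (Fin n) ℝ i)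

variable {x₀ x : M}

theorem coordFrame_eq_mfderiv (hx : x ∈ (chartAt E x₀).source) (i : Fin n) :
    coordFrame x₀ i x = mfderivWithin 𝓘(ℝ, E) (𝓡 n) (extChartAt (𝓡 n) x₀).symm (Set.range (𝓡 n))
      (extChartAt (𝓡 n) x₀ x) (EuclideanSpace.basisFun (Fin n) ℝ i) := by
  rw [← TangentBundle.symmL_trivializationAt hx]
  rfl

theorem mfderiv_extChartAt_coordFrame (hx : x ∈ (chartAt E x₀).source) (i : Fin n) :
    mfderiv (𝓡 n) 𝓘(ℝ, E) (extChartAt (𝓡 n) x₀) x (coordFrame x₀ i x) =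
      EuclideanSpace.basisFun (Fin n) ℝ i := by
  rw [← TangentBundle.continuousLinearMapAt_trivializationAt (I := 𝓡 n) hx]
  exact (trivializationAt E (TangentSpace (𝓡 n)) x₀).continuousLinearMapAt_symmL (R := ℝ)
    (b := x) hx _

theorem smoothFieldAt_coordFrame (hx : x ∈ (chartAt E x₀).source) (i : Fin n) :
    SmoothFieldAt n (coordFrame x₀ i) x := by
  have h := contMDiffAt_localFrame_of_mem (I := 𝓡 n) ∞
    (trivializationAt E (TangentSpace (𝓡 n)) x₀)
    (EuclideanSpace.basisFun (Fin n) ℝ).toBasis i (x := x) hx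
  refine h.congr_of_eventuallyEq ?_
  filter_upwards [(chartAt E x₀).open_source.mem_nhds hx] with y hy
  have hy' : y ∈ (trivializationAt E (TangentSpace (𝓡 n)) x₀).baseSet := hy
  rw [Trivialization.localFrame_apply_of_mem_baseSet _ _ hy', coordFrame,
    Trivialization.symmL_apply _ hy']
  simp only [Trivialization.basisAt, Module.Basis.map_apply, OrthonormalBasis.coe_toBasis]
  rw [Trivialization.linearEquivAt_symm_apply]

theorem diffFieldAt_coordFrame (hx : x ∈ (chartAt E x₀).source) (i : Fin n) :
    DiffFieldAt n (coordFrame x₀ i) x :=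
  (smoothFieldAt_coordFrame hx i).mdifferentiableAt (by simp)

/-- The coordinate vector fields as a basis of the tangent space. -/
def coordBasis (hx : x ∈ (chartAt E x₀).source) : Module.Basis (Fin n) ℝ (TangentSpace (𝓡 n) x) :=
  (EuclideanSpace.basisFun (Fin n) ℝ).toBasis.map
    ((trivializationAt E (TangentSpace (𝓡 n)) x₀).linearEquivAt ℝ x hx).symm

theorem coordBasis_apply (hx : x ∈ (chartAt E x₀).source) (i : Fin n) :
    coordBasis hx i = coordFrame x₀ i x := by
  rw [coordBasis, coordFrame, Trivialization.symmL_apply _ hx, Module.Basis.map_apply,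
    OrthonormalBasis.coe_toBasis]
  exact Trivialization.linearEquivAt_symm_apply (R := ℝ) _ _ hx _

theorem mdifferentiableAt_extChartAt_symm {y : E} (hy : y ∈ (extChartAt (𝓡 n) x₀).target) :
    MDifferentiableAt 𝓘(ℝ, E) (𝓡 n) (extChartAt (𝓡 n) x₀).symm y :=
  ((contMDiffOn_extChartAt_symm (n := ∞) x₀).contMDiffAt
    ((isOpen_extChartAt_target x₀).mem_nhds hy)).mdifferentiableAt (by simp)

theorem mvfderiv_eq_fderiv_extChartAt {f : M → ℝ} (hf : DiffFunAt n f x)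
    (hx : x ∈ (chartAt E x₀).source) (v : TangentSpace (𝓡 n) x) :
    mvfderiv (𝓡 n) f x v =
      fderiv ℝ (f ∘ (extChartAt (𝓡 n) x₀).symm) (extChartAt (𝓡 n) x₀ x)
        (mfderiv (𝓡 n) 𝓘(ℝ, E) (extChartAt (𝓡 n) x₀) x v) := by
  have hx' : x ∈ (extChartAt (𝓡 n) x₀).source := by simpa using hx
  have hx2 : (extChartAt (𝓡 n) x₀).symm (extChartAt (𝓡 n) x₀ x) = x := (extChartAt _ _).left_inv hx'
  have h1 := mdifferentiableAt_extChartAt_symm ((extChartAt (𝓡 n) x₀).map_source hx')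
  have h2 : MDifferentiableAt 𝓘(ℝ, E) 𝓘(ℝ, ℝ) (f ∘ (extChartAt (𝓡 n) x₀).symm)
      (extChartAt (𝓡 n) x₀ x) := MDifferentiableAt.comp_of_eq _ hf h1 hx2
  have h3 : f =ᶠ[nhds x] (f ∘ (extChartAt (𝓡 n) x₀).symm) ∘ extChartAt (𝓡 n) x₀ := by
    filter_upwards [(isOpen_extChartAt_source x₀).mem_nhds hx'] with y hy
    simp only [Function.comp_apply, (extChartAt (𝓡 n) x₀).left_inv hy]
  have h4 := mfderiv_comp x h2 (mdifferentiableAt_extChartAt hx)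
  rw [← h3.mfderiv_eq, mfderiv_eq_fderiv] at h4
  exact congrArg (fun L ↦ L v) h4

theorem mvfderiv_coordFrame {f : M → ℝ} (hf : DiffFunAt n f x) (hx : x ∈ (chartAt E x₀).source)
    (i : Fin n) :
    mvfderiv (𝓡 n) f x (coordFrame x₀ i x) =
      fderiv ℝ (f ∘ (extChartAt (𝓡 n) x₀).symm) (extChartAt (𝓡 n) x₀ x)
        (EuclideanSpace.basisFun (Fin n) ℝ i) := by
  rw [mvfderiv_eq_fderiv_extChartAt hf hx, mfderiv_extChartAt_coordFrame hx]

/-- A constant vector field on the model space. -/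
def constField (v : E) : Π y : E, TangentSpace 𝓘(ℝ, E) y := fun _ ↦ v

theorem mdifferentiableAt_constField (v y : E) :
    DiffFieldAt n (constField v) y :=
  (contMDiffAt_vectorSpace_iff_contDiffAt.2 contDiffAt_const :
    ContMDiffAt _ _ 1 _ _).mdifferentiableAt one_ne_zero

/-- Near `x` the coordinate fields are pullbacks of constant fields under the chart. Pullback
commutes with the Lie bracket, and constant fields commute. -/
theorem mlieBracket_coordFrame (hx : x ∈ (chartAt E x₀).source) (i j : Fin n) :
    VectorField.mlieBracket (𝓡 n) (coordFrame x₀ i) (coordFrame x₀ j) x = 0 := by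
  have h (i : Fin n) : coordFrame x₀ i =ᶠ[nhds x] VectorField.mpullback (𝓡 n) 𝓘(ℝ, E)
      (extChartAt (𝓡 n) x₀) (constField (EuclideanSpace.basisFun (Fin n) ℝ i)) := by
    filter_upwards [(chartAt E x₀).open_source.mem_nhds hx] with y hy
    rw [VectorField.mpullback_apply]
    have hinv := isInvertible_mfderiv_extChartAt (I := 𝓡 n) (x := x₀) (y := y) (by simpa using hy)
    have h1 : constField (EuclideanSpace.basisFun (Fin n) ℝ i) (extChartAt (𝓡 n) x₀ y) =
        mfderiv (𝓡 n) 𝓘(ℝ, E) (extChartAt (𝓡 n) x₀) y (coordFrame x₀ i y) :=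
      (mfderiv_extChartAt_coordFrame hy i).symm
    rw [h1]
    exact (hinv.inverse_apply_self _).symm
  have hM : IsManifold (𝓡 n) (minSmoothness ℝ 2) M := by
    rw [minSmoothness_of_isRCLikeNormedField]
    infer_instance
  rw [(h i).mlieBracket_vectorField_eq (h j),
    ← VectorField.mpullback_mlieBracket (n := ∞) (mdifferentiableAt_constField _ _)
      (mdifferentiableAt_constField _ _) (contMDiffAt_extChartAt' hx)
      (by rw [minSmoothness_of_isRCLikeNormedField]; exact ENat.LEInfty.out)]
  have h2 (v w : E) : VectorField.mlieBracket 𝓘(ℝ, E) (constField v) (constField w) = 0 := by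
    rw [← VectorField.mlieBracketWithin_univ, VectorField.mlieBracketWithin_eq_lieBracketWithin]
    have hc (v y : E) : fderivWithin ℝ (constField v : E → E) Set.univ y = 0 :=
      congrFun (fderivWithin_const v) y
    funext y
    change (fderivWithin ℝ (constField w : E → E) Set.univ y) v
      - (fderivWithin ℝ (constField v : E → E) Set.univ y) w = 0
    rw [hc, hc]
    simp
  rw [h2]
  simp

theorem contDiffAt_comp_extChartAt_symm {f : M → ℝ} {y : E}
    (hy : y ∈ (extChartAt (𝓡 n) x₀).target)
    (hf : SmoothFunAt n f ((extChartAt (𝓡 n) x₀).symm y)) :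
    ContDiffAt ℝ ∞ (f ∘ (extChartAt (𝓡 n) x₀).symm) y :=
  contMDiffAt_iff_contDiffAt.1 (ContMDiffAt.comp (I' := 𝓡 n) y hf
    ((contMDiffOn_extChartAt_symm (n := ∞) x₀).contMDiffAt
    ((isOpen_extChartAt_target x₀).mem_nhds hy)))

variable [RiemannianBundle (fun x : M ↦ TangentSpace (𝓡 n) x)]

/-- Links the definition of `gramMatrix` by the derivative of the inverse chart with `coordFrame`,
which comes from the trivialization of the tangent bundle. -/
theorem gramMatrix_apply {y : E} (hy : y ∈ (extChartAt (𝓡 n) x₀).target) (i j : Fin n) :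
    gramMatrix x₀ y i j = inner ℝ (coordFrame x₀ i ((extChartAt (𝓡 n) x₀).symm y))
      (coordFrame x₀ j ((extChartAt (𝓡 n) x₀).symm y)) := by
  have hx : (extChartAt (𝓡 n) x₀).symm y ∈ (chartAt E x₀).source := by
    simpa using (extChartAt (𝓡 n) x₀).map_target hy
  have h (i : Fin n) := coordFrame_eq_mfderiv hx i
  rw [(extChartAt (𝓡 n) x₀).right_inv hy] at h
  have hr : Set.range (𝓡 n) = Set.univ := (𝓡 n).range_eq_univ
  rw [hr, mfderivWithin_univ] at h
  rw [h, h]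
  rfl

omit [IsManifold (𝓡 n) ∞ M] in
theorem gramMatrix_symm (y : E) (i j : Fin n) : gramMatrix x₀ y i j = gramMatrix x₀ y j i := by
  simp only [gramMatrix, Matrix.of_apply]
  exact real_inner_comm _ _

theorem gramMatrix_eq_gram {y : E} (hy : y ∈ (extChartAt (𝓡 n) x₀).target) :
    gramMatrix x₀ y = Matrix.of fun i j ↦ inner ℝ
      (coordFrame x₀ i ((extChartAt (𝓡 n) x₀).symm y))
      (coordFrame x₀ j ((extChartAt (𝓡 n) x₀).symm y)) := by
  ext i j
  exact gramMatrix_apply hy i j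

theorem det_gramMatrix_pos {y : E} (hy : y ∈ (extChartAt (𝓡 n) x₀).target) :
    0 < (gramMatrix x₀ y).det := by
  have hx : (extChartAt (𝓡 n) x₀).symm y ∈ (chartAt E x₀).source := by
    simpa using (extChartAt (𝓡 n) x₀).map_target hy
  have h : LinearIndependent ℝ fun i ↦
      (coordFrame x₀ i ((extChartAt (𝓡 n) x₀).symm y) : TangentSpace (𝓡 n) _) := by
    have h2 := (coordBasis hx).linearIndependent
    rwa [show ⇑(coordBasis hx) = fun i : Fin n ↦
      (coordFrame x₀ i ((extChartAt (𝓡 n) x₀).symm y) : TangentSpace (𝓡 n) _) from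
      funext (coordBasis_apply hx)] at h2
  rw [gramMatrix_eq_gram hy]
  exact (Matrix.posDef_gram_of_linearIndependent h).det_pos

variable [IsContMDiffRiemannianBundle (𝓡 n) ∞ (EuclideanSpace ℝ (Fin n))
      (fun x : M ↦ TangentSpace (𝓡 n) x)]

theorem smoothFunAt_inner {X Y : Π x : M, TangentSpace (𝓡 n) x} (hX : SmoothFieldAt n X x)
    (hY : SmoothFieldAt n Y x) : SmoothFunAt n (fun y ↦ inner ℝ (X y) (Y y)) x :=
  hX.inner_bundle hY

theorem contDiffAt_gramMatrix {y : E} (hy : y ∈ (extChartAt (𝓡 n) x₀).target) (i j : Fin n) :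
    ContDiffAt ℝ ∞ (fun z ↦ gramMatrix x₀ z i j) y := by
  have hx : (extChartAt (𝓡 n) x₀).symm y ∈ (chartAt E x₀).source := by
    simpa using (extChartAt (𝓡 n) x₀).map_target hy
  refine (contDiffAt_comp_extChartAt_symm hy (smoothFunAt_inner (smoothFieldAt_coordFrame hx i)
    (smoothFieldAt_coordFrame hx j))).congr_of_eventuallyEq ?_
  filter_upwards [(isOpen_extChartAt_target x₀).mem_nhds hy] with z hz
  exact gramMatrix_apply hz i j

/-- Since the brackets vanish, only the metric terms remain: the Christoffel symbols of the first
kind. -/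
theorem koszul_coordFrame {y : E} (hy : y ∈ (extChartAt (𝓡 n) x₀).target) (j k l : Fin n) :
    koszul (coordFrame x₀ j) (coordFrame x₀ k) (coordFrame x₀ l) ((extChartAt (𝓡 n) x₀).symm y) =
      1 / 2 * (fderiv ℝ (fun z ↦ gramMatrix x₀ z k l) y (EuclideanSpace.basisFun (Fin n) ℝ j)
        + fderiv ℝ (fun z ↦ gramMatrix x₀ z l j) y (EuclideanSpace.basisFun (Fin n) ℝ k)
        - fderiv ℝ (fun z ↦ gramMatrix x₀ z j k) y (EuclideanSpace.basisFun (Fin n) ℝ l)) := by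
  have hx : (extChartAt (𝓡 n) x₀).symm y ∈ (chartAt E x₀).source := by
    simpa using (extChartAt (𝓡 n) x₀).map_target hy
  have h (i j k : Fin n) : mvfderiv (𝓡 n) (fun z ↦ inner ℝ (coordFrame x₀ j z) (coordFrame x₀ k z))
      ((extChartAt (𝓡 n) x₀).symm y) (coordFrame x₀ i ((extChartAt (𝓡 n) x₀).symm y)) =
      fderiv ℝ (fun z ↦ gramMatrix x₀ z j k) y (EuclideanSpace.basisFun (Fin n) ℝ i) := by
    rw [mvfderiv_coordFrame (mdifferentiableAt_inner_tangent (diffFieldAt_coordFrame hx j)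
      (diffFieldAt_coordFrame hx k)) hx, (extChartAt (𝓡 n) x₀).right_inv hy]
    congr 1
    refine Filter.EventuallyEq.fderiv_eq ?_
    filter_upwards [(isOpen_extChartAt_target x₀).mem_nhds hy] with z hz
    exact (gramMatrix_apply hz j k).symm
  simp only [koszul, mlieBracket_coordFrame hx, inner_zero_left, h]
  ring

/-- The components of a one-form in the chart at `x₀`. -/
def formCoord (x₀ : M) (η : Π x : M, TangentSpace (𝓡 n) x →L[ℝ] ℝ) (k : Fin n) (y : E) : ℝ :=
  η ((extChartAt (𝓡 n) x₀).symm y) (coordFrame x₀ k ((extChartAt (𝓡 n) x₀).symm y))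

/-- The density of the divergence of a one-form in a chart is a Euclidean divergence. -/
theorem sqrt_det_mul_divForm {η : Π x : M, TangentSpace (𝓡 n) x →L[ℝ] ℝ} {y : E}
    (hy : y ∈ (extChartAt (𝓡 n) x₀).target)
    (hη : DiffFormAt n η ((extChartAt (𝓡 n) x₀).symm y))
    (hη' : ∀ k, ContDiffAt ℝ 1 (formCoord x₀ η k) y) :
    Real.sqrt (gramMatrix x₀ y).det * divForm η ((extChartAt (𝓡 n) x₀).symm y) =
      ∑ i, fderiv ℝ (fun z ↦ Real.sqrt (gramMatrix x₀ z).det *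
        ∑ j, (gramMatrix x₀ z)⁻¹ i j * formCoord x₀ η j z) y
          (EuclideanSpace.basisFun (Fin n) ℝ i) := by
  have hx : (extChartAt (𝓡 n) x₀).symm y ∈ (chartAt E x₀).source := by
    simpa using (extChartAt (𝓡 n) x₀).map_target hy
  rw [← sqrt_det_mul_trace_christoffel (fun i ↦ EuclideanSpace.basisFun (Fin n) ℝ i)
    (fun i j ↦ (contDiffAt_gramMatrix hy i j).of_le (by simp)) (det_gramMatrix_pos hy)
    gramMatrix_symm hη', divForm_eq_frame hη (coordFrame x₀) (diffFieldAt_coordFrame hx)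
    (coordBasis hx) (coordBasis_apply hx), ← gramMatrix_eq_gram hy]
  congr 1
  refine Finset.sum_congr rfl fun j _ ↦ Finset.sum_congr rfl fun k _ ↦ ?_
  rw [mvfderiv_coordFrame (hη _ (diffFieldAt_coordFrame hx k)) hx,
    (extChartAt (𝓡 n) x₀).right_inv hy]
  simp only [koszul_coordFrame hy]
  rfl

end CoordinateFrame

/-! ### The Riemannian volume measure in charts. -/

/-- A supremum of measures is not computed set by set. Instead, `ν` plus the part of the supremum
living on `sᶜ` is an upper bound of the whole family, and restricting this bound to `s` removes the
second summand. -/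
theorem restrict_iSup_le {α ι : Type*} [MeasurableSpace α] {μ : ι → Measure α} {ν : Measure α}
    {s : Set α} (hs : MeasurableSet s) (h : ∀ i, (μ i).restrict s ≤ ν) :
    (⨆ i, μ i).restrict s ≤ ν := by
  have h1 : ⨆ i, μ i ≤ ν + (⨆ i, μ i).restrict sᶜ := by
    refine iSup_le fun i ↦ ?_
    rw [← Measure.restrict_add_restrict_compl (μ := μ i) hs]
    exact add_le_add (h i) (Measure.restrict_mono_measure (le_iSup μ i) _)
  have h2 := Measure.restrict_mono_measure h1 s
  rw [Measure.restrict_add, Measure.restrict_restrict hs, Set.inter_compl_self,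
    Measure.restrict_empty, add_zero] at h2
  exact h2.trans Measure.restrict_le_self

section Volume

variable {n : ℕ} {M : Type*} [TopologicalSpace M] [ChartedSpace (EuclideanSpace ℝ (Fin n)) M]
  [IsManifold (𝓡 n) ∞ M] [RiemannianBundle (fun x : M ↦ TangentSpace (𝓡 n) x)]

local notation "E" => EuclideanSpace ℝ (Fin n)

omit [IsManifold (𝓡 n) ∞ M] [RiemannianBundle (fun x : M ↦ TangentSpace (𝓡 n) x)] in
theorem aemeasurable_extChartAt_symm [MeasurableSpace M] [BorelSpace M] (x₀ : M)
    (f : E → ℝ≥0∞) :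
    AEMeasurable (extChartAt (𝓡 n) x₀).symm
      ((volume.restrict (extChartAt (𝓡 n) x₀).target).withDensity f) :=
  ((continuousOn_extChartAt_symm x₀).aemeasurable
    (isOpen_extChartAt_target x₀).measurableSet).mono_ac (withDensity_absolutelyContinuous _ _)

omit [IsManifold (𝓡 n) ∞ M] [RiemannianBundle (fun x : M ↦ TangentSpace (𝓡 n) x)] in
theorem measurableSet_target_inter_preimage [MeasurableSpace M] [BorelSpace M] (x₀ : M)
    {A : Set M} (hA : MeasurableSet A) :
    MeasurableSet ((extChartAt (𝓡 n) x₀).target ∩ (extChartAt (𝓡 n) x₀).symm ⁻¹' A) := by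
  classical
  have ht := (isOpen_extChartAt_target (I := 𝓡 n) x₀).measurableSet
  -- The inverse chart is controlled only on the target. Making it constant elsewhere gives a
  -- measurable map with the same preimages inside the target.
  have h := (continuousOn_extChartAt_symm (I := 𝓡 n) x₀).measurable_piecewise
    (g := fun _ ↦ x₀) continuousOn_const ht
  have h2 : (extChartAt (𝓡 n) x₀).target ∩ (extChartAt (𝓡 n) x₀).symm ⁻¹' A =
      (extChartAt (𝓡 n) x₀).target ∩
        (extChartAt (𝓡 n) x₀).target.piecewise (extChartAt (𝓡 n) x₀).symm (fun _ ↦ x₀) ⁻¹' A := by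
    ext y
    simp only [Set.mem_inter_iff, Set.mem_preimage]
    refine and_congr_right fun hy ↦ ?_
    rw [Set.piecewise_eq_of_mem _ _ _ hy]
  rw [h2]
  exact ht.inter (h hA)

omit [IsManifold (𝓡 n) ∞ M] in
theorem chartVolume_apply [MeasurableSpace M] [BorelSpace M] (x₀ : M) {A : Set M}
    (hA : MeasurableSet A) :
    chartVolume (n := n) x₀ A =
      ∫⁻ y in (extChartAt (𝓡 n) x₀).target ∩ (extChartAt (𝓡 n) x₀).symm ⁻¹' A,
        ENNReal.ofReal (Real.sqrt (gramMatrix x₀ y).det) := by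
  rw [chartVolume, Measure.map_apply_of_aemeasurable (aemeasurable_extChartAt_symm x₀ _) hA,
    withDensity_apply', Measure.restrict_restrict' (isOpen_extChartAt_target x₀).measurableSet,
    Set.inter_comm]

omit [RiemannianBundle (fun x : M ↦ TangentSpace (𝓡 n) x)] in
/-- The derivative of the change of coordinates from the chart at `x₁` to the chart at `x₀`. -/
theorem hasFDerivAt_chart_transition (x₀ x₁ : M) {y : E} (hy : y ∈ (extChartAt (𝓡 n) x₁).target)
    (hy' : (extChartAt (𝓡 n) x₁).symm y ∈ (chartAt E x₀).source) :
    HasFDerivAt (extChartAt (𝓡 n) x₀ ∘ (extChartAt (𝓡 n) x₁).symm)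
      ((mfderiv (𝓡 n) 𝓘(ℝ, E) (extChartAt (𝓡 n) x₀) ((extChartAt (𝓡 n) x₁).symm y)).comp
        (mfderiv 𝓘(ℝ, E) (𝓡 n) (extChartAt (𝓡 n) x₁).symm y) : E →L[ℝ] E) y := by
  have h1 := (mdifferentiableAt_extChartAt_symm hy).hasMFDerivAt
  have h0 := (mdifferentiableAt_extChartAt (I := 𝓡 n) hy').hasMFDerivAt
  exact (h0.comp y h1).hasFDerivAt

/-- With `J` the Jacobian matrix of the transition map, the two frames are related by `J`. Hence the
Gram matrices satisfy `G₁ = Jᵀ G₀ J`, and `det G₁ = (det J)² det G₀`. This is the factor in the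
change of variables formula. -/
theorem sqrt_det_gramMatrix_transition (x₀ x₁ : M) {y : E}
    (hy : y ∈ (extChartAt (𝓡 n) x₁).target)
    (hy' : (extChartAt (𝓡 n) x₁).symm y ∈ (chartAt E x₀).source) :
    Real.sqrt (gramMatrix x₁ y).det =
      |((mfderiv (𝓡 n) 𝓘(ℝ, E) (extChartAt (𝓡 n) x₀) ((extChartAt (𝓡 n) x₁).symm y)).comp
        (mfderiv 𝓘(ℝ, E) (𝓡 n) (extChartAt (𝓡 n) x₁).symm y) : E →L[ℝ] E).det| *
      Real.sqrt (gramMatrix x₀ ((extChartAt (𝓡 n) x₀) ((extChartAt (𝓡 n) x₁).symm y))).det := by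
  have hx1 : (extChartAt (𝓡 n) x₁).symm y ∈ (chartAt E x₁).source := by
    simpa using (extChartAt (𝓡 n) x₁).map_target hy
  set x := (extChartAt (𝓡 n) x₁).symm y with hxdef
  have hx0 : x ∈ (extChartAt (𝓡 n) x₀).source := by simpa using hy'
  set L : E →L[ℝ] E := ((mfderiv (𝓡 n) 𝓘(ℝ, E) (extChartAt (𝓡 n) x₀) x).comp
        (mfderiv 𝓘(ℝ, E) (𝓡 n) (extChartAt (𝓡 n) x₁).symm y) : E →L[ℝ] E) with hL
  set b := (EuclideanSpace.basisFun (Fin n) ℝ).toBasis with hb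
  set J := LinearMap.toMatrix b b (L : E →ₗ[ℝ] E) with hJ
  have hdet : L.det = J.det := by
    rw [hJ, LinearMap.det_toMatrix]
  have hX (i : Fin n) : coordFrame x₁ i x = ∑ k, J k i • coordFrame x₀ k x := by
    have hinj := (isInvertible_mfderiv_extChartAt (I := 𝓡 n) hx0).injective
    apply hinj
    rw [map_sum]
    simp_rw [map_smul, mfderiv_extChartAt_coordFrame hy']
    rw [coordFrame_eq_mfderiv hx1, (𝓡 n).range_eq_univ, mfderivWithin_univ, hxdef,
      (extChartAt (𝓡 n) x₁).right_inv hy, ← hxdef]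
    change L (EuclideanSpace.basisFun (Fin n) ℝ i) = _
    have h := (b.sum_repr (L (EuclideanSpace.basisFun (Fin n) ℝ i))).symm
    rw [h]
    refine Finset.sum_congr rfl fun k _ ↦ ?_
    rw [hJ, LinearMap.toMatrix_apply, hb, OrthonormalBasis.coe_toBasis]
    rfl
  have hG : gramMatrix x₁ y = J.transpose * gramMatrix x₀ (extChartAt (𝓡 n) x₀ x) * J := by
    ext i j
    have h0 (k l : Fin n) := gramMatrix_apply ((extChartAt (𝓡 n) x₀).map_source hx0) k l
    rw [(extChartAt (𝓡 n) x₀).left_inv hx0] at h0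
    rw [gramMatrix_apply hy, ← hxdef, hX, hX, sum_inner]
    simp only [Matrix.mul_apply, Matrix.transpose_apply, h0, inner_sum, real_inner_smul_left,
      real_inner_smul_right, Finset.sum_mul]
    rw [Finset.sum_comm]
    refine Finset.sum_congr rfl fun k _ ↦ Finset.sum_congr rfl fun l _ ↦ ?_
    ring
  rw [hG, hdet, Matrix.det_mul, Matrix.det_mul, Matrix.det_transpose,
    show J.det * (gramMatrix x₀ (extChartAt (𝓡 n) x₀ x)).det * J.det =
      J.det ^ 2 * (gramMatrix x₀ (extChartAt (𝓡 n) x₀ x)).det by ring,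
    Real.sqrt_mul (sq_nonneg _), Real.sqrt_sq_eq_abs]

/-- The chart volumes agree on overlaps. -/
theorem chartVolume_eq_of_subset [MeasurableSpace M] [BorelSpace M] (x₀ x₁ : M) {A : Set M}
    (hA : MeasurableSet A) (h0 : A ⊆ (chartAt E x₀).source) (h1 : A ⊆ (chartAt E x₁).source) :
    chartVolume (n := n) x₀ A = chartVolume (n := n) x₁ A := by
  have h0' : A ⊆ (extChartAt (𝓡 n) x₀).source := by simpa using h0
  have h1' : A ⊆ (extChartAt (𝓡 n) x₁).source := by simpa using h1
  rw [chartVolume_apply x₀ hA, chartVolume_apply x₁ hA]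
  set B₁ := (extChartAt (𝓡 n) x₁).target ∩ (extChartAt (𝓡 n) x₁).symm ⁻¹' A with hB1
  have hB : (extChartAt (𝓡 n) x₀).target ∩ (extChartAt (𝓡 n) x₀).symm ⁻¹' A =
      (extChartAt (𝓡 n) x₀ ∘ (extChartAt (𝓡 n) x₁).symm) '' B₁ := by
    ext z
    constructor
    · rintro ⟨hz, hzA⟩
      refine ⟨extChartAt (𝓡 n) x₁ ((extChartAt (𝓡 n) x₀).symm z),
        ⟨(extChartAt (𝓡 n) x₁).map_source (h1' hzA), ?_⟩, ?_⟩
      · rw [Set.mem_preimage, (extChartAt (𝓡 n) x₁).left_inv (h1' hzA)]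
        exact hzA
      · rw [Function.comp_apply, (extChartAt (𝓡 n) x₁).left_inv (h1' hzA),
          (extChartAt (𝓡 n) x₀).right_inv hz]
    · rintro ⟨y, ⟨hy, hyA⟩, rfl⟩
      refine ⟨(extChartAt (𝓡 n) x₀).map_source (h0' hyA), ?_⟩
      rw [Set.mem_preimage, Function.comp_apply, (extChartAt (𝓡 n) x₀).left_inv (h0' hyA)]
      exact hyA
  have hinj : Set.InjOn (extChartAt (𝓡 n) x₀ ∘ (extChartAt (𝓡 n) x₁).symm) B₁ := by
    rintro y ⟨hy, hyA⟩ z ⟨hz, hzA⟩ hyz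
    have h := (extChartAt (𝓡 n) x₀).injOn (h0' hyA) (h0' hzA) hyz
    exact (extChartAt (𝓡 n) x₁).symm.injOn hy hz h
  have hm := measurableSet_target_inter_preimage (n := n) x₁ hA
  rw [hB, lintegral_image_eq_lintegral_abs_det_fderiv_mul volume hm
    (fun y hy ↦ (hasFDerivAt_chart_transition x₀ x₁ hy.1 (h0 hy.2)).hasFDerivWithinAt) hinj]
  refine setLIntegral_congr_fun hm fun y hy ↦ ?_
  simp only
  rw [sqrt_det_gramMatrix_transition x₀ x₁ hy.1 (h0 hy.2), ENNReal.ofReal_mul (abs_nonneg _)]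
  rfl

omit [IsManifold (𝓡 n) ∞ M] in
theorem chartVolume_restrict [MeasurableSpace M] [BorelSpace M] (x₀ : M) :
    (chartVolume (n := n) x₀).restrict (chartAt E x₀).source = chartVolume (n := n) x₀ := by
  ext A hA
  have hs := (chartAt E x₀).open_source.measurableSet
  rw [Measure.restrict_apply hA, chartVolume_apply _ (hA.inter hs), chartVolume_apply _ hA]
  congr 2
  ext y
  simp only [Set.mem_inter_iff, Set.mem_preimage]
  refine ⟨fun h ↦ ⟨h.1, h.2.1⟩, fun h ↦ ⟨h.1, h.2, ?_⟩⟩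
  simpa using (extChartAt (𝓡 n) x₀).map_target h.1

/-- The Riemannian volume measure restricts to the chart volume on the domain of each chart. -/
theorem volumeMeasure_restrict_source [MeasurableSpace M] [BorelSpace M] (x₀ : M) :
    (volumeMeasure n M).restrict (chartAt E x₀).source = chartVolume (n := n) x₀ := by
  have hs := (chartAt E x₀).open_source.measurableSet
  apply le_antisymm
  · refine restrict_iSup_le hs fun x₁ ↦ ?_
    -- `chartVolume x₁` lives on its own chart domain, so only the overlap counts, and there it
    -- equals `chartVolume x₀`.
    refine Measure.le_iff.2 fun A hA ↦ ?_
    rw [Measure.restrict_apply hA, ← chartVolume_restrict x₁,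
      Measure.restrict_apply (hA.inter hs),
      chartVolume_eq_of_subset x₁ x₀ ((hA.inter hs).inter (chartAt E x₁).open_source.measurableSet)
        Set.inter_subset_right (Set.inter_subset_left.trans Set.inter_subset_right)]
    exact measure_mono (Set.inter_subset_left.trans Set.inter_subset_left)
  · conv_lhs => rw [← chartVolume_restrict x₀]
    exact Measure.restrict_mono_measure (le_iSup (fun x ↦ chartVolume (n := n) x) x₀) _

end Volume

/-! ### Smooth one-forms and the rules for their divergence. -/

section Forms

variable {n : ℕ} {M : Type*} [TopologicalSpace M] [ChartedSpace (EuclideanSpace ℝ (Fin n)) M]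
  [IsManifold (𝓡 n) ∞ M]

local notation "E" => EuclideanSpace ℝ (Fin n)

variable {x₀ x : M}

/-- The derivative of the preferred chart at `x₀`. -/
def chartDeriv (x₀ x : M) : TangentSpace (𝓡 n) x →L[ℝ] E :=
  mfderiv (𝓡 n) 𝓘(ℝ, E) (extChartAt (𝓡 n) x₀) x

theorem eq_sum_coordFrame (hx : x ∈ (chartAt E x₀).source) (v : TangentSpace (𝓡 n) x) :
    v = ∑ k, chartDeriv x₀ x v k • coordFrame x₀ k x := by
  have hinj := (isInvertible_mfderiv_extChartAt (I := 𝓡 n) (x := x₀) (y := x)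
    (by simpa using hx)).injective
  apply hinj
  rw [map_sum]
  simp_rw [map_smul, mfderiv_extChartAt_coordFrame hx]
  exact ((EuclideanSpace.basisFun (Fin n) ℝ).sum_repr
    (chartDeriv x₀ x v)).symm

theorem trivializationAt_eq_chartDeriv (hx : x ∈ (chartAt E x₀).source) (v : TangentSpace (𝓡 n) x) :
    (trivializationAt E (TangentSpace (𝓡 n)) x₀ ⟨x, v⟩).2 =
      chartDeriv x₀ x v := by
  rw [chartDeriv, ← TangentBundle.continuousLinearMapAt_trivializationAt (I := 𝓡 n) hx]
  exact ((trivializationAt E (TangentSpace (𝓡 n)) x₀).coe_linearMapAt_of_mem (R := ℝ) hx ▸ rfl)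

theorem contMDiffAt_chartDeriv_apply {X : Π x : M, TangentSpace (𝓡 n) x}
    (hx : x ∈ (chartAt E x₀).source) (hX : SmoothFieldAt n X x) :
    ContMDiffAt (𝓡 n) 𝓘(ℝ, E) ∞
      (fun y ↦ chartDeriv x₀ y (X y)) x := by
  have h := ((trivializationAt E (TangentSpace (𝓡 n)) x₀).contMDiffAt_section_iff
    (IB := 𝓡 n) (n := ∞) (x₀ := x) (s := X) hx).1 hX
  refine h.congr_of_eventuallyEq ?_
  filter_upwards [(chartAt E x₀).open_source.mem_nhds hx] with y hy
  exact (trivializationAt_eq_chartDeriv hy _).symm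

theorem mdifferentiableAt_chartDeriv_apply {X : Π x : M, TangentSpace (𝓡 n) x}
    (hx : x ∈ (chartAt E x₀).source) (hX : DiffFieldAt n X x) :
    MDifferentiableAt (𝓡 n) 𝓘(ℝ, E)
      (fun y ↦ chartDeriv x₀ y (X y)) x := by
  have h := ((trivializationAt E (TangentSpace (𝓡 n)) x₀).mdifferentiableAt_section_iff
    (IB := 𝓡 n) X (b₀ := x) hx).1 hX
  refine h.congr_of_eventuallyEq ?_
  filter_upwards [(chartAt E x₀).open_source.mem_nhds hx] with y hy
  exact (trivializationAt_eq_chartDeriv hy _).symm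

variable (n) in
/-- A smooth one-form: it maps vector fields that are smooth at a point to functions that are
smooth at this point. -/
def SmoothForm (η : Π x : M, TangentSpace (𝓡 n) x →L[ℝ] ℝ) : Prop :=
  ∀ (x : M) (Y : Π x : M, TangentSpace (𝓡 n) x), SmoothFieldAt n Y x →
    SmoothFunAt n (fun y ↦ η y (Y y)) x

variable {η η' : Π x : M, TangentSpace (𝓡 n) x →L[ℝ] ℝ}

/-- A smooth form is tested on smooth fields only. For a merely differentiable `Y` one writes `η(Y)
= ∑ Y^k η(∂_k)`: the components of `Y` are differentiable and the coordinate fields are smooth. -/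
theorem SmoothForm.diffFormAt (hη : SmoothForm n η) (x : M) : DiffFormAt n η x := by
  intro Y hY
  have hx : x ∈ (chartAt E x).source := mem_chart_source _ x
  have h1 := mdifferentiableAt_chartDeriv_apply hx hY
  have h2 (k : Fin n) : DiffFunAt n (fun y ↦
      chartDeriv x y (Y y) k * η y (coordFrame x k y)) x := by
    refine MDifferentiableAt.mul ?_ ((hη x _ (smoothFieldAt_coordFrame hx k)).mdifferentiableAt
      (by simp))
    exact ((EuclideanSpace.proj (𝕜 := ℝ) k).differentiableAt.mdifferentiableAt).comp x h1
  have h3 : DiffFunAt n (fun y ↦ ∑ k, chartDeriv x y (Y y) k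
      * η y (coordFrame x k y)) x := by
    have h := MDifferentiableAt.sum (t := Finset.univ) fun k _ ↦ h2 k
    convert h using 1
    ext y
    simp
  refine h3.congr_of_eventuallyEq ?_
  filter_upwards [(chartAt E x).open_source.mem_nhds hx] with y hy
  conv_lhs => rw [eq_sum_coordFrame hy (Y y)]
  simp only [map_sum, map_smul, smul_eq_mul]

theorem SmoothForm.contDiffAt_formCoord (hη : SmoothForm n η) (x₀ : M) (k : Fin n) {y : E}
    (hy : y ∈ (extChartAt (𝓡 n) x₀).target) : ContDiffAt ℝ ∞ (formCoord x₀ η k) y := by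
  have hx : (extChartAt (𝓡 n) x₀).symm y ∈ (chartAt E x₀).source := by
    simpa using (extChartAt (𝓡 n) x₀).map_target hy
  exact contDiffAt_comp_extChartAt_symm hy (hη _ _ (smoothFieldAt_coordFrame hx k))

theorem SmoothForm.smul (hη : SmoothForm n η) {f : M → ℝ} (hf : ∀ x, SmoothFunAt n f x) :
    SmoothForm n (fun x ↦ f x • η x) := fun x Y hY ↦ (hf x).mul (hη x Y hY)

theorem SmoothForm.add (hη : SmoothForm n η) (hη' : SmoothForm n η') :
    SmoothForm n (fun x ↦ η x + η' x) := fun x Y hY ↦ (hη x Y hY).add (hη' x Y hY)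

theorem smoothForm_zero : SmoothForm n (fun x : M ↦ (0 : TangentSpace (𝓡 n) x →L[ℝ] ℝ)) :=
  fun _ _ _ ↦ contMDiffAt_const

theorem smoothForm_mvfderiv {f : M → ℝ} (hf : ∀ x, SmoothFunAt n f x) :
    SmoothForm n (mvfderiv (𝓡 n) f) := by
  intro x Y hY
  have hx : x ∈ (chartAt E x).source := mem_chart_source _ x
  have hy := (extChartAt (𝓡 n) x).map_source (mem_extChartAt_source (I := 𝓡 n) x)
  have h1 : ContDiffAt ℝ ∞ (fderiv ℝ (f ∘ (extChartAt (𝓡 n) x).symm)) (extChartAt (𝓡 n) x x) :=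
    (contDiffAt_comp_extChartAt_symm hy (hf _)).fderiv_right (by simp)
  have h2 := h1.contMDiffAt.comp x (contMDiffAt_extChartAt' (I := 𝓡 n) (n := ∞) hx)
  refine (h2.clm_apply (contMDiffAt_chartDeriv_apply hx hY)).congr_of_eventuallyEq ?_
  filter_upwards [(chartAt E x).open_source.mem_nhds hx] with y hy
  exact mvfderiv_eq_fderiv_extChartAt ((hf y).mdifferentiableAt (by simp)) hy _

omit [IsManifold (𝓡 n) ∞ M] in
theorem mvfderiv_congr_of_eventuallyEq {f g : M → ℝ} (h : f =ᶠ[nhds x] g) :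
    mvfderiv (𝓡 n) f x = mvfderiv (𝓡 n) g x :=
  ContinuousLinearMap.ext fun v ↦ congrArg (fun L : TangentSpace (𝓡 n) x →L[ℝ] ℝ ↦ L v)
    h.mfderiv_eq

variable [RiemannianBundle (fun x : M ↦ TangentSpace (𝓡 n) x)]

theorem divForm_zero (x : M) :
    divForm (fun x : M ↦ (0 : TangentSpace (𝓡 n) x →L[ℝ] ℝ)) x = 0 := by
  simp [divForm, mvfderiv_const]

theorem divForm_congr {x : M} (h : ∀ᶠ y in nhds x, η y = η' y) : divForm η x = divForm η' x := by
  refine Finset.sum_congr rfl fun i _ ↦ ?_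
  rw [h.self_of_nhds]
  congr 2
  refine mvfderiv_congr_of_eventuallyEq ?_
  filter_upwards [h] with y hy
  rw [hy]

theorem divForm_add (hη : SmoothForm n η) (hη' : SmoothForm n η') (x : M) :
    divForm (fun x ↦ η x + η' x) x = divForm η x + divForm η' x := by
  rw [divForm, divForm, divForm, ← Finset.sum_add_distrib]
  refine Finset.sum_congr rfl fun i _ ↦ ?_
  have h := mvfderiv_add
    ((hη.diffFormAt x) _ (diffFieldAt_extendVector (tangentBasis x i)))
    ((hη'.diffFormAt x) _ (diffFieldAt_extendVector (tangentBasis x i)))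
  have h' : mvfderiv (𝓡 n) (fun y ↦ (η y + η' y) (extendVector (tangentBasis x i) y)) x =
    _ := h
  rw [h', add_apply, add_apply]
  ring

theorem divForm_smul (hη : SmoothForm n η) {f : M → ℝ} {x : M} (hf : DiffFunAt n f x) :
    divForm (fun x ↦ f x • η x) x = f x * divForm η x + η x (gradient f x) := by
  rw [divForm, divForm, gradient, map_sum, Finset.mul_sum, ← Finset.sum_add_distrib]
  refine Finset.sum_congr rfl fun i _ ↦ ?_
  have h := mvfderiv_mul hf
    ((hη.diffFormAt x) _ (diffFieldAt_extendVector (tangentBasis x i)))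
  have h' : mvfderiv (𝓡 n) (fun y ↦ (f y • η y) (extendVector (tangentBasis x i) y)) x =
    _ := h
  rw [h', add_apply, smul_apply, smul_apply, smul_apply, map_smul, extendVector_self]
  simp only [smul_eq_mul]
  ring

/-- Both claims are proved in one induction because additivity of the divergence needs smoothness of
the partial sums. -/
theorem divForm_sum {ι : Type*} (s : Finset ι) (η : ι → Π x : M, TangentSpace (𝓡 n) x →L[ℝ] ℝ)
    (hη : ∀ i ∈ s, SmoothForm n (η i)) :
    SmoothForm n (fun x ↦ ∑ i ∈ s, η i x) ∧
      ∀ x, divForm (fun x ↦ ∑ i ∈ s, η i x) x = ∑ i ∈ s, divForm (η i) x := by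
  classical
  induction s using Finset.induction_on with
  | empty => simpa using ⟨smoothForm_zero, divForm_zero⟩
  | insert a s ha ih =>
    obtain ⟨h1, h2⟩ := ih fun i hi ↦ hη i (Finset.mem_insert_of_mem hi)
    have h3 := hη a (Finset.mem_insert_self a s)
    simp only [Finset.sum_insert ha]
    refine ⟨h3.add h1, fun x ↦ ?_⟩
    rw [divForm_add h3 h1, h2]

end Forms

/-! ### The divergence theorem. -/

/-- Integration by parts against the constant function `1`. -/
theorem integral_fderiv_apply_eq_zero {E : Type*} [NormedAddCommGroup E] [NormedSpace ℝ E]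
    [FiniteDimensional ℝ E] [MeasurableSpace E] [BorelSpace E] (μ : Measure E) [μ.IsAddHaarMeasure]
    {f : E → ℝ} (hf : ContDiff ℝ 1 f) (hc : HasCompactSupport f) (v : E) :
    Integrable (fun x ↦ fderiv ℝ f x v) μ ∧ ∫ x, fderiv ℝ f x v ∂μ = 0 := by
  have h1 : Integrable (fun x ↦ fderiv ℝ f x v) μ :=
    ((hf.continuous_fderiv one_ne_zero).clm_apply continuous_const).integrable_of_hasCompactSupport
      (hc.fderiv_apply ℝ v)
  have h2 := integral_mul_fderiv_eq_neg_fderiv_mul_of_integrable (f := fun _ : E ↦ (1 : ℝ)) (g := f)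
    (v := v) (μ := μ) (by simp) (by simpa using h1)
    (by simpa using hf.continuous.integrable_of_hasCompactSupport hc)
    (fun x _ ↦ by fun_prop) (fun x _ ↦ hf.contDiffAt.differentiableAt one_ne_zero)
  exact ⟨h1, by simpa using h2⟩

section Volume

variable {n : ℕ} {M : Type*} [TopologicalSpace M] [ChartedSpace (EuclideanSpace ℝ (Fin n)) M]
  [IsManifold (𝓡 n) ∞ M] [RiemannianBundle (fun x : M ↦ TangentSpace (𝓡 n) x)]
  [IsContMDiffRiemannianBundle (𝓡 n) ∞ (EuclideanSpace ℝ (Fin n))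
      (fun x : M ↦ TangentSpace (𝓡 n) x)]

local notation "E" => EuclideanSpace ℝ (Fin n)

theorem contDiffAt_sqrt_det_gramMatrix {x₀ : M} {y : E} (hy : y ∈ (extChartAt (𝓡 n) x₀).target) :
    ContDiffAt ℝ ∞ (fun z ↦ Real.sqrt (gramMatrix x₀ z).det) y :=
  (contDiffAt_det fun i j ↦ contDiffAt_gramMatrix hy i j).sqrt (det_gramMatrix_pos hy).ne'

theorem continuousOn_sqrt_det_gramMatrix (x₀ : M) :
    ContinuousOn (fun z ↦ Real.sqrt (gramMatrix x₀ z).det) (extChartAt (𝓡 n) x₀).target :=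
  fun _ hy ↦ (contDiffAt_sqrt_det_gramMatrix hy).continuousAt.continuousWithinAt

/-- The definition uses a basis chosen separately at each point, so continuity cannot be read off
from it. It comes from the coordinate formula, divided by `√det g`. -/
theorem continuous_divForm {η : Π x : M, TangentSpace (𝓡 n) x →L[ℝ] ℝ} (hη : SmoothForm n η) :
    Continuous (divForm η) := by
  refine continuous_iff_continuousAt.2 fun x ↦ ?_
  have hx : x ∈ (extChartAt (𝓡 n) x).source := mem_extChartAt_source x
  have hopen := isOpen_extChartAt_target (I := 𝓡 n) x
  have h1 : ContinuousAt (fun y ↦ (Real.sqrt (gramMatrix x y).det)⁻¹ *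
      ∑ i, fderiv ℝ (fun z ↦ Real.sqrt (gramMatrix x z).det *
        ∑ j, (gramMatrix x z)⁻¹ i j * formCoord x η j z) y (EuclideanSpace.basisFun (Fin n) ℝ i))
        (extChartAt (𝓡 n) x x) := by
    have hy := (extChartAt (𝓡 n) x).map_source hx
    have h0 := contDiffAt_sqrt_det_gramMatrix hy
    refine (h0.continuousAt.inv₀ (Real.sqrt_pos.2 (det_gramMatrix_pos hy)).ne').mul
      (tendsto_finsetSum _ fun i _ ↦ ?_)
    have h2 : ContDiffAt ℝ ∞ (fun z ↦ Real.sqrt (gramMatrix x z).det *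
        ∑ j, (gramMatrix x z)⁻¹ i j * formCoord x η j z) (extChartAt (𝓡 n) x x) :=
      h0.mul (ContDiffAt.sum fun j _ ↦ (contDiffAt_inv_apply
        (fun i j ↦ contDiffAt_gramMatrix hy i j) (det_gramMatrix_pos hy).ne' i j).mul
          (hη.contDiffAt_formCoord x j hy))
    exact (h2.fderiv_right (m := 0) (by simp)).continuousAt.clm_apply continuousAt_const
  refine (h1.comp (continuousAt_extChartAt (I := 𝓡 n) x)).congr ?_
  filter_upwards [(isOpen_extChartAt_source (I := 𝓡 n) x).mem_nhds hx] with z hz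
  have hy := (extChartAt (𝓡 n) x).map_source hz
  have h3 := sqrt_det_mul_divForm hy (hη.diffFormAt _)
    fun k ↦ (hη.contDiffAt_formCoord x k hy).of_le (by simp)
  rw [(extChartAt (𝓡 n) x).left_inv hz] at h3
  simp only [Function.comp_apply]
  rw [← h3, inv_mul_cancel_left₀ (Real.sqrt_pos.2 (det_gramMatrix_pos hy)).ne']

variable [MeasurableSpace M] [BorelSpace M]

theorem setIntegral_volumeMeasure {f : M → ℝ} (hf : Continuous f) (x₀ : M) :
    ∫ x in (chartAt E x₀).source, f x ∂(volumeMeasure n M) =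
      ∫ y in (extChartAt (𝓡 n) x₀).target,
        Real.sqrt (gramMatrix x₀ y).det * f ((extChartAt (𝓡 n) x₀).symm y) := by
  rw [volumeMeasure_restrict_source, chartVolume,
    integral_map (aemeasurable_extChartAt_symm x₀ _) hf.aestronglyMeasurable,
    integral_withDensity_eq_integral_toReal_smul₀]
  · refine integral_congr_ae (ae_of_all _ fun y ↦ ?_)
    simp only [ENNReal.toReal_ofReal (Real.sqrt_nonneg _), smul_eq_mul]
  · exact ((continuousOn_sqrt_det_gramMatrix x₀).aemeasurable
      (isOpen_extChartAt_target x₀).measurableSet).ennreal_ofReal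
  · exact ae_of_all _ fun y ↦ ENNReal.ofReal_lt_top

/-- The continuous density `√det g` is integrable over the image of a compact neighbourhood in a
chart. -/
instance isLocallyFiniteMeasure_volumeMeasure :
    IsLocallyFiniteMeasure (volumeMeasure n M) where
  finiteAtNhds x := by
    have : LocallyCompactSpace M := ChartedSpace.locallyCompactSpace E M
    obtain ⟨K, hK, hKs, hKc⟩ := LocallyCompactSpace.local_compact_nhds x (chartAt E x).source
      ((chartAt E x).open_source.mem_nhds (mem_chart_source E x))
    refine ⟨interior K, interior_mem_nhds.2 hK, ?_⟩
    have hs : interior K ⊆ (chartAt E x).source := interior_subset.trans hKs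
    have hm : MeasurableSet (interior K) := isOpen_interior.measurableSet
    rw [← Measure.restrict_eq_self _ hs, volumeMeasure_restrict_source, chartVolume_apply x hm]
    have hK' : IsCompact (extChartAt (𝓡 n) x '' K) :=
      hKc.image_of_continuousOn ((continuousOn_extChartAt x).mono (by simpa using hKs))
    have hsub : extChartAt (𝓡 n) x '' K ⊆ (extChartAt (𝓡 n) x).target := by
      rintro _ ⟨z, hz, rfl⟩
      exact (extChartAt (𝓡 n) x).map_source (by simpa using hKs hz)
    have hint := ((continuousOn_sqrt_det_gramMatrix x).mono hsub).integrableOn_compact hK'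
      (μ := volume)
    refine lt_of_le_of_lt (lintegral_mono_set (t := extChartAt (𝓡 n) x '' K) ?_) ?_
    · rintro y ⟨hy, hyK⟩
      exact ⟨_, interior_subset hyK, (extChartAt (𝓡 n) x).right_inv hy⟩
    · exact (lintegral_ofReal_le_lintegral_enorm _).trans_lt hint.2

/-- Holds because `√det g > 0`. The strict positivity of the integral in the fundamental lemma
depends on it. -/
instance isOpenPosMeasure_volumeMeasure : (volumeMeasure n M).IsOpenPosMeasure where
  open_pos U hU := by
    rintro ⟨x, hx⟩ h0
    have hV : IsOpen (U ∩ (chartAt E x).source) := hU.inter (chartAt E x).open_source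
    have h1 : volumeMeasure n M (U ∩ (chartAt E x).source) = 0 :=
      measure_mono_null Set.inter_subset_left h0
    rw [← Measure.restrict_eq_self _ Set.inter_subset_right, volumeMeasure_restrict_source,
      chartVolume_apply x hV.measurableSet] at h1
    have h2 : IsOpen ((extChartAt (𝓡 n) x).target ∩
        (extChartAt (𝓡 n) x).symm ⁻¹' (U ∩ (chartAt E x).source)) :=
      (continuousOn_extChartAt_symm x).isOpen_inter_preimage (isOpen_extChartAt_target x) hV
    rw [setLIntegral_eq_zero_iff' h2.measurableSet ?_] at h1
    · have h3 : volume ((extChartAt (𝓡 n) x).target ∩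
        (extChartAt (𝓡 n) x).symm ⁻¹' (U ∩ (chartAt E x).source)) = 0 := by
        refine measure_mono_null (fun y hy ↦ ?_) h1
        simp only [Set.mem_compl_iff, Set.mem_ofPred_eq]
        intro h
        exact (ENNReal.ofReal_pos.2 (Real.sqrt_pos.2 (det_gramMatrix_pos hy.1))).ne' (h hy)
      refine (h2.measure_pos volume ⟨extChartAt (𝓡 n) x x, ?_⟩).ne' h3
      have hxs : x ∈ (extChartAt (𝓡 n) x).source := mem_extChartAt_source x
      refine ⟨(extChartAt (𝓡 n) x).map_source hxs, ?_⟩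
      rw [Set.mem_preimage, (extChartAt (𝓡 n) x).left_inv hxs]
      exact ⟨hx, mem_chart_source E x⟩
    · exact (((continuousOn_sqrt_det_gramMatrix x).mono Set.inter_subset_left).aemeasurable
        h2.measurableSet).ennreal_ofReal

/-- The divergence theorem for forms that are supported in the domain of a chart. -/
theorem integral_divForm_eq_zero_of_subset [T2Space M] {η : Π x : M, TangentSpace (𝓡 n) x →L[ℝ] ℝ}
    (hη : SmoothForm n η) {K : Set M} (hK : IsCompact K) {x₀ : M} (hKs : K ⊆ (chartAt E x₀).source)
    (hηK : ∀ x ∉ K, η x = 0) : ∫ x, divForm η x ∂(volumeMeasure n M) = 0 := by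
  have hdiv : ∀ x ∉ K, divForm η x = 0 := fun x hx ↦ by
    rw [divForm_congr (η' := fun _ ↦ 0), divForm_zero]
    filter_upwards [hK.isClosed.isOpen_compl.mem_nhds hx] with y hy using hηK y hy
  have h1 : ∫ x, divForm η x ∂(volumeMeasure n M) =
      ∫ x in (chartAt E x₀).source, divForm η x ∂(volumeMeasure n M) :=
    (setIntegral_eq_integral_of_forall_compl_eq_zero fun x hx ↦ hdiv x fun h ↦ hx (hKs h)).symm
  rw [h1, setIntegral_volumeMeasure (continuous_divForm hη)]
  set T := (extChartAt (𝓡 n) x₀).target with hT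
  have hTo : IsOpen T := isOpen_extChartAt_target x₀
  set u : Fin n → E → ℝ := fun i z ↦ Real.sqrt (gramMatrix x₀ z).det *
        ∑ j, (gramMatrix x₀ z)⁻¹ i j * formCoord x₀ η j z with hu
  have hK' : IsCompact (extChartAt (𝓡 n) x₀ '' K) :=
    hK.image_of_continuousOn ((continuousOn_extChartAt x₀).mono (by simpa using hKs))
  have hsub : extChartAt (𝓡 n) x₀ '' K ⊆ T := by
    rintro _ ⟨z, hz, rfl⟩
    exact (extChartAt (𝓡 n) x₀).map_source (by simpa using hKs hz)
  -- The densitized dual field vanishes off the compact image of `K`, which lies in the open target.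
  -- Its extension by zero is therefore `C¹` on the whole model space.
  have hu0 (i : Fin n) : ∀ y ∉ extChartAt (𝓡 n) x₀ '' K, T.indicator (u i) y = 0 := by
    intro y hy
    by_cases hyT : y ∈ T
    · rw [Set.indicator_of_mem hyT]
      have : (extChartAt (𝓡 n) x₀).symm y ∉ K := fun h ↦
        hy ⟨_, h, (extChartAt (𝓡 n) x₀).right_inv hyT⟩
      simp only [hu, formCoord, hηK _ this, zero_apply, mul_zero, Finset.sum_const_zero]
    · exact Set.indicator_of_notMem hyT _
  have hueq (i : Fin n) {y : E} (hy : y ∈ T) : T.indicator (u i) =ᶠ[nhds y] u i := by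
    filter_upwards [hTo.mem_nhds hy] with z hz using Set.indicator_of_mem hz _
  have huc (i : Fin n) : ContDiff ℝ 1 (T.indicator (u i)) := by
    refine contDiff_iff_contDiffAt.2 fun y ↦ ?_
    by_cases hyT : y ∈ T
    · refine ContDiffAt.congr_of_eventuallyEq ?_ (hueq i hyT)
      refine ContDiffAt.of_le (n := ∞) ?_ (by simp)
      exact (contDiffAt_sqrt_det_gramMatrix hyT).mul (ContDiffAt.sum fun j _ ↦
        (contDiffAt_inv_apply (fun i j ↦ contDiffAt_gramMatrix hyT i j)
          (det_gramMatrix_pos hyT).ne' i j).mul (hη.contDiffAt_formCoord x₀ j hyT))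
    · refine (contDiffAt_const (c := 0)).congr_of_eventuallyEq ?_
      filter_upwards [hK'.isClosed.isOpen_compl.mem_nhds fun h ↦ hyT (hsub h)] with z hz
        using hu0 i z hz
  have hus (i : Fin n) : HasCompactSupport (T.indicator (u i)) :=
    HasCompactSupport.intro hK' (hu0 i)
  have h2 : ∀ y ∈ T, Real.sqrt (gramMatrix x₀ y).det * divForm η ((extChartAt (𝓡 n) x₀).symm y) =
      ∑ i, fderiv ℝ (T.indicator (u i)) y (EuclideanSpace.basisFun (Fin n) ℝ i) := by
    intro y hy
    rw [sqrt_det_mul_divForm hy (hη.diffFormAt _)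
      fun k ↦ (hη.contDiffAt_formCoord x₀ k hy).of_le (by simp)]
    refine Finset.sum_congr rfl fun i _ ↦ ?_
    rw [(hueq i hy).fderiv_eq]
  rw [setIntegral_congr_fun hTo.measurableSet h2,
    setIntegral_eq_integral_of_forall_compl_eq_zero, integral_finsetSum]
  · exact Finset.sum_eq_zero fun i _ ↦ (integral_fderiv_apply_eq_zero volume (huc i) (hus i) _).2
  · exact fun i _ ↦ (integral_fderiv_apply_eq_zero volume (huc i) (hus i) _).1
  · intro y hy
    refine Finset.sum_eq_zero fun i _ ↦ ?_
    have : T.indicator (u i) =ᶠ[nhds y] fun _ ↦ 0 := by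
      filter_upwards [hK'.isClosed.isOpen_compl.mem_nhds fun h ↦ hy (hsub h)] with z hz
        using hu0 i z hz
    rw [this.fderiv_eq]
    simp

/-- The divergence theorem for compactly supported forms. -/
theorem integral_divForm_eq_zero [T2Space M] [SecondCountableTopology M]
    {η : Π x : M, TangentSpace (𝓡 n) x →L[ℝ] ℝ} (hη : SmoothForm n η) {K : Set M}
    (hK : IsCompact K) (hηK : ∀ x ∉ K, η x = 0) : ∫ x, divForm η x ∂(volumeMeasure n M) = 0 := by
  have : LocallyCompactSpace M := ChartedSpace.locallyCompactSpace E M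
  obtain ⟨f, hf⟩ := SmoothPartitionOfUnity.exists_isSubordinate_chartAt_source (𝓡 n) M
  have hfin := f.locallyFinite.finite_nonempty_inter_compact hK
  set s := hfin.toFinset with hs
  -- Only the finitely many partition functions whose support meets `K` are needed: on `K` they sum
  -- to one, and off `K` the form is zero.
  have h1 : η = fun x ↦ ∑ i ∈ s, f i x • η x := by
    funext x
    by_cases hx : x ∈ K
    · rw [← Finset.sum_smul, f.sum_finsupport' x (Set.mem_univ x) fun i hi ↦ ?_, one_smul]
      rw [hs, Set.Finite.mem_toFinset]
      exact ⟨x, (SmoothPartitionOfUnity.mem_finsupport f x).1 hi, hx⟩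
    · rw [hηK x hx]
      simp
  have h2 (i : M) : SmoothForm n (fun x ↦ f i x • η x) :=
    hη.smul fun x ↦ (f i).contMDiff x
  have hcs (i : M) : ∀ x ∉ tsupport (f i) ∩ K, f i x • η x = 0 := by
    intro x hx
    by_cases hxK : x ∈ K
    · rw [image_eq_zero_of_notMem_tsupport fun h ↦ hx ⟨h, hxK⟩, zero_smul]
    · rw [hηK x hxK, smul_zero]
  have hcK (i : M) : IsCompact (tsupport (f i) ∩ K) := hK.inter_left (isClosed_tsupport _)
  have h3 (i : M) : Integrable (divForm fun x ↦ f i x • η x) (volumeMeasure n M) := by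
    refine (continuous_divForm (h2 i)).integrable_of_hasCompactSupport
      (HasCompactSupport.intro (hcK i) fun x hx ↦ ?_)
    rw [divForm_congr (η' := fun _ ↦ 0), divForm_zero]
    filter_upwards [(hcK i).isClosed.isOpen_compl.mem_nhds hx] with y hy using hcs i y hy
  rw [h1]
  simp only [(divForm_sum s _ fun i _ ↦ h2 i).2]
  rw [integral_finsetSum _ fun i _ ↦ h3 i]
  exact Finset.sum_eq_zero fun i _ ↦ integral_divForm_eq_zero_of_subset (h2 i) (hcK i)
    (Set.inter_subset_left.trans (hf i)) (hcs i)

end Volume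

/-! ### Smooth functions depending on a parameter. -/

section Families

variable {n : ℕ} {M : Type*} [TopologicalSpace M] [ChartedSpace (EuclideanSpace ℝ (Fin n)) M]
  [IsManifold (𝓡 n) ∞ M]

local notation "E" => EuclideanSpace ℝ (Fin n)

variable (n) in
/-- The function `f` on `M × ℝ` is smooth at `z`. -/
abbrev SmoothFamilyAt (f : M → ℝ → ℝ) (z : M × ℝ) : Prop :=
  ContMDiffAt ((𝓡 n).prod 𝓘(ℝ, ℝ)) 𝓘(ℝ, ℝ) ∞ (fun z : M × ℝ ↦ f z.1 z.2) z

/-- A function on `M × ℝ` in the preferred chart at `x₀`. -/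
def familyInChart (x₀ : M) (f : M → ℝ → ℝ) (p : E × ℝ) : ℝ :=
  f ((extChartAt (𝓡 n) x₀).symm p.1) p.2

variable {f : M → ℝ → ℝ} {x₀ x : M} {t : ℝ}

theorem contDiffAt_familyInChart (hx : x ∈ (chartAt E x₀).source)
    (hf : SmoothFamilyAt n f (x, t)) :
    ContDiffAt ℝ ∞ (familyInChart x₀ f) (extChartAt (𝓡 n) x₀ x, t) := by
  have hx' : x ∈ (extChartAt (𝓡 n) x₀).source := by simpa using hx
  have hy := (extChartAt (𝓡 n) x₀).map_source hx'
  have h1 : ContMDiffAt 𝓘(ℝ, E × ℝ) (𝓡 n) ∞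
      (fun p : E × ℝ ↦ (extChartAt (𝓡 n) x₀).symm p.1) (extChartAt (𝓡 n) x₀ x, t) :=
    ContMDiffAt.comp (I' := 𝓘(ℝ, E)) (g := (extChartAt (𝓡 n) x₀).symm) (f := Prod.fst)
      (extChartAt (𝓡 n) x₀ x, t)
      ((contMDiffOn_extChartAt_symm (n := ∞) x₀).contMDiffAt
        ((isOpen_extChartAt_target x₀).mem_nhds hy)) contDiff_fst.contMDiff.contMDiffAt
  have h2 := h1.prodMk (contDiff_snd.contMDiff.contMDiffAt (n := ∞)
    (x := ((extChartAt (𝓡 n) x₀ x, t) : E × ℝ)))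
  refine contMDiffAt_iff_contDiffAt.1 (ContMDiffAt.comp_of_eq hf h2 ?_)
  simp only [(extChartAt (𝓡 n) x₀).left_inv hx']

theorem smoothFamilyAt_of_contDiffAt {G : E × ℝ → ℝ} (hx : x ∈ (chartAt E x₀).source)
    (hG : ContDiffAt ℝ ∞ G (extChartAt (𝓡 n) x₀ x, t)) :
    SmoothFamilyAt n (fun y s ↦ G (extChartAt (𝓡 n) x₀ y, s)) (x, t) := by
  have h : ContMDiffAt ((𝓡 n).prod 𝓘(ℝ, ℝ)) 𝓘(ℝ, E) ∞
      (fun z : M × ℝ ↦ extChartAt (𝓡 n) x₀ z.1) (x, t) :=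
    ContMDiffAt.comp (I' := 𝓡 n) (g := extChartAt (𝓡 n) x₀) (f := Prod.fst) (x, t)
      (contMDiffAt_extChartAt' hx) contMDiffAt_fst
  exact hG.contMDiffAt.comp (x, t) (h.prodMk_space contMDiffAt_snd)

omit [IsManifold (𝓡 n) ∞ M] in
theorem familyInChart_extChartAt (hx : x ∈ (chartAt E x₀).source) (t : ℝ) :
    familyInChart x₀ f (extChartAt (𝓡 n) x₀ x, t) = f x t := by
  simp only [familyInChart, (extChartAt (𝓡 n) x₀).left_inv
    (show x ∈ (extChartAt (𝓡 n) x₀).source by simpa using hx)]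

theorem hasDerivAt_family (hx : x ∈ (chartAt E x₀).source) (hf : SmoothFamilyAt n f (x, t)) :
    HasDerivAt (f x) (fderiv ℝ (familyInChart x₀ f) (extChartAt (𝓡 n) x₀ x, t) (0, 1)) t := by
  have h := ((contDiffAt_familyInChart hx hf).differentiableAt (by simp)).hasFDerivAt.comp_hasDerivAt
    t ((hasDerivAt_const t (extChartAt (𝓡 n) x₀ x)).prodMk (hasDerivAt_id t))
  refine h.congr_of_eventuallyEq (Filter.Eventually.of_forall fun s ↦ ?_)
  exact (familyInChart_extChartAt hx s).symm

theorem hasDerivAt_deriv_family (hf : SmoothFamilyAt n f (x, t)) :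
    HasDerivAt (f x) (deriv (f x) t) t :=
  (hasDerivAt_family (mem_chart_source E x) hf).differentiableAt.hasDerivAt

omit [IsManifold (𝓡 n) ∞ M] in
theorem contMDiffAt_slice (hf : SmoothFamilyAt n f (x, t)) : SmoothFunAt n (fun y ↦ f y t) x :=
  ContMDiffAt.comp (I' := (𝓡 n).prod 𝓘(ℝ, ℝ)) (g := fun z : M × ℝ ↦ f z.1 z.2)
    (f := fun y ↦ (y, t)) x hf (contMDiffAt_id.prodMk contMDiffAt_const)

theorem mvfderiv_slice (hx : x ∈ (chartAt E x₀).source) (hf : SmoothFamilyAt n f (x, t))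
    (v : TangentSpace (𝓡 n) x) :
    mvfderiv (𝓡 n) (fun y ↦ f y t) x v =
      fderiv ℝ (familyInChart x₀ f) (extChartAt (𝓡 n) x₀ x, t) (chartDeriv x₀ x v, 0) := by
  rw [mvfderiv_eq_fderiv_extChartAt ((contMDiffAt_slice hf).mdifferentiableAt (by simp)) hx]
  have h := HasFDerivAt.comp (g := familyInChart x₀ f) (f := fun y : E ↦ (y, t))
    (extChartAt (𝓡 n) x₀ x)
    ((contDiffAt_familyInChart hx hf).differentiableAt (by simp)).hasFDerivAt
    (hasFDerivAt_prodMk_left (𝕜 := ℝ) (extChartAt (𝓡 n) x₀ x) t)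
  have h2 : (fun y ↦ f y t) ∘ (extChartAt (𝓡 n) x₀).symm =
      familyInChart x₀ f ∘ fun y ↦ (y, t) := rfl
  rw [h2, h.fderiv]
  rfl

variable {N : Set M}

theorem smoothFamilyAt_deriv (hN : IsOpen N) (hf : ∀ x ∈ N, ∀ t, SmoothFamilyAt n f (x, t))
    (hx : x ∈ N) (t : ℝ) : SmoothFamilyAt n (fun y s ↦ deriv (f y) s) (x, t) := by
  have hxs := mem_chart_source E x
  have h1 := ((contDiffAt_familyInChart hxs (hf x hx t)).fderiv_right (m := ∞) (by simp)).clm_apply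
    (contDiffAt_const (c := ((0, 1) : E × ℝ)))
  refine (smoothFamilyAt_of_contDiffAt hxs h1).congr_of_eventuallyEq ?_
  have h2 : ∀ᶠ z : M × ℝ in nhds (x, t), z.1 ∈ N ∩ (chartAt E x).source :=
    continuousAt_fst.eventually_mem
      ((hN.inter (chartAt E x).open_source).mem_nhds ⟨hx, hxs⟩)
  filter_upwards [h2] with z hz
  exact (hasDerivAt_family hz.2 (hf _ hz.1 _)).deriv

theorem smoothFamilyAt_mvfderiv (hN : IsOpen N) (hf : ∀ x ∈ N, ∀ t, SmoothFamilyAt n f (x, t))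
    (hx : x ∈ N) (t : ℝ) {X : Π x : M, TangentSpace (𝓡 n) x} (hX : SmoothFieldAt n X x) :
    SmoothFamilyAt n (fun y s ↦ mvfderiv (𝓡 n) (fun z ↦ f z s) y (X y)) (x, t) := by
  have hxs := mem_chart_source E x
  have h1 := (contDiffAt_familyInChart hxs (hf x hx t)).fderiv_right (m := ∞) (by simp)
  have h : ContMDiffAt ((𝓡 n).prod 𝓘(ℝ, ℝ)) 𝓘(ℝ, E) ∞
      (fun z : M × ℝ ↦ extChartAt (𝓡 n) x z.1) (x, t) :=
    ContMDiffAt.comp (I' := 𝓡 n) (g := extChartAt (𝓡 n) x) (f := Prod.fst) (x, t)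
      (contMDiffAt_extChartAt' hxs) contMDiffAt_fst
  have h2 : ContMDiffAt ((𝓡 n).prod 𝓘(ℝ, ℝ)) 𝓘(ℝ, E × ℝ →L[ℝ] ℝ) ∞ (fun z : M × ℝ ↦
      fderiv ℝ (familyInChart x f) (extChartAt (𝓡 n) x z.1, z.2)) (x, t) :=
    h1.contMDiffAt.comp (x, t) (h.prodMk_space contMDiffAt_snd)
  have h3 : ContMDiffAt ((𝓡 n).prod 𝓘(ℝ, ℝ)) 𝓘(ℝ, E) ∞
      (fun z : M × ℝ ↦ chartDeriv x z.1 (X z.1)) (x, t) :=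
    ContMDiffAt.comp (I' := 𝓡 n) (g := fun y ↦ chartDeriv x y (X y)) (f := Prod.fst) (x, t)
      (contMDiffAt_chartDeriv_apply hxs hX) contMDiffAt_fst
  refine (h2.clm_apply (h3.prodMk_space (contMDiffAt_const (c := (0 : ℝ))))).congr_of_eventuallyEq ?_
  have h4 : ∀ᶠ z : M × ℝ in nhds (x, t), z.1 ∈ N ∩ (chartAt E x).source :=
    continuousAt_fst.eventually_mem
      ((hN.inter (chartAt E x).open_source).mem_nhds ⟨hx, hxs⟩)
  filter_upwards [h4] with z hz
  exact mvfderiv_slice hz.2 (hf _ hz.1 _) _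

/-- In a chart both sides are mixed second derivatives of one smooth function on `E × ℝ`, equal by
symmetry. The set `N` is there because frame coefficients are smooth only near a point. -/
theorem hasDerivAt_mvfderiv_slice (hN : IsOpen N)
    (hf : ∀ x ∈ N, ∀ t, SmoothFamilyAt n f (x, t)) (hx : x ∈ N) (t : ℝ)
    (v : TangentSpace (𝓡 n) x) :
    HasDerivAt (fun s ↦ mvfderiv (𝓡 n) (fun y ↦ f y s) x v)
      (mvfderiv (𝓡 n) (fun y ↦ deriv (f y) t) x v) t := by
  have hxs := mem_chart_source E x
  set C : E × ℝ → ℝ := familyInChart x f with hC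
  have hC1 (t : ℝ) : ContDiffAt ℝ ∞ C (extChartAt (𝓡 n) x x, t) :=
    contDiffAt_familyInChart hxs (hf x hx t)
  have hC2 : HasFDerivAt (fderiv ℝ C) (fderiv ℝ (fderiv ℝ C) (extChartAt (𝓡 n) x x, t))
      (extChartAt (𝓡 n) x x, t) :=
    (((hC1 t).fderiv_right (m := ∞) (by simp)).differentiableAt (by simp)).hasFDerivAt
  have h1 : HasDerivAt (fun s ↦ fderiv ℝ C (extChartAt (𝓡 n) x x, s) (chartDeriv x x v, 0))
      (fderiv ℝ (fderiv ℝ C) (extChartAt (𝓡 n) x x, t) (0, 1) (chartDeriv x x v, 0)) t :=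
    (hC2.comp_hasDerivAt t ((hasDerivAt_const t (extChartAt (𝓡 n) x x)).prodMk
      (hasDerivAt_id t))).clm_apply (hasDerivAt_const t _) |>.congr_deriv (by simp)
  have h2 : mvfderiv (𝓡 n) (fun y ↦ deriv (f y) t) x v =
      fderiv ℝ (fderiv ℝ C) (extChartAt (𝓡 n) x x, t) (chartDeriv x x v, 0) (0, 1) := by
    rw [mvfderiv_eq_fderiv_extChartAt
      ((contMDiffAt_slice (smoothFamilyAt_deriv hN hf hx t)).mdifferentiableAt (by simp)) hxs]
    have h3 : (fun y ↦ deriv (f y) t) ∘ (extChartAt (𝓡 n) x).symm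
        =ᶠ[nhds (extChartAt (𝓡 n) x x)] fun y ↦ fderiv ℝ C (y, t) (0, 1) := by
      have h4 : ∀ᶠ y in nhds (extChartAt (𝓡 n) x x), (extChartAt (𝓡 n) x).symm y ∈ N := by
        refine (continuousAt_extChartAt_symm (I := 𝓡 n) x).eventually_mem ?_
        rw [extChartAt_to_inv]
        exact hN.mem_nhds hx
      filter_upwards [h4, (isOpen_extChartAt_target (I := 𝓡 n) x).mem_nhds
        (mem_extChartAt_target (I := 𝓡 n) x)] with y hy hyt
      have hys : (extChartAt (𝓡 n) x).symm y ∈ (chartAt E x).source := by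
        simpa using (extChartAt (𝓡 n) x).map_target hyt
      have h5 := (hasDerivAt_family hys (hf _ hy t)).deriv
      rw [(extChartAt (𝓡 n) x).right_inv hyt] at h5
      exact h5
    rw [h3.fderiv_eq]
    have h6 : HasFDerivAt (fun y ↦ fderiv ℝ C (y, t) (0, 1))
        (((fderiv ℝ (fderiv ℝ C) (extChartAt (𝓡 n) x x, t)).comp
          (ContinuousLinearMap.inl ℝ E ℝ)).flip (0, 1)) (extChartAt (𝓡 n) x x) :=
      (hC2.comp (extChartAt (𝓡 n) x x)
        (hasFDerivAt_prodMk_left (extChartAt (𝓡 n) x x) t)).clm_apply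
        (hasFDerivAt_const ((0, 1) : E × ℝ) _) |>.congr_fderiv (by ext; simp)
    rw [h6.fderiv]
    rfl
  rw [h2, (((hC1 t).of_le (m := 2) ENat.LEInfty.out).isSymmSndFDerivAt
    (by simp)).eq (chartDeriv x x v, 0) (0, 1)]
  refine h1.congr_of_eventuallyEq (Filter.Eventually.of_forall fun s ↦ ?_)
  exact mvfderiv_slice hxs (hf x hx s) v

end Families

/-! ### Smooth families of sections and local frames. -/

section SectionFamilies

variable {n : ℕ} {M : Type*} [TopologicalSpace M] [ChartedSpace (EuclideanSpace ℝ (Fin n)) M]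
  {F : Type*} [NormedAddCommGroup F] [NormedSpace ℝ F]
  {V : M → Type*} [TopologicalSpace (TotalSpace F V)]
  [∀ x, NormedAddCommGroup (V x)] [∀ x, InnerProductSpace ℝ (V x)] [FiberBundle F V]

local notation "E" => EuclideanSpace ℝ (Fin n)

variable (n F) in
/-- The family `S` of sections is smooth, in the section variable and the parameter, at `z`. -/
abbrev SmoothSectionFamilyAt (S : ℝ → Π x : M, V x) (z : M × ℝ) : Prop :=
  ContMDiffAt ((𝓡 n).prod 𝓘(ℝ, ℝ)) ((𝓡 n).prod 𝓘(ℝ, F)) ∞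
    (fun z : M × ℝ ↦ (⟨z.1, S z.2 z.1⟩ : TotalSpace F V)) z

variable {x : M} {t : ℝ}

omit [∀ x, InnerProductSpace ℝ (V x)] in
theorem SmoothSectionFamilyAt.slice {S : ℝ → Π x : M, V x}
    (hS : SmoothSectionFamilyAt n F S (x, t)) : SmoothSectionAt n F (S t) x :=
  ContMDiffAt.comp (I' := (𝓡 n).prod 𝓘(ℝ, ℝ))
    (g := fun z : M × ℝ ↦ (⟨z.1, S z.2 z.1⟩ : TotalSpace F V))
    (f := fun y ↦ (y, t)) x hS (contMDiffAt_id.prodMk contMDiffAt_const)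

omit [∀ x, InnerProductSpace ℝ (V x)] in
theorem SmoothSectionAt.const_family {s : Π x : M, V x} (hs : SmoothSectionAt n F s x) (t : ℝ) :
    SmoothSectionFamilyAt n F (fun _ ↦ s) (x, t) :=
  ContMDiffAt.comp (I' := 𝓡 n)
    (g := fun y ↦ (⟨y, s y⟩ : TotalSpace F V)) (f := Prod.fst) (x, t) hs contMDiffAt_fst

theorem SmoothFunAt.const_family {f : M → ℝ} (hf : SmoothFunAt n f x) (t : ℝ) :
    SmoothFamilyAt n (fun x _ ↦ f x) (x, t) :=
  ContMDiffAt.comp (I' := 𝓡 n) (g := f) (f := Prod.fst) (x, t) hf contMDiffAt_fst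

section VectorBundle

variable [VectorBundle ℝ F V] [IsManifold (𝓡 n) ∞ M] [ContMDiffVectorBundle ∞ F V (𝓡 n)]

omit [IsManifold (𝓡 n) ∞ M] in
theorem smoothSectionFamilyAt_iff {S : ℝ → Π x : M, V x} {z : M × ℝ}
    (e : Trivialization F (TotalSpace.proj : TotalSpace F V → M)) [MemTrivializationAtlas e]
    (hz : z.1 ∈ e.baseSet) : SmoothSectionFamilyAt n F S z ↔
      ContMDiffAt ((𝓡 n).prod 𝓘(ℝ, ℝ)) 𝓘(ℝ, F) ∞
        (fun z : M × ℝ ↦ (e ⟨z.1, S z.2 z.1⟩).2) z := by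
  have h := Trivialization.contMDiffAt_iff (IM := (𝓡 n).prod 𝓘(ℝ, ℝ)) (IB := 𝓡 n) (n := ∞)
    (e := e) (f := fun z : M × ℝ ↦ (⟨z.1, S z.2 z.1⟩ : TotalSpace F V)) (x₀ := z)
    (e.mem_source.2 hz)
  exact h.trans ⟨fun h ↦ h.2, fun h ↦ ⟨contMDiffAt_fst, h⟩⟩

omit [IsManifold (𝓡 n) ∞ M] in
theorem smoothSectionFamilyAt_sum_smul {ι : Type*} (u : Finset ι) {f : ι → M → ℝ → ℝ}
    {S : ι → ℝ → Π x : M, V x} {z : M × ℝ}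
    (hf : ∀ a ∈ u, SmoothFamilyAt n (f a) z) (hS : ∀ a ∈ u, SmoothSectionFamilyAt n F (S a) z) :
    SmoothSectionFamilyAt n F (fun t y ↦ ∑ a ∈ u, f a y t • S a t y) z := by
  set e := trivializationAt F V z.1 with he
  have hz : z.1 ∈ e.baseSet := FiberBundle.mem_baseSet_trivializationAt' z.1
  refine (smoothSectionFamilyAt_iff e hz).2 ?_
  have h1 : ∀ a ∈ u, ContMDiffAt ((𝓡 n).prod 𝓘(ℝ, ℝ)) 𝓘(ℝ, F) ∞
      (fun z : M × ℝ ↦ f a z.1 z.2 • (e ⟨z.1, S a z.2 z.1⟩).2) z :=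
    fun a ha ↦ (hf a ha).smul ((smoothSectionFamilyAt_iff e hz).1 (hS a ha))
  refine (ContMDiffAt.sum h1).congr_of_eventuallyEq ?_
  have h2 : ∀ᶠ w : M × ℝ in nhds z, w.1 ∈ e.baseSet :=
    continuousAt_fst.eventually_mem
      (e.open_baseSet.mem_nhds (FiberBundle.mem_baseSet_trivializationAt' z.1))
  filter_upwards [h2] with w hw
  have h3 (v : V w.1) : (e ⟨w.1, v⟩).2 = e.linearMapAt ℝ w.1 v := by
    rw [e.coe_linearMapAt_of_mem hw]
  simp only [h3, map_sum, map_smul]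

/-- Smooth global sections which form a frame near `x₀`, and the corresponding coefficients. -/
theorem exists_frame [T2Space M] [FiniteDimensional ℝ F] (x₀ : M) :
    ∃ (N : Set M) (s : Fin (Module.finrank ℝ F) → Π x : M, V x)
      (c : Fin (Module.finrank ℝ F) → Π x : M, V x → ℝ), IsOpen N ∧ x₀ ∈ N ∧
      (∀ a x, SmoothSectionAt n F (s a) x) ∧ (∀ x ∈ N, ∀ v, v = ∑ a, c a x v • s a x) ∧
      ∀ (S : ℝ → Π x : M, V x), ∀ x ∈ N, ∀ t, SmoothSectionFamilyAt n F S (x, t) →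
        ∀ a, SmoothFamilyAt n (fun y s ↦ c a y (S s y)) (x, t) := by
  set e := trivializationAt F V x₀ with he
  set b := Module.finBasis ℝ F with hb
  have hx₀ : x₀ ∈ e.baseSet := FiberBundle.mem_baseSet_trivializationAt' x₀
  obtain ⟨ψ, -, hψ⟩ := (SmoothBumpFunction.nhds_basis_tsupport (I := 𝓡 n) x₀).mem_iff.1
    (e.open_baseSet.mem_nhds hx₀)
  -- The bump function makes the local frame global, as the smoothness of `∇s` is used for globally
  -- smooth `s`. Where `ψ = 1` the coefficients in the trivialization are still the right ones.
  refine ⟨interior {x | ψ x = 1} ∩ e.baseSet, fun a x ↦ ψ x • e.localFrame b a x,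
    fun a x v ↦ b.repr (e ⟨x, v⟩).2 a, isOpen_interior.inter e.open_baseSet,
    ⟨mem_interior_iff_mem_nhds.2 ψ.eventuallyEq_one, hx₀⟩, fun a x ↦ ?_, fun x hx v ↦ ?_,
    fun S x hx t hS a ↦ ?_⟩
  · by_cases hx : x ∈ tsupport ψ
    · exact ContMDiffAt.smul_section ψ.contMDiffAt
        (contMDiffAt_localFrame_of_mem (I := 𝓡 n) ∞ e b a (hψ hx))
    · refine (contMDiff_zeroSection ℝ V).contMDiffAt.congr_of_eventuallyEq ?_
      filter_upwards [(isClosed_tsupport ψ).isOpen_compl.mem_nhds hx] with y hy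
      rw [image_eq_zero_of_notMem_tsupport hy, zero_smul]
      rfl
  · have h1 : ψ x = 1 := interior_subset (s := {x | ψ x = 1}) hx.1
    have h := e.eq_sum_localFrameCoeff_smul (I := 𝓡 n) (b := b) (x' := x)
      (s := FiberBundle.extend F v) hx.2
    simp only [FiberBundle.extend_apply_self] at h
    conv_lhs => rw [h]
    refine Finset.sum_congr rfl fun a _ ↦ ?_
    have h2 := e.localFrameCoeff_eq_coeff (I := 𝓡 n) (b := b) (x := x)
      (s := FiberBundle.extend F v) hx.2 (i := a)
    simp only [FiberBundle.extend_apply_self] at h2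
    rw [h2]
    simp only [h1, one_smul]
  · have h1 := (smoothSectionFamilyAt_iff e hx.2).1 hS
    exact (LinearMap.toContinuousLinearMap (b.coord a)).contDiff.contMDiff.contMDiffAt.comp _ h1

end VectorBundle

end SectionFamilies

/-! ### Covariant derivatives of families of sections. -/

section Covariant

variable {n : ℕ} {M : Type*} [TopologicalSpace M] [ChartedSpace (EuclideanSpace ℝ (Fin n)) M]
  [IsManifold (𝓡 n) ∞ M]
  {F : Type*} [NormedAddCommGroup F] [NormedSpace ℝ F]
  {V : M → Type*} [TopologicalSpace (TotalSpace F V)]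
  [∀ x, NormedAddCommGroup (V x)] [∀ x, InnerProductSpace ℝ (V x)] [FiberBundle F V]
  [VectorBundle ℝ F V] [ContMDiffVectorBundle ∞ F V (𝓡 n)]

local notation "E" => EuclideanSpace ℝ (Fin n)

theorem cov_congr (nabla : CovariantDerivative (𝓡 n) F V) {s s' : Π x : M, V x} {x : M} (hs : DiffSectionAt n F s x)
    (hs' : DiffSectionAt n F s' x) (h : ∀ᶠ y in nhds x, s y = s' y) :
    nabla s x = nabla s' x :=
  nabla.isCovariantDerivativeOnUniv.congr_of_eventuallyEq hs hs' Filter.univ_mem h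

theorem cov_sum_smul (nabla : CovariantDerivative (𝓡 n) F V) {ι : Type*} (u : Finset ι) {f : ι → M → ℝ} {s : ι → Π x : M, V x} {x : M}
    (hf : ∀ a ∈ u, DiffFunAt n (f a) x) (hs : ∀ a ∈ u, DiffSectionAt n F (s a) x) :
    DiffSectionAt n F (fun y ↦ ∑ a ∈ u, f a y • s a y) x ∧
    ∀ v, nabla (fun y ↦ ∑ a ∈ u, f a y • s a y) x v =
      ∑ a ∈ u, (f a x • nabla (s a) x v + mvfderiv (𝓡 n) (f a) x v • s a x) := by
  classical
  induction u using Finset.induction_on with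
  | empty =>
    refine ⟨mdifferentiableAt_zeroSection ℝ V, fun v ↦ ?_⟩
    have h := congrFun nabla.zero x
    simp only [Finset.sum_empty]
    exact congrArg (fun L ↦ L v) h
  | insert a u ha ih =>
    obtain ⟨h1, h2⟩ := ih (fun b hb ↦ hf b (Finset.mem_insert_of_mem hb))
      fun b hb ↦ hs b (Finset.mem_insert_of_mem hb)
    have hfa := hf a (Finset.mem_insert_self a u)
    have hsa := hs a (Finset.mem_insert_self a u)
    have h3 : DiffSectionAt n F (f a • s a) x := hfa.smul_section hsa
    simp only [Finset.sum_insert ha]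
    refine ⟨mdifferentiableAt_add_section h3 h1, fun v ↦ ?_⟩
    have h4 := nabla.isCovariantDerivativeOnUniv.add h3 h1
    have h5 := nabla.isCovariantDerivativeOnUniv.leibniz hsa hfa
    have h6 := congrArg (fun L ↦ L v) h4
    rw [h5] at h6
    rw [← h2 v]
    exact h6

variable [T2Space M] [FiniteDimensional ℝ F] {S : ℝ → Π x : M, V x}

/-- All time dependence is moved into scalar coefficients of a fixed frame. Statements about `S`,
its `t`-derivative and `∇ S` thereby reduce to statements about functions. -/
theorem exists_frame_family (hS : ∀ z, SmoothSectionFamilyAt n F S z) (x₀ : M) :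
    ∃ (N : Set M) (s : Fin (Module.finrank ℝ F) → Π x : M, V x)
      (f : Fin (Module.finrank ℝ F) → M → ℝ → ℝ), IsOpen N ∧ x₀ ∈ N ∧
      (∀ a x, SmoothSectionAt n F (s a) x) ∧ (∀ a, ∀ x ∈ N, ∀ t, SmoothFamilyAt n (f a) (x, t)) ∧
      (∀ x ∈ N, ∀ t, S t x = ∑ a, f a x t • s a x) ∧
      (∀ x ∈ N, ∀ t, HasDerivAt (fun t ↦ S t x) (∑ a, deriv (f a x) t • s a x) t) ∧
      ∀ (nabla : CovariantDerivative (𝓡 n) F V), ∀ x ∈ N, ∀ t v, nabla (S t) x v =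
        ∑ a, (f a x t • nabla (s a) x v + mvfderiv (𝓡 n) (fun y ↦ f a y t) x v • s a x) := by
  obtain ⟨N, s, c, hN, hx₀, hs, hc, hcS⟩ := exists_frame (n := n) (F := F) (V := V) x₀
  have hf : ∀ a, ∀ x ∈ N, ∀ t, SmoothFamilyAt n (fun y s ↦ c a y (S s y)) (x, t) :=
    fun a x hx t ↦ hcS S x hx t (hS _) a
  refine ⟨N, s, fun a x t ↦ c a x (S t x), hN, hx₀, hs, hf, fun x hx t ↦ hc x hx _,
    fun x hx t ↦ ?_, fun nabla x hx t v ↦ ?_⟩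
  · have h := HasDerivAt.fun_sum (u := Finset.univ)
      fun a _ ↦ (hasDerivAt_deriv_family (hf a x hx t)).smul_const (s a x)
    refine h.congr_of_eventuallyEq (Filter.Eventually.of_forall fun s ↦ ?_)
    exact hc x hx _
  · have h := cov_sum_smul nabla Finset.univ (f := fun a y ↦ c a y (S t y)) (s := s) (x := x)
      (fun a _ ↦ (contMDiffAt_slice (hf a x hx t)).mdifferentiableAt (by simp))
      fun a _ ↦ (hs a x).mdifferentiableAt (by simp)
    rw [cov_congr nabla ((hS (x, t)).slice.mdifferentiableAt (by simp)) h.1]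
    · exact h.2 v
    · filter_upwards [hN.mem_nhds hx] with y hy using hc y hy _

theorem hasDerivAt_family_section (hS : ∀ z, SmoothSectionFamilyAt n F S z) (x : M) (t : ℝ) :
    HasDerivAt (fun t ↦ S t x) (deriv (fun t ↦ S t x) t) t := by
  obtain ⟨N, s, f, hN, hx, -, -, -, h, -⟩ := exists_frame_family hS x
  exact (h x hx t).differentiableAt.hasDerivAt

theorem smoothSectionFamilyAt_deriv (hS : ∀ z, SmoothSectionFamilyAt n F S z) (z : M × ℝ) :
    SmoothSectionFamilyAt n F (fun t x ↦ deriv (fun t ↦ S t x) t) z := by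
  obtain ⟨x, t⟩ := z
  obtain ⟨N, s, f, hN, hx, hs, hf, -, h, -⟩ := exists_frame_family hS x
  refine (smoothSectionFamilyAt_sum_smul Finset.univ
    (fun a _ ↦ smoothFamilyAt_deriv hN (hf a) hx t)
    fun a _ ↦ (hs a x).const_family t).congr_of_eventuallyEq ?_
  filter_upwards [continuousAt_fst.eventually_mem (hN.mem_nhds hx)] with w hw
  rw [(h w.1 hw w.2).deriv]

variable (nabla : CovariantDerivative (𝓡 n) F V)
  [CovariantDerivative.ContMDiffCovariantDerivative nabla ∞]

theorem smoothSectionAt_cov {s : Π x : M, V x} (hs : ∀ x, SmoothSectionAt n F s x)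
    {X : Π x : M, TangentSpace (𝓡 n) x} {x : M} (hX : SmoothFieldAt n X x) :
    SmoothSectionAt n F (fun y ↦ nabla s y (X y)) x := by
  have h := CovariantDerivative.ContMDiffCovariantDerivative.contMDiff (cov := nabla) (k := ∞)
  have h1 := h.contMDiff (σ := s) (fun y _ ↦ (hs y).contMDiffWithinAt)
  exact ContMDiffAt.clm_bundle_apply (h1.contMDiffAt Filter.univ_mem) hX

theorem smoothSectionFamilyAt_cov (hS : ∀ z, SmoothSectionFamilyAt n F S z)
    {X : Π x : M, TangentSpace (𝓡 n) x} {x : M} (hX : SmoothFieldAt n X x) (t : ℝ) :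
    SmoothSectionFamilyAt n F (fun t y ↦ nabla (S t) y (X y)) (x, t) := by
  obtain ⟨N, s, f, hN, hx, hs, hf, -, -, h⟩ := exists_frame_family hS x
  have h1 := smoothSectionFamilyAt_sum_smul Finset.univ
    (fun a _ ↦ hf a x hx t) fun a _ ↦ (smoothSectionAt_cov nabla (hs a) hX).const_family t
  have h2 := smoothSectionFamilyAt_sum_smul Finset.univ
    (fun a _ ↦ smoothFamilyAt_mvfderiv hN (hf a) hx t hX) fun a _ ↦ (hs a x).const_family t
  -- The two halves of the Leibniz formula are added as a sum indexed by `Bool`.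
  have h3 := smoothSectionFamilyAt_sum_smul (Finset.univ : Finset Bool)
    (f := fun _ _ _ ↦ 1) (S := fun b t y ↦ if b then ∑ a, f a y t • nabla (s a) y (X y)
      else ∑ a, mvfderiv (𝓡 n) (fun z ↦ f a z t) y (X y) • s a y) (z := (x, t))
    (fun _ _ ↦ contMDiffAt_const) fun b _ ↦ by
      cases b
      · exact h2
      · exact h1
  refine h3.congr_of_eventuallyEq ?_
  filter_upwards [continuousAt_fst.eventually_mem (hN.mem_nhds hx)] with w hw
  rw [h nabla w.1 hw w.2]
  simp [Finset.sum_add_distrib]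

/-- The connection and the frame do not depend on `t`, so only the differentials of the coefficients
have to be exchanged with `d/dt`, which is `hasDerivAt_mvfderiv_slice`. -/
theorem hasDerivAt_cov (hS : ∀ z, SmoothSectionFamilyAt n F S z) (x : M)
    (v : TangentSpace (𝓡 n) x) (t : ℝ) :
    HasDerivAt (fun t ↦ nabla (S t) x v)
      (nabla (fun y ↦ deriv (fun t ↦ S t y) t) x v) t := by
  obtain ⟨N, s, f, hN, hx, hs, hf, -, h', h⟩ := exists_frame_family hS x
  have h1 : HasDerivAt (fun t ↦ ∑ a, (f a x t • nabla (s a) x v +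
      mvfderiv (𝓡 n) (fun y ↦ f a y t) x v • s a x)) (∑ a, (deriv (f a x) t • nabla (s a) x v +
      mvfderiv (𝓡 n) (fun y ↦ deriv (f a y) t) x v • s a x)) t :=
    HasDerivAt.fun_sum fun a _ ↦ ((hasDerivAt_deriv_family (hf a x hx t)).smul_const _).add
      ((hasDerivAt_mvfderiv_slice hN (hf a) hx t v).smul_const _)
  have h2 := cov_sum_smul nabla Finset.univ (f := fun a y ↦ deriv (f a y) t) (s := s) (x := x)
    (fun a _ ↦ (contMDiffAt_slice (smoothFamilyAt_deriv hN (hf a) hx t)).mdifferentiableAt (by simp))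
    fun a _ ↦ (hs a x).mdifferentiableAt (by simp)
  rw [cov_congr nabla ((smoothSectionFamilyAt_deriv hS (x, t)).slice.mdifferentiableAt
    (by simp)) h2.1, h2.2]
  · exact h1.congr_of_eventuallyEq (Filter.Eventually.of_forall fun s ↦ h nabla x hx s v)
  · filter_upwards [hN.mem_nhds hx] with y hy using (h' y hy t).deriv

end Covariant

/-! ### Gradients and smoothness of traces. -/

section Gradient

variable {n : ℕ} {M : Type*} [TopologicalSpace M] [ChartedSpace (EuclideanSpace ℝ (Fin n)) M]
  [IsManifold (𝓡 n) ∞ M]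

local notation "E" => EuclideanSpace ℝ (Fin n)

theorem mvfderiv_comp_hasDerivAt {f : M → ℝ} {h : ℝ → ℝ} {h' : ℝ} {x : M}
    (hh : HasDerivAt h h' (f x)) (hf : DiffFunAt n f x) (v : TangentSpace (𝓡 n) x) :
    mvfderiv (𝓡 n) (fun y ↦ h (f y)) x v = h' * mvfderiv (𝓡 n) f x v := by
  have hx := mem_chart_source E x
  have hinv : (extChartAt (𝓡 n) x).symm (extChartAt (𝓡 n) x x) = x := extChartAt_to_inv x
  have h0 : DiffFunAt n (fun y ↦ h (f y)) x :=
    MDifferentiableAt.comp (g := h) (I' := 𝓘(ℝ, ℝ)) x hh.differentiableAt.mdifferentiableAt hf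
  have h1 : DifferentiableAt ℝ (f ∘ (extChartAt (𝓡 n) x).symm) (extChartAt (𝓡 n) x x) :=
    (MDifferentiableAt.comp_of_eq (I' := 𝓡 n) (g := f) _ hf
      (mdifferentiableAt_extChartAt_symm (mem_extChartAt_target x)) hinv).differentiableAt
  rw [mvfderiv_eq_fderiv_extChartAt h0 hx, mvfderiv_eq_fderiv_extChartAt hf hx]
  have h2 := HasDerivAt.comp_hasFDerivAt (f := f ∘ (extChartAt (𝓡 n) x).symm) (h₂ := h)
    (h₂' := h') (extChartAt (𝓡 n) x x) (by simpa only [Function.comp_apply, hinv] using hh)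
    h1.hasFDerivAt
  have h3 : (fun y ↦ h (f y)) ∘ (extChartAt (𝓡 n) x).symm =
    h ∘ (f ∘ (extChartAt (𝓡 n) x).symm) := rfl
  rw [h3, h2.fderiv]
  rfl

variable [RiemannianBundle (fun x : M ↦ TangentSpace (𝓡 n) x)]

theorem inner_gradient (f : M → ℝ) {x : M} (v : TangentSpace (𝓡 n) x) :
    inner ℝ (gradient f x) v = mvfderiv (𝓡 n) f x v := by
  conv_rhs => rw [← (tangentBasis x).sum_repr' v]
  simp [gradient, sum_inner, real_inner_smul_left, mul_comm]

theorem mvfderiv_gradient (f g : M → ℝ) (x : M) :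
    mvfderiv (𝓡 n) f x (gradient g x) =
      ∑ i, mvfderiv (𝓡 n) f x (tangentBasis x i) * mvfderiv (𝓡 n) g x (tangentBasis x i) := by
  simp [gradient, mul_comm]

theorem norm_gradient_sq (f : M → ℝ) (x : M) :
    ‖gradient (n := n) f x‖ ^ 2 = mvfderiv (𝓡 n) f x (gradient f x) := by
  rw [← real_inner_self_eq_norm_sq, inner_gradient]

theorem norm_gradient_sq_eq_sum (f : M → ℝ) (x : M) :
    ‖gradient (n := n) f x‖ ^ 2 = ∑ i, mvfderiv (𝓡 n) f x (tangentBasis x i) ^ 2 := by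
  rw [norm_gradient_sq, mvfderiv_gradient]
  simp only [sq]

theorem gradient_eq_smul {f g : M → ℝ} {c : ℝ} {x : M}
    (h : ∀ v, mvfderiv (𝓡 n) f x v = c * mvfderiv (𝓡 n) g x v) :
    gradient (n := n) f x = c • gradient g x := by
  simp only [gradient, h, Finset.smul_sum, mul_smul]

variable [IsContMDiffRiemannianBundle (𝓡 n) ∞ (EuclideanSpace ℝ (Fin n))
      (fun x : M ↦ TangentSpace (𝓡 n) x)]

/-- The components of the inverse of the Gram matrix in the chart at `x₀`, as functions on `M`. -/
def gramInv (x₀ : M) (j k : Fin n) (x : M) : ℝ := (gramMatrix x₀ (extChartAt (𝓡 n) x₀ x))⁻¹ j k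

theorem smoothFunAt_gramInv {x₀ x : M} (hx : x ∈ (chartAt E x₀).source) (j k : Fin n) :
    SmoothFunAt n (gramInv x₀ j k) x := by
  have hy := (extChartAt (𝓡 n) x₀).map_source
    (show x ∈ (extChartAt (𝓡 n) x₀).source by simpa using hx)
  exact (contDiffAt_inv_apply (fun i j ↦ contDiffAt_gramMatrix hy i j)
    (det_gramMatrix_pos hy).ne' j k).contMDiffAt.comp x (contMDiffAt_extChartAt' hx)

theorem sum_tangentBasis_eq_gramInv {x₀ x : M} (hx : x ∈ (chartAt E x₀).source)
    (B : TangentSpace (𝓡 n) x →ₗ[ℝ] TangentSpace (𝓡 n) x →ₗ[ℝ] ℝ) :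
    ∑ i, B (tangentBasis x i) (tangentBasis x i) =
      ∑ j, ∑ k, gramInv x₀ j k x * B (coordFrame x₀ j x) (coordFrame x₀ k x) := by
  have hx' : x ∈ (extChartAt (𝓡 n) x₀).source := by simpa using hx
  rw [sum_orthonormalBasis_eq_sum_gram_inv (tangentBasis x) (coordBasis hx)]
  simp only [coordBasis_apply]
  have h := gramMatrix_eq_gram ((extChartAt (𝓡 n) x₀).map_source hx')
  rw [(extChartAt (𝓡 n) x₀).left_inv hx'] at h
  simp only [gramInv, h]

/-- A trace of a family of bilinear forms is smooth if the bilinear forms are smooth. -/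
theorem smoothFamilyAt_trace {x₀ : M} {t : ℝ}
    (B : ℝ → Π x : M, TangentSpace (𝓡 n) x →ₗ[ℝ] TangentSpace (𝓡 n) x →ₗ[ℝ] ℝ)
    (hB : ∀ X Y : Π x : M, TangentSpace (𝓡 n) x, SmoothFieldAt n X x₀ → SmoothFieldAt n Y x₀ →
      SmoothFamilyAt n (fun x t ↦ B t x (X x) (Y x)) (x₀, t)) :
    SmoothFamilyAt n (fun x t ↦ ∑ i, B t x (tangentBasis x i) (tangentBasis x i)) (x₀, t) := by
  -- The bases `tangentBasis x` need not depend continuously on `x`; the inverse Gram matrix and the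
  -- coordinate frame do depend smoothly on it.
  have hx := mem_chart_source E x₀
  have h : SmoothFamilyAt n (fun x t ↦ ∑ j, ∑ k, gramInv x₀ j k x *
      B t x (coordFrame x₀ j x) (coordFrame x₀ k x)) (x₀, t) :=
    ContMDiffAt.sum fun j _ ↦ ContMDiffAt.sum fun k _ ↦
      ((smoothFunAt_gramInv hx j k).const_family t).mul
        (hB _ _ (smoothFieldAt_coordFrame hx j) (smoothFieldAt_coordFrame hx k))
  refine h.congr_of_eventuallyEq ?_
  filter_upwards [continuousAt_fst.eventually_mem ((chartAt E x₀).open_source.mem_nhds hx)]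
    with w hw using sum_tangentBasis_eq_gramInv hw _

end Gradient

/-! ### The energy density along a variation. -/

section Energy

variable {n : ℕ} {M : Type*} [TopologicalSpace M] [ChartedSpace (EuclideanSpace ℝ (Fin n)) M]
  [IsManifold (𝓡 n) ∞ M] [RiemannianBundle (fun x : M ↦ TangentSpace (𝓡 n) x)]
  [IsContMDiffRiemannianBundle (𝓡 n) ∞ (EuclideanSpace ℝ (Fin n))
      (fun x : M ↦ TangentSpace (𝓡 n) x)]
  {F : Type*} [NormedAddCommGroup F] [NormedSpace ℝ F] [FiniteDimensional ℝ F]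
  {V : M → Type*} [TopologicalSpace (TotalSpace F V)]
  [∀ x, NormedAddCommGroup (V x)] [∀ x, InnerProductSpace ℝ (V x)] [FiberBundle F V]
  [VectorBundle ℝ F V] [ContMDiffVectorBundle ∞ F V (𝓡 n)] [IsContMDiffRiemannianBundle (𝓡 n) ∞ F V]

local notation "E" => EuclideanSpace ℝ (Fin n)

theorem SmoothSectionFamilyAt.inner {S T : ℝ → Π x : M, V x} {z : M × ℝ}
    (hS : SmoothSectionFamilyAt n F S z) (hT : SmoothSectionFamilyAt n F T z) :
    SmoothFamilyAt n (fun x t ↦ inner ℝ (S t x) (T t x)) z :=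
  ContMDiffAt.inner_bundle (b := Prod.fst) hS hT

theorem SmoothSectionAt.inner {s s' : Π x : M, V x} {x : M}
    (hs : SmoothSectionAt n F s x) (hs' : SmoothSectionAt n F s' x) :
    SmoothFunAt n (fun x ↦ inner ℝ (s x) (s' x)) x :=
  ContMDiffAt.inner_bundle (b := id) hs hs'

theorem halfSq_eq_inner (σ : Π x : M, V x) : halfSq σ = fun x ↦ 1 / 2 * inner ℝ (σ x) (σ x) := by
  funext x
  rw [halfSq, real_inner_self_eq_norm_sq]

theorem weight_eq (σ : Π x : M, V x) : weight σ = fun x ↦ (1 + 2 * halfSq σ x)⁻¹ := by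
  funext x
  rw [weight, halfSq, one_div]
  ring_nf

theorem one_add_two_mul_halfSq_pos (σ : Π x : M, V x) (x : M) : 0 < 1 + 2 * halfSq σ x := by
  rw [halfSq]
  positivity

theorem weight_pos (σ : Π x : M, V x) (x : M) : 0 < weight σ x := by
  rw [weight]
  positivity

theorem smoothFamilyAt_halfSq {S : ℝ → Π x : M, V x} {z : M × ℝ}
    (hS : SmoothSectionFamilyAt n F S z) :
    SmoothFamilyAt n (fun x t ↦ halfSq (S t) x) z := by
  simp only [halfSq_eq_inner]
  exact contMDiffAt_const.mul (hS.inner hS)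

/-- The derivative of `s ↦ (1 + 2 s)⁻ᵖ`. -/
theorem hasDerivAt_inv_rpow (p : ℝ) {s : ℝ} (hs : 0 < 1 + 2 * s) :
    HasDerivAt (fun s ↦ (1 + 2 * s)⁻¹ ^ p) (-2 * p * (1 + 2 * s)⁻¹ ^ (p + 1)) s := by
  have h1 : HasDerivAt (fun s : ℝ ↦ 1 + 2 * s) 2 s := by
    simpa using ((hasDerivAt_id s).const_mul 2).const_add 1
  have hpos : 0 < (1 + 2 * s)⁻¹ := inv_pos.2 hs
  have h3 : HasDerivAt (fun s : ℝ ↦ (1 + 2 * s)⁻¹) (-2 / (1 + 2 * s) ^ 2) s := h1.inv hs.ne'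
  refine (h3.rpow_const (p := p) (Or.inl hpos.ne')).congr_deriv ?_
  have h2 : (1 + 2 * s)⁻¹ ^ (p + 1) = (1 + 2 * s)⁻¹ ^ (p - 1) * (1 + 2 * s)⁻¹ ^ 2 := by
    rw [← Real.rpow_natCast, ← Real.rpow_add hpos]
    congr 1
    push_cast
    ring
  rw [h2]
  field_simp

theorem contDiffAt_inv_rpow (p : ℝ) {s : ℝ} (hs : 0 < 1 + 2 * s) :
    ContDiffAt ℝ ∞ (fun s ↦ (1 + 2 * s)⁻¹ ^ p) s :=
  ((contDiffAt_const.add (contDiffAt_const.mul contDiffAt_id)).inv hs.ne').rpow_const_of_ne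
    (inv_pos.2 hs).ne'

theorem smoothFamilyAt_weight_rpow (p : ℝ) {S : ℝ → Π x : M, V x} {z : M × ℝ}
    (hS : SmoothSectionFamilyAt n F S z) :
    SmoothFamilyAt n (fun x t ↦ weight (S t) x ^ p) z := by
  simp only [weight_eq]
  exact (contDiffAt_inv_rpow p (one_add_two_mul_halfSq_pos (S z.2) z.1)).contMDiffAt.comp z
    (smoothFamilyAt_halfSq hS)

theorem smoothFunAt_halfSq {σ : Π x : M, V x} {x : M} (hσ : SmoothSectionAt n F σ x) :
    SmoothFunAt n (halfSq σ) x :=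
  contMDiffAt_slice (f := fun x _ ↦ halfSq σ x) (t := 0)
    (smoothFamilyAt_halfSq (hσ.const_family 0))

theorem smoothFunAt_weight_rpow (p : ℝ) {σ : Π x : M, V x} {x : M}
    (hσ : SmoothSectionAt n F σ x) : SmoothFunAt n (fun x ↦ weight σ x ^ p) x :=
  contMDiffAt_slice (f := fun x _ ↦ weight σ x ^ p) (t := 0)
    (smoothFamilyAt_weight_rpow p (hσ.const_family 0))

theorem mvfderiv_weight_rpow (p : ℝ) {σ : Π x : M, V x} {x : M} (hσ : SmoothSectionAt n F σ x)
    (v : TangentSpace (𝓡 n) x) :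
    mvfderiv (𝓡 n) (fun x ↦ weight σ x ^ p) x v =
      -2 * p * weight σ x ^ (p + 1) * mvfderiv (𝓡 n) (halfSq σ) x v := by
  have h := mvfderiv_comp_hasDerivAt (n := n) (f := halfSq σ)
    (hasDerivAt_inv_rpow p (one_add_two_mul_halfSq_pos σ x))
    ((smoothFunAt_halfSq hσ).mdifferentiableAt (by simp)) v
  simpa only [weight_eq] using h

variable [T2Space M]
  (nabla : CovariantDerivative (𝓡 n) F V) [CovariantDerivative.ContMDiffCovariantDerivative nabla ∞]

theorem smoothFamilyAt_normSqCov {S : ℝ → Π x : M, V x}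
    (hS : ∀ z, SmoothSectionFamilyAt n F S z) (z : M × ℝ) :
    SmoothFamilyAt n (fun x t ↦ normSqCov nabla (S t) x) z := by
  obtain ⟨x, t⟩ := z
  have h := smoothFamilyAt_trace (x₀ := x) (t := t) (fun t x ↦ LinearMap.mk₂ ℝ
    (fun v w ↦ inner ℝ (nabla (S t) x v) (nabla (S t) x w))
    (by simp [inner_add_left]) (by simp [real_inner_smul_left])
    (by simp [inner_add_right]) (by simp [real_inner_smul_right]))
    fun X Y hX hY ↦ (smoothSectionFamilyAt_cov nabla hS hX t).inner
      (smoothSectionFamilyAt_cov nabla hS hY t)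
  simpa only [normSqCov, LinearMap.mk₂_apply, real_inner_self_eq_norm_sq] using h

theorem smoothFamilyAt_norm_gradient_sq {f : M → ℝ → ℝ} (hf : ∀ z, SmoothFamilyAt n f z)
    (z : M × ℝ) :
    SmoothFamilyAt n (fun x t ↦ ‖gradient (n := n) (fun y ↦ f y t) x‖ ^ 2) z := by
  obtain ⟨x, t⟩ := z
  have h := smoothFamilyAt_trace (x₀ := x) (t := t) (fun t x ↦ LinearMap.mk₂ ℝ
    (fun v w ↦ mvfderiv (𝓡 n) (fun y ↦ f y t) x v * mvfderiv (𝓡 n) (fun y ↦ f y t) x w)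
    (by simp [add_mul]) (by simp [mul_assoc])
    (by simp [mul_add]) (fun _ _ _ ↦ by simp only [map_smul, smul_eq_mul]; ring))
    fun X Y hX hY ↦
      (smoothFamilyAt_mvfderiv isOpen_univ (fun x _ t ↦ hf (x, t)) (Set.mem_univ x) t hX).mul
      (smoothFamilyAt_mvfderiv isOpen_univ (fun x _ t ↦ hf (x, t)) (Set.mem_univ x) t hY)
  simp only [LinearMap.mk₂_apply, ← sq] at h
  simpa only [norm_gradient_sq_eq_sum] using h

theorem smoothFamilyAt_energyDensity (p q : ℝ) {S : ℝ → Π x : M, V x}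
    (hS : ∀ z, SmoothSectionFamilyAt n F S z) (z : M × ℝ) :
    SmoothFamilyAt n (fun x t ↦ energyDensity nabla p q (S t) x) z :=
  (smoothFamilyAt_weight_rpow p (hS z)).mul ((smoothFamilyAt_normSqCov nabla hS z).add
    (contMDiffAt_const.mul (smoothFamilyAt_norm_gradient_sq
      (fun z ↦ smoothFamilyAt_halfSq (hS z)) z)))

theorem hasDerivAt_halfSq {S : ℝ → Π x : M, V x} {S' : Π x : M, V x} {x : M} {t : ℝ}
    (h : HasDerivAt (fun t ↦ S t x) (S' x) t) :
    HasDerivAt (fun t ↦ halfSq (S t) x) (inner ℝ (S t x) (S' x)) t := by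
  simp only [halfSq_eq_inner]
  refine ((h.inner ℝ h).const_mul (1 / 2)).congr_deriv ?_
  rw [real_inner_comm (S t x) (S' x)]
  ring

/-- Product rule, using `dF/dt = ⟨σ,ρ⟩` for the weight and for `∇F`. The factor `2` is kept in front
to cancel the `1/2` in the energy. -/
theorem hasDerivAt_energyDensity (p q : ℝ) {S : ℝ → Π x : M, V x}
    (hS : ∀ z, SmoothSectionFamilyAt n F S z) (x : M) (t : ℝ) {ρ : Π x : M, V x}
    (hρ : ∀ x, deriv (fun t ↦ S t x) t = ρ x) :
    HasDerivAt (fun t ↦ energyDensity nabla p q (S t) x)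
      (2 * (weight (S t) x ^ p * (∑ i, inner ℝ (nabla (S t) x (tangentBasis x i))
          (nabla ρ x (tangentBasis x i)) + q * mvfderiv (𝓡 n) (halfSq (S t)) x
            (gradient (fun y ↦ inner ℝ (S t y) (ρ y)) x))
        - p * weight (S t) x ^ (p + 1) * inner ℝ (S t x) (ρ x) *
          (normSqCov nabla (S t) x + q * ‖gradient (n := n) (halfSq (S t)) x‖ ^ 2))) t := by
  have hS' (x : M) : HasDerivAt (fun t ↦ S t x) (ρ x) t := hρ x ▸ hasDerivAt_family_section hS x t
  have h1 : HasDerivAt (fun t ↦ weight (S t) x ^ p)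
      (-2 * p * weight (S t) x ^ (p + 1) * inner ℝ (S t x) (ρ x)) t := by
    simp only [weight_eq]
    exact HasDerivAt.comp (h₂ := fun s ↦ (1 + 2 * s)⁻¹ ^ p) t
      (hasDerivAt_inv_rpow p (one_add_two_mul_halfSq_pos (S t) x)) (hasDerivAt_halfSq (hS' x))
  have hcov (v : TangentSpace (𝓡 n) x) : HasDerivAt (fun t ↦ nabla (S t) x v) (nabla ρ x v) t := by
    have h := hasDerivAt_cov nabla hS x v t
    rwa [show (fun y ↦ deriv (fun t ↦ S t y) t) = ρ from funext hρ] at h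
  have h2 : HasDerivAt (fun t ↦ normSqCov nabla (S t) x)
      (∑ i, 2 * inner ℝ (nabla (S t) x (tangentBasis x i)) (nabla ρ x (tangentBasis x i))) t := by
    refine HasDerivAt.fun_sum fun i _ ↦ ?_
    exact (hcov (tangentBasis x i)).norm_sq
  have h3 : HasDerivAt (fun t ↦ ‖gradient (n := n) (halfSq (S t)) x‖ ^ 2)
      (∑ i, 2 * (mvfderiv (𝓡 n) (halfSq (S t)) x (tangentBasis x i) *
        mvfderiv (𝓡 n) (fun y ↦ inner ℝ (S t y) (ρ y)) x (tangentBasis x i))) t := by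
    simp only [norm_gradient_sq_eq_sum]
    refine HasDerivAt.fun_sum fun i _ ↦ ?_
    have h := hasDerivAt_mvfderiv_slice isOpen_univ
      (fun x _ t ↦ smoothFamilyAt_halfSq (hS (x, t))) (Set.mem_univ x) t (tangentBasis x i)
    have h4 : (fun y ↦ deriv (fun t ↦ halfSq (S t) y) t) = fun y ↦ inner ℝ (S t y) (ρ y) :=
      funext fun y ↦ (hasDerivAt_halfSq (hS' y)).deriv
    rw [h4] at h
    exact (h.pow 2).congr_deriv (by simp; ring)
  refine (h1.fun_mul (h2.fun_add (h3.const_mul q))).congr_deriv ?_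
  rw [mvfderiv_gradient, ← Finset.mul_sum, ← Finset.mul_sum]
  ring

end Energy

/-! ### The pointwise first variation identity. -/

section FirstVariation

variable {n : ℕ} {M : Type*} [TopologicalSpace M] [ChartedSpace (EuclideanSpace ℝ (Fin n)) M]
  [IsManifold (𝓡 n) ∞ M] [RiemannianBundle (fun x : M ↦ TangentSpace (𝓡 n) x)]
  [IsContMDiffRiemannianBundle (𝓡 n) ∞ (EuclideanSpace ℝ (Fin n))
      (fun x : M ↦ TangentSpace (𝓡 n) x)]
  {F : Type*} [NormedAddCommGroup F] [NormedSpace ℝ F] [FiniteDimensional ℝ F]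
  {V : M → Type*} [TopologicalSpace (TotalSpace F V)]
  [∀ x, NormedAddCommGroup (V x)] [∀ x, InnerProductSpace ℝ (V x)] [FiberBundle F V]
  [VectorBundle ℝ F V] [ContMDiffVectorBundle ∞ F V (𝓡 n)] [IsContMDiffRiemannianBundle (𝓡 n) ∞ F V]
  [T2Space M]
  (nabla : CovariantDerivative (𝓡 n) F V)

local notation "E" => EuclideanSpace ℝ (Fin n)

/-- The one-form `⟨∇σ, ρ⟩`. -/
def pairForm (σ ρ : Π x : M, V x) (x : M) : TangentSpace (𝓡 n) x →L[ℝ] ℝ :=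
  (innerSL ℝ (ρ x)).comp (nabla σ x)

theorem pairForm_apply (σ ρ : Π x : M, V x) (x : M) (v : TangentSpace (𝓡 n) x) :
    pairForm nabla σ ρ x v = inner ℝ (nabla σ x v) (ρ x) :=
  real_inner_comm _ _

/-- The one-form whose divergence is the difference between the derivative of the energy density
and the integrand of the first variation formula. -/
def energyForm (p q : ℝ) (σ ρ : Π x : M, V x) (x : M) : TangentSpace (𝓡 n) x →L[ℝ] ℝ :=
  weight σ x ^ p • (pairForm nabla σ ρ x +
    (q * inner ℝ (σ x) (ρ x)) • mvfderiv (𝓡 n) (halfSq σ) x)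

variable [CovariantDerivative.ContMDiffCovariantDerivative nabla ∞] {σ ρ : Π x : M, V x}

theorem smoothForm_pairForm (hσ : ∀ x, SmoothSectionAt n F σ x)
    (hρ : ∀ x, SmoothSectionAt n F ρ x) : SmoothForm n (pairForm nabla σ ρ) := by
  intro x Y hY
  simp only [pairForm_apply]
  exact (smoothSectionAt_cov nabla hσ hY).inner (hρ x)

/-- Metric compatibility splits `E_i ⟨∇_{E_i} σ, ρ⟩` into two terms. The one in which `∇σ` is
differentiated, with the correction by `∇_{E_i} E_i`, is the trace of `∇²σ` paired with `ρ`. -/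
theorem divForm_pairForm (hnabla : nabla.IsMetricCompatible) (hσ : ∀ x, SmoothSectionAt n F σ x)
    (hρ : ∀ x, SmoothSectionAt n F ρ x) (x : M) :
    divForm (pairForm nabla σ ρ) x = -inner ℝ (roughLaplacian nabla σ x) (ρ x) +
      ∑ i, inner ℝ (nabla σ x (tangentBasis x i)) (nabla ρ x (tangentBasis x i)) := by
  rw [divForm, roughLaplacian, inner_neg_left, neg_neg, sum_inner, ← Finset.sum_add_distrib]
  refine Finset.sum_congr rfl fun i _ ↦ ?_
  simp only [pairForm_apply]
  have h := hnabla.mvfderiv_inner_eq (extendVector (tangentBasis x i)) (x := x)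
    (σ := fun y ↦ nabla σ y (extendVector (tangentBasis x i) y)) (τ := ρ)
    ((smoothSectionAt_cov nabla hσ (smoothFieldAt_extendVector (tangentBasis x i))).mdifferentiableAt
      (by simp)) ((hρ x).mdifferentiableAt (by simp))
  simp only [extendVector_self] at h
  rw [h, inner_sub_left]
  ring

theorem smoothForm_inner_smul_mvfderiv (q : ℝ) (hσ : ∀ x, SmoothSectionAt n F σ x)
    (hρ : ∀ x, SmoothSectionAt n F ρ x) :
    SmoothForm n (fun x ↦ (q * inner ℝ (σ x) (ρ x)) • mvfderiv (𝓡 n) (halfSq σ) x) :=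
  (smoothForm_mvfderiv fun x ↦ smoothFunAt_halfSq (hσ x)).smul
    fun x ↦ contMDiffAt_const.mul ((hσ x).inner (hρ x))

theorem smoothForm_energyForm (p q : ℝ) (hσ : ∀ x, SmoothSectionAt n F σ x)
    (hρ : ∀ x, SmoothSectionAt n F ρ x) : SmoothForm n (energyForm nabla p q σ ρ) :=
  ((smoothForm_pairForm nabla hσ hρ).add (smoothForm_inner_smul_mvfderiv q hσ hρ)).smul
    fun x ↦ smoothFunAt_weight_rpow p (hσ x)

/-- Differentiating `w^p` contributes `-2p w^(p+1) (⟨∇_{∇F} σ, ρ⟩ + q |∇F|² ⟨σ,ρ⟩)`. Combined with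
the `-pq w^(p+1) |∇F|² ⟨σ,ρ⟩` of the energy derivative, this leaves the coefficient `+pq` in the
integrand. -/
theorem divForm_energyForm (hnabla : nabla.IsMetricCompatible) (p q : ℝ)
    (hσ : ∀ x, SmoothSectionAt n F σ x) (hρ : ∀ x, SmoothSectionAt n F ρ x) (x : M) :
    divForm (energyForm nabla p q σ ρ) x =
      weight σ x ^ p * (∑ i, inner ℝ (nabla σ x (tangentBasis x i))
          (nabla ρ x (tangentBasis x i)) + q * mvfderiv (𝓡 n) (halfSq σ) x
            (gradient (fun y ↦ inner ℝ (σ y) (ρ y)) x))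
        - p * weight σ x ^ (p + 1) * inner ℝ (σ x) (ρ x) *
          (normSqCov nabla σ x + q * ‖gradient (n := n) (halfSq σ) x‖ ^ 2)
        - firstVariationIntegrand nabla p q σ ρ x := by
  have h1 := smoothForm_pairForm nabla hσ hρ
  have h2 := smoothForm_inner_smul_mvfderiv q hσ hρ
  have hin : DiffFunAt n (fun y ↦ inner ℝ (σ y) (ρ y)) x :=
    ((hσ x).inner (hρ x)).mdifferentiableAt (by simp)
  have hq : DiffFunAt n (fun y ↦ q * inner ℝ (σ y) (ρ y)) x :=
    (contMDiffAt_const.mul ((hσ x).inner (hρ x))).mdifferentiableAt (by simp)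
  have hgq : gradient (n := n) (fun y ↦ q * inner ℝ (σ y) (ρ y)) x =
      q • gradient (fun y ↦ inner ℝ (σ y) (ρ y)) x :=
    gradient_eq_smul fun v ↦ mvfderiv_comp_hasDerivAt (n := n) (h := fun s ↦ q * s)
      (f := fun y ↦ inner ℝ (σ y) (ρ y))
      (by simpa using (hasDerivAt_id (inner ℝ (σ x) (ρ x))).const_mul q) hin v
  have hgw : gradient (n := n) (fun x ↦ weight σ x ^ p) x =
      (-2 * p * weight σ x ^ (p + 1)) • gradient (halfSq σ) x :=
    gradient_eq_smul fun v ↦ mvfderiv_weight_rpow p (hσ x) v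
  rw [show energyForm nabla p q σ ρ = fun x ↦ weight σ x ^ p • (pairForm nabla σ ρ x +
    (q * inner ℝ (σ x) (ρ x)) • mvfderiv (𝓡 n) (halfSq σ) x) from rfl,
    divForm_smul (h1.add h2) ((smoothFunAt_weight_rpow p (hσ x)).mdifferentiableAt (by simp)),
    divForm_add h1 h2, divForm_smul (smoothForm_mvfderiv fun x ↦ smoothFunAt_halfSq (hσ x)) hq,
    divForm_pairForm nabla hnabla hσ hρ, hgq, hgw, ← neg_neg (divForm (mvfderiv _ _) x),
    ← laplacian_eq_neg_divForm, firstVariationIntegrand]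
  simp only [add_apply, smul_apply, smul_eq_mul, map_smul, pairForm_apply, inner_add_left,
    inner_sub_left, real_inner_smul_left, ← norm_gradient_sq]
  ring

/-- The linear variation `σ + t ρ` is smooth. -/
theorem smoothSectionFamilyAt_add_smul (hσ : ∀ x, SmoothSectionAt n F σ x)
    (hρ : ∀ x, SmoothSectionAt n F ρ x) (z : M × ℝ) :
    SmoothSectionFamilyAt n F (fun t x ↦ σ x + t • ρ x) z := by
  have h := smoothSectionFamilyAt_sum_smul (n := n) (F := F) (Finset.univ : Finset (Fin 2)) (z := z)
    (f := ![fun _ _ ↦ 1, fun _ t ↦ t]) (S := ![fun _ ↦ σ, fun _ ↦ ρ])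
    (by
      intro a _
      fin_cases a
      · exact contMDiffAt_const
      · exact contMDiffAt_snd)
    (by
      intro a _
      fin_cases a
      · exact (hσ z.1).const_family z.2
      · exact (hρ z.1).const_family z.2)
  simpa using h

theorem deriv_add_smul {W : Type*} [NormedAddCommGroup W] [NormedSpace ℝ W] (v w : W) (t : ℝ) :
    deriv (fun t : ℝ ↦ v + t • w) t = w := by
  simpa using (((hasDerivAt_id t).smul_const w).const_add v).deriv

/-- Continuity of the two Laplacians is not examined directly. The integrand is half the energy
derivative along `σ + t ρ` minus a divergence, and both of these are known to be continuous. -/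
theorem continuous_firstVariationIntegrand (hnabla : nabla.IsMetricCompatible) (p q : ℝ)
    (hσ : ∀ x, SmoothSectionAt n F σ x) (hρ : ∀ x, SmoothSectionAt n F ρ x) :
    Continuous (firstVariationIntegrand nabla p q σ ρ) := by
  obtain ⟨S, hS⟩ : ∃ S : ℝ → Π x : M, V x, S = fun t x ↦ σ x + t • ρ x := ⟨_, rfl⟩
  have hS0 : S 0 = σ := by simp [hS]
  have hSs : ∀ z, SmoothSectionFamilyAt n F S z := hS ▸ smoothSectionFamilyAt_add_smul hσ hρ
  have h1 (x : M) := hasDerivAt_energyDensity nabla p q hSs x 0 (ρ := ρ)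
    fun x ↦ by simp only [hS, deriv_add_smul]
  rw [hS0] at h1
  have h2 (x : M) : SmoothFunAt n (fun x ↦ deriv (fun t ↦ energyDensity nabla p q (S t) x) 0) x :=
    contMDiffAt_slice (smoothFamilyAt_deriv isOpen_univ
      (fun x _ t ↦ smoothFamilyAt_energyDensity nabla p q hSs (x, t)) (Set.mem_univ x) 0)
  have h3 : firstVariationIntegrand nabla p q σ ρ = fun x ↦
      1 / 2 * deriv (fun t ↦ energyDensity nabla p q (S t) x) 0 -
        divForm (energyForm nabla p q σ ρ) x := by
    funext x
    rw [(h1 x).deriv, divForm_energyForm nabla hnabla p q hσ hρ]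
    ring
  rw [h3]
  exact (continuous_const.mul (continuous_iff_continuousAt.2 fun x ↦ (h2 x).continuousAt)).sub
    (continuous_divForm (smoothForm_energyForm nabla p q hσ hρ))

theorem firstVariationIntegrand_eq_zero (p q : ℝ) {x : M} (h : ρ x = 0) :
    firstVariationIntegrand nabla p q σ ρ x = 0 := by
  simp [firstVariationIntegrand, h]

/-- Rests on `w^p = w^(p+1) (1 + 2F)`. The right-hand side exhibits the Euler-Lagrange expression,
paired pointwise with `ρ` and multiplied by a positive function. -/
theorem firstVariationIntegrand_eq (p q : ℝ) (x : M) :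
    firstVariationIntegrand nabla p q σ ρ x = weight σ x ^ (p + 1) *
      inner ℝ (opT nabla p σ x - opPhi nabla p q σ x • σ x) (ρ x) := by
  have h : weight σ x ^ p = weight σ x ^ (p + 1) * (1 + 2 * halfSq σ x) := by
    rw [Real.rpow_add_one (weight_pos σ x).ne', weight_eq, mul_assoc,
      inv_mul_cancel₀ (one_add_two_mul_halfSq_pos σ x).ne', mul_one]
  rw [firstVariationIntegrand, h, opT, opPhi]
  simp only [inner_add_left, inner_sub_left, real_inner_smul_left]
  ring

/-- The density depends only on the germ of the section, so it is constant in time off the support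
of a variation. -/
theorem energyDensity_congr (p q : ℝ) {σ' : Π x : M, V x} {x : M} (hσ : SmoothSectionAt n F σ x)
    (hσ' : SmoothSectionAt n F σ' x) (h : ∀ᶠ y in nhds x, σ y = σ' y) :
    energyDensity nabla p q σ x = energyDensity nabla p q σ' x := by
  have h1 := cov_congr nabla (hσ.mdifferentiableAt (by simp)) (hσ'.mdifferentiableAt (by simp)) h
  have h2 : halfSq σ =ᶠ[nhds x] halfSq σ' := by
    filter_upwards [h] with y hy
    rw [halfSq, halfSq, hy]
  rw [energyDensity, energyDensity, weight, weight, normSqCov, normSqCov, h1, h.self_of_nhds,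
    gradient, gradient, mvfderiv_congr_of_eventuallyEq h2]

end FirstVariation

/-! ### The integrated formula and the Euler-Lagrange equation. -/

section Integral

variable {n : ℕ} {M : Type*} [TopologicalSpace M] [T2Space M] [SecondCountableTopology M]
  [ChartedSpace (EuclideanSpace ℝ (Fin n)) M]
  [IsManifold (𝓡 n) ∞ M] [RiemannianBundle (fun x : M ↦ TangentSpace (𝓡 n) x)]
  [IsContMDiffRiemannianBundle (𝓡 n) ∞ (EuclideanSpace ℝ (Fin n))
      (fun x : M ↦ TangentSpace (𝓡 n) x)]
  [MeasurableSpace M] [BorelSpace M]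
  {F : Type*} [NormedAddCommGroup F] [NormedSpace ℝ F] [FiniteDimensional ℝ F]
  {V : M → Type*} [TopologicalSpace (TotalSpace F V)]
  [∀ x, NormedAddCommGroup (V x)] [∀ x, InnerProductSpace ℝ (V x)] [FiberBundle F V]
  [VectorBundle ℝ F V] [ContMDiffVectorBundle ∞ F V (𝓡 n)] [IsContMDiffRiemannianBundle (𝓡 n) ∞ F V]
  (nabla : CovariantDerivative (𝓡 n) F V)
  [CovariantDerivative.ContMDiffCovariantDerivative nabla ∞]

local notation "E" => EuclideanSpace ℝ (Fin n)

/-- Differentiation under the integral sign for smooth families of functions which are independent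
of the parameter outside of a compact set. -/
theorem hasDerivAt_setIntegral_family {f : M → ℝ → ℝ} (hf : ∀ z, SmoothFamilyAt n f z)
    {K U : Set M} (hU : IsCompact (closure U)) (hK : IsCompact K)
    (hfK : ∀ x ∉ K, ∀ t, f x t = f x 0) :
    HasDerivAt (fun t ↦ ∫ x in U, f x t ∂(volumeMeasure n M))
      (∫ x in U, deriv (f x) 0 ∂(volumeMeasure n M)) 0 := by
  have hslice (t : ℝ) : Continuous fun x ↦ f x t :=
    continuous_iff_continuousAt.2 fun x ↦ (contMDiffAt_slice (hf (x, t))).continuousAt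
  have hderiv (z : M × ℝ) : SmoothFamilyAt n (fun x t ↦ deriv (f x) t) z :=
    smoothFamilyAt_deriv isOpen_univ (fun x _ t ↦ hf (x, t)) (Set.mem_univ z.1) z.2
  have hdc : Continuous fun z : M × ℝ ↦ deriv (f z.1) z.2 :=
    continuous_iff_continuousAt.2 fun z ↦ (hderiv z).continuousAt
  obtain ⟨C, hC⟩ := (hK.prod (isCompact_closedBall (0 : ℝ) 1)).exists_bound_of_continuousOn
    hdc.continuousOn
  have hd0 : ∀ x ∉ K, ∀ t, deriv (f x) t = 0 := fun x hx t ↦ by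
    rw [show f x = fun _ ↦ f x 0 from funext (hfK x hx), deriv_const]
  have hfin : volumeMeasure n M U < ⊤ :=
    (measure_mono subset_closure).trans_lt hU.measure_lt_top
  -- `C` bounds the time derivative on `K × [-1, 1]`, and off `K` this derivative is zero, whence
  -- `max C 0`. A constant is integrable over `U` since `U` has compact closure.
  refine (hasDerivAt_integral_of_dominated_loc_of_deriv_le (bound := fun _ ↦ max C 0)
    (F' := fun t x ↦ deriv (f x) t) (Metric.closedBall_mem_nhds (0 : ℝ) one_pos)
    (Filter.Eventually.of_forall fun t ↦ (hslice t).aestronglyMeasurable)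
    (((hslice 0).continuousOn.integrableOn_compact hU).mono_set subset_closure)
    (continuous_iff_continuousAt.2 fun x ↦
      (contMDiffAt_slice (hderiv (x, 0))).continuousAt).aestronglyMeasurable
    (ae_of_all _ fun x t ht ↦ ?_) ?_
    (ae_of_all _ fun x t _ ↦ hasDerivAt_deriv_family (hf (x, t)))).2
  · by_cases hx : x ∈ K
    · exact (hC (x, t) ⟨hx, ht⟩).trans (le_max_left _ _)
    · rw [hd0 x hx, norm_zero]
      exact le_max_right _ _
  · exact (integrableOn_const hfin.ne)

/-- The first variation formula. -/
theorem first_variation (hnabla : nabla.IsMetricCompatible) (p q : ℝ) {σ : Π x : M, V x}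
    (hσ : ∀ x, SmoothSectionAt n F σ x) {U : Set M} (hU : IsCompact (closure U))
    {S : ℝ → Π x : M, V x} (hS : IsVariation n F σ U S) :
    (∀ t, IntegrableOn (energyDensity nabla p q (S t)) U (volumeMeasure n M)) ∧
      Integrable (firstVariationIntegrand nabla p q σ (variationField S)) (volumeMeasure n M) ∧
      HasDerivAt (fun t ↦ verticalEnergy nabla p q U (S t))
        (∫ x, firstVariationIntegrand nabla p q σ (variationField S) x ∂(volumeMeasure n M)) 0 := by
  obtain ⟨K, hK, hKU, hSK⟩ := hS.support
  have hSs : ∀ z, SmoothSectionFamilyAt n F S z := hS.smooth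
  have he := smoothFamilyAt_energyDensity nabla p q hSs
  have hρ : ∀ x, SmoothSectionAt n F (variationField S) x := fun x ↦
    (smoothSectionFamilyAt_deriv hSs (x, 0)).slice
  have hρK : ∀ x ∉ K, variationField S x = 0 := fun x hx ↦ by
    rw [variationField, show (fun t ↦ S t x) = fun _ ↦ σ x from funext fun t ↦ hSK t x hx,
      deriv_const]
  have hint : Integrable (firstVariationIntegrand nabla p q σ (variationField S))
      (volumeMeasure n M) :=
    (continuous_firstVariationIntegrand nabla hnabla p q hσ hρ).integrable_of_hasCompactSupport
      (HasCompactSupport.intro hK fun x hx ↦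
        firstVariationIntegrand_eq_zero nabla p q (hρK x hx))
  refine ⟨fun t ↦ ?_, hint, ?_⟩
  · have hc : Continuous (energyDensity nabla p q (S t)) :=
      continuous_iff_continuousAt.2 fun x ↦ (contMDiffAt_slice (he (x, t))).continuousAt
    exact (hc.continuousOn.integrableOn_compact hU).mono_set subset_closure
  have hdiv0 : ∀ x ∉ K, energyForm nabla p q σ (variationField S) x = 0 := fun x hx ↦ by
    simp [energyForm, pairForm, hρK x hx]
  have hform := smoothForm_energyForm nabla p q hσ hρ
  have hdivK : ∀ x ∉ K, divForm (energyForm nabla p q σ (variationField S)) x = 0 := fun x hx ↦ by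
    rw [divForm_congr (η' := fun _ ↦ 0), divForm_zero]
    filter_upwards [hK.isClosed.isOpen_compl.mem_nhds hx] with y hy using hdiv0 y hy
  have hdivint : Integrable (divForm (energyForm nabla p q σ (variationField S)))
      (volumeMeasure n M) :=
    (continuous_divForm hform).integrable_of_hasCompactSupport (HasCompactSupport.intro hK hdivK)
  have hderiv (x : M) : deriv (fun t ↦ energyDensity nabla p q (S t) x) 0 =
      2 * (firstVariationIntegrand nabla p q σ (variationField S) x +
        divForm (energyForm nabla p q σ (variationField S)) x) := by
    rw [(hasDerivAt_energyDensity nabla p q hSs x 0 (ρ := variationField S) fun _ ↦ rfl).deriv,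
      hS.zero, divForm_energyForm nabla hnabla p q hσ hρ]
    ring
  have h := (hasDerivAt_setIntegral_family he hU hK (fun x hx t ↦
    energyDensity_congr nabla p q (hSs (x, t)).slice (hSs (x, 0)).slice (by
      filter_upwards [hK.isClosed.isOpen_compl.mem_nhds hx] with y hy
      rw [hSK t y hy, hSK 0 y hy]))).const_mul (1 / 2)
  refine h.congr_deriv ?_
  simp only [hderiv]
  -- Both summands vanish off `K ⊆ U`, so the integral extends to all of `M`, where the divergence
  -- integrates to zero.
  rw [setIntegral_eq_integral_of_forall_compl_eq_zero fun x hx ↦ ?_, integral_const_mul,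
    integral_add hint hdivint, integral_divForm_eq_zero hform hK hdiv0]
  · ring
  · have hxK : x ∉ K := fun h ↦ hx (hKU h)
    rw [hdivK x hxK, firstVariationIntegrand_eq_zero nabla p q (hρK x hxK)]
    simp

/-- The fundamental lemma of the calculus of variations for `(p,q)`-harmonic sections. -/
theorem eq_of_isHarmonicSection (hnabla : nabla.IsMetricCompatible) (p q : ℝ) {σ : Π x : M, V x}
    (hσ : ∀ x, SmoothSectionAt n F σ x) (h : IsHarmonicSection nabla p q σ) (x₀ : M) :
    opT nabla p σ x₀ = opPhi nabla p q σ x₀ • σ x₀ := by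
  by_contra hne
  have : LocallyCompactSpace M := ChartedSpace.locallyCompactSpace E M
  obtain ⟨N, s, c, -, hx₀, hs, hc, -⟩ := exists_frame (n := n) (F := F) (V := V) x₀
  set W := opT nabla p σ x₀ - opPhi nabla p q σ x₀ • σ x₀ with hW
  -- A global smooth section with value `W` at `x₀`, obtained by freezing the frame coefficients of
  -- `W`.
  set τ : Π x : M, V x := fun x ↦ ∑ a, c a x₀ W • s a x with hτ
  have hτs (x : M) : SmoothSectionAt n F τ x :=
    (smoothSectionFamilyAt_sum_smul Finset.univ (f := fun a _ _ ↦ c a x₀ W) (S := fun a _ ↦ s a)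
      (z := (x, 0)) (fun _ _ ↦ contMDiffAt_const) fun a _ ↦ (hs a x).const_family 0).slice
  have hτ0 : τ x₀ = W := (hc x₀ hx₀ W).symm
  have hcont := continuous_firstVariationIntegrand nabla hnabla p q hσ hτs
  have hpos : 0 < firstVariationIntegrand nabla p q σ τ x₀ := by
    rw [firstVariationIntegrand_eq, hτ0, ← hW, real_inner_self_eq_norm_sq]
    have h1 : 0 < ‖W‖ := norm_pos_iff.2 (sub_ne_zero.2 hne)
    have h2 := Real.rpow_pos_of_pos (weight_pos σ x₀) (p + 1)
    positivity
  -- The bump function is supported where the integrand for `τ` is positive. The integrand is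
  -- pointwise linear in the variation field, so for `ψ τ` it is nonnegative everywhere and positive
  -- at `x₀`.
  obtain ⟨ψ, -, hψ⟩ := (SmoothBumpFunction.nhds_basis_tsupport (I := 𝓡 n) x₀).mem_iff.1
    (hcont.continuousAt.eventually (lt_mem_nhds hpos))
  have hψc : IsCompact (tsupport ψ) := ψ.hasCompactSupport
  -- The interior of `K'` serves as the relatively compact open set `U` around the support of the
  -- variation.
  obtain ⟨K', hK'c, hK'⟩ := exists_compact_superset hψc
  set ρ : Π x : M, V x := fun x ↦ ψ x • τ x with hρ
  have hρs (x : M) : SmoothSectionAt n F ρ x := ψ.contMDiffAt.smul_section (hτs x)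
  have hvar : IsVariation n F σ (interior K') (fun t x ↦ σ x + t • ρ x) := by
    refine ⟨smoothSectionFamilyAt_add_smul hσ hρs, by simp, tsupport ψ, hψc, hK',
      fun t x hx ↦ ?_⟩
    simp [hρ, image_eq_zero_of_notMem_tsupport hx]
  have hcl : IsCompact (closure (interior K')) :=
    hK'c.closure_of_subset interior_subset
  have hvf : variationField (fun t x ↦ σ x + t • ρ x) = ρ :=
    funext fun x ↦ deriv_add_smul (σ x) (ρ x) 0
  have h0 := (h _ isOpen_interior hcl _ hvar).unique
    (first_variation nabla hnabla p q hσ hcl hvar).2.2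
  rw [hvf] at h0
  have heq (x : M) : firstVariationIntegrand nabla p q σ ρ x =
      ψ x * firstVariationIntegrand nabla p q σ τ x := by
    rw [firstVariationIntegrand_eq, firstVariationIntegrand_eq, hρ, real_inner_smul_right]
    ring
  have hposint : 0 < ∫ x, firstVariationIntegrand nabla p q σ ρ x ∂(volumeMeasure n M) := by
    refine Continuous.integral_pos_of_hasCompactSupport_nonneg_nonzero (x := x₀)
      (continuous_firstVariationIntegrand nabla hnabla p q hσ hρs)
      (HasCompactSupport.intro hψc fun x hx ↦ ?_) (fun x ↦ ?_) ?_
    · rw [heq, image_eq_zero_of_notMem_tsupport hx, zero_mul]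
    · rw [heq]
      by_cases hx : x ∈ tsupport ψ
      · exact mul_nonneg ψ.nonneg (le_of_lt (hψ hx))
      · rw [image_eq_zero_of_notMem_tsupport hx, zero_mul]
        rfl
    · rw [heq, ψ.eq_one, one_mul]
      exact hpos.ne'
  exact hposint.ne h0

end Integral

end PQHarmonic

end

/-- First variation of the vertical `(p,q)`-energy of sections of a Riemannian vector bundle with
metric connection over a Riemannian manifold (without boundary), and the Euler-Lagrange equation
of `(p,q)`-harmonic sections. -/
theorem theorem3p6 {n : ℕ}
    -- a smooth Riemannian `n`-manifold
    {M : Type*} [TopologicalSpace M] [T2Space M] [SecondCountableTopology M]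
    [ChartedSpace (EuclideanSpace ℝ (Fin n)) M] [IsManifold (𝓡 n) ∞ M]
    [RiemannianBundle (fun x : M ↦ TangentSpace (𝓡 n) x)]
    [IsContMDiffRiemannianBundle (𝓡 n) ∞ (EuclideanSpace ℝ (Fin n))
      (fun x : M ↦ TangentSpace (𝓡 n) x)]
    [MeasurableSpace M] [BorelSpace M]
    -- a smooth Riemannian vector bundle of finite rank
    {F : Type*} [NormedAddCommGroup F] [NormedSpace ℝ F] [FiniteDimensional ℝ F]
    {V : M → Type*} [TopologicalSpace (TotalSpace F V)]
    [∀ x, NormedAddCommGroup (V x)] [∀ x, InnerProductSpace ℝ (V x)]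
    [FiberBundle F V] [VectorBundle ℝ F V] [ContMDiffVectorBundle ∞ F V (𝓡 n)]
    [IsContMDiffRiemannianBundle (𝓡 n) ∞ F V]
    -- a smooth connection that is compatible with the fibre metric
    (nabla : CovariantDerivative (𝓡 n) F V) [CovariantDerivative.ContMDiffCovariantDerivative nabla ∞]
    (hnabla : nabla.IsMetricCompatible)
    (p q : ℝ)
    -- a smooth section
    (σ : Π x : M, V x)
    (hσ : ContMDiff (𝓡 n) ((𝓡 n).prod 𝓘(ℝ, F)) ∞ (fun x ↦ (⟨x, σ x⟩ : TotalSpace F V))) :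
    (∀ U : Set M, IsOpen U → IsCompact (closure U) →
      ∀ S : ℝ → Π x : M, V x, PQHarmonic.IsVariation n F σ U S →
        (∀ t, IntegrableOn (PQHarmonic.energyDensity nabla p q (S t)) U
          (PQHarmonic.volumeMeasure n M)) ∧
        Integrable (PQHarmonic.firstVariationIntegrand nabla p q σ (PQHarmonic.variationField S))
          (PQHarmonic.volumeMeasure n M) ∧
        HasDerivAt (fun t ↦ PQHarmonic.verticalEnergy nabla p q U (S t))
          (∫ x, PQHarmonic.firstVariationIntegrand nabla p q σ (PQHarmonic.variationField S) x
            ∂(PQHarmonic.volumeMeasure n M)) 0) ∧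
    (PQHarmonic.IsHarmonicSection nabla p q σ ↔
      ∀ x, PQHarmonic.opT nabla p σ x = PQHarmonic.opPhi nabla p q σ x • σ x) := by
  have hσ' : ∀ x, PQHarmonic.SmoothSectionAt n F σ x := hσ
  refine ⟨fun U _ hU S hS ↦ PQHarmonic.first_variation nabla hnabla p q hσ' hU hS,
    PQHarmonic.eq_of_isHarmonicSection nabla hnabla p q hσ', fun h U _ hU S hS ↦ ?_⟩
  refine (PQHarmonic.first_variation nabla hnabla p q hσ' hU hS).2.2.congr_deriv ?_
  simp [PQHarmonic.firstVariationIntegrand_eq, h]
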